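/- Let $\mathbb S^1=\mathbb R/2\pi\mathbb Z$, and let $\alpha$ be an irrational number of bounded type: if $p_n/q_n$ are the convergents of its continued fraction, there is a constant $C>0$ with $q_{n+1}\le Cq_n$ for all $n$. For $s,K>0$ and a smooth function $f$ on $\mathbb S^1$ put $$|f|_{s,K}=\frac{4\pi^2}{3}\sup_{k\ge 0}\frac{(1+k)^2}{K^k(k!)^s}\,\sup_{x}|f^{(k)}(x)|,$$ and for matrix-valued $f$ take the maximum of this quantity over the entries. Let $G^{s,K}(\mathbb S^1,SL(2,\mathbb R))$ be the set of smooth maps $A:\mathbb S^1\to SL(2,\mathbb R)$ with $|A|_{s,K}<\infty$, and let $G^s(\mathbb S^1,SL(2,\mathbb R))=\bigcup_{K>0}G^{s,K}(\mathbb S^1,SL(2,\mathbb R))$ carry the inductive limit topology: a set is open if and only if its intersection with every $G^{s,K}$ is open for $|\cdot|_{s,K}$. For $A\in G^s(\mathbb S^1,SL(2,\mathbb R))$ let $$L(A)=\inf_{n\ge1}\frac1n\cdot\frac1{2\pi}\int_0^{2\pi}\ln\|A(x+2\pi(n-1)\alpha)\cdots A(x+2\pi\alpha)A(x)\|\,dx$$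 be the Lyapunov exponent of the quasiperiodic cocycle $(\alpha,A)$; by subadditivity the infimum is also the limit as $n\to\infty$. **Theorem.** For every $s>2$ and every sufficiently large $M>0$ (depending on $\alpha$ and $s$) the following holds for every sufficiently large $N\in\mathbb N$ (depending on $\alpha,s,M$). Put $\varepsilon=M^{-100}$, $\delta=\frac14M^{-20}$ and $\lambda=e^{q_N^{q_N}}$. There are $D_s\in G^s(\mathbb S^1,SL(2,\mathbb R))$ and a sequence $\widetilde A_n\in G^s(\mathbb S^1,SL(2,\mathbb R))$, all of whose values have the form $\begin{pmatrix}\lambda&0\\0&\lambda^{-1}\end{pmatrix}R_\theta$ with $R_\theta$ a rotation matrix, such that 1. the map $B\mapsto L(B)$ on $G^s(\mathbb S^1,SL(2,\mathbb R))$ is discontinuous at $D_s$ in the $G^s$-topology; 2. $L(D_s)\ge(1-4\varepsilon)\ln\lambda$; 3. $\widetilde A_n\to D_s$ in $G^s$, in the sense that $|\widetilde A_n-D_s|_{s,K}\to0$ as $n\to\infty$ for some $K>0$; 4. $L(\widetilde A_n)\le(1-\delta)\ln\lambda$ for all $n$. -/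

import Mathlib

open scoped ContDiff Nat ENNReal Topology

namespace GevreyLE

noncomputable section

/-- The group `SL(2, ℝ)`. -/
abbrev SL2 : Type := Matrix.SpecialLinearGroup (Fin 2) ℝ

/-- The denominator `q_n` of the `n`-th convergent `p_n / q_n` of the continued fraction expansion
of `α` (so `q_0 = 1`). -/
def convDen (α : ℝ) (n : ℕ) : ℝ := (GenContFract.of α).dens n

/-- `α` is an irrational number of bounded type: `q_{n+1} ≤ M q_n` for all `n` and some `M > 0`. -/
def IsBoundedType (α : ℝ) : Prop :=
  Irrational α ∧ ∃ M : ℝ, 0 < M ∧ ∀ n : ℕ, convDen α (n + 1) ≤ M * convDen α n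

/-- The Gevrey norm
`|f|_{s,K} = (4π²/3) sup_k (1+k)² / (K^k (k!)^s) · sup_x |f^{(k)}(x)|`, with value `∞` allowed.
Functions on the circle `ℝ / 2πℤ` are `2π`-periodic functions on `ℝ`. -/
def gevreyNorm (s K : ℝ) (f : ℝ → ℝ) : ℝ≥0∞ :=
  ENNReal.ofReal (4 * Real.pi ^ 2 / 3) *
    ⨆ k : ℕ, ENNReal.ofReal ((1 + (k : ℝ)) ^ 2 / (K ^ k * ((k ! : ℕ) : ℝ) ^ s)) *
      ⨆ x : ℝ, ‖iteratedDeriv k f x‖ₑ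

/-- The Gevrey norm of a matrix valued function: the maximum over the entries. -/
def matGevreyNorm (s K : ℝ) (F : ℝ → Matrix (Fin 2) (Fin 2) ℝ) : ℝ≥0∞ :=
  ⨆ i : Fin 2, ⨆ j : Fin 2, gevreyNorm s K (fun x => F x i j)

/-- `G^s(𝕊¹, SL(2,ℝ))`, where `𝕊¹ = ℝ / 2πℤ`: the smooth `2π`-periodic maps `A : ℝ → SL(2,ℝ)`
whose Gevrey norm `|A|_{s,K}` is finite for some `K > 0`. -/
structure GevreyCocycle (s : ℝ) where
  /-- the underlying map -/
  toFun : ℝ → SL2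
  periodic' : Function.Periodic toFun (2 * Real.pi)
  smooth' : ∀ i j : Fin 2, ContDiff ℝ ∞ (fun x => (toFun x : Matrix (Fin 2) (Fin 2) ℝ) i j)
  gevrey' : ∃ K : ℝ, 0 < K ∧
    matGevreyNorm s K (fun x => (toFun x : Matrix (Fin 2) (Fin 2) ℝ)) < ⊤

/-- Membership in the step `G^{s,K}(𝕊¹, SL(2,ℝ))`. -/
def GevreyCocycle.InStep {s : ℝ} (K : ℝ) (A : GevreyCocycle s) : Prop :=
  matGevreyNorm s K (fun x => (A.toFun x : Matrix (Fin 2) (Fin 2) ℝ)) < ⊤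

/-- The distance `|A - B|_{s,K}` (possibly infinite). -/
def gevreyDist {s : ℝ} (K : ℝ) (A B : GevreyCocycle s) : ℝ≥0∞ :=
  matGevreyNorm s K
    (fun x => (A.toFun x : Matrix (Fin 2) (Fin 2) ℝ) - (B.toFun x : Matrix (Fin 2) (Fin 2) ℝ))

/-- The inductive limit topology on `G^s = ⋃_{K > 0} G^{s,K}`: a set is open iff its trace on each
step `G^{s,K}` is open for the norm `|·|_{s,K}`. -/
instance (s : ℝ) : TopologicalSpace (GevreyCocycle s) where
  IsOpen U := ∀ K : ℝ, 0 < K → ∀ A ∈ U, A.InStep K →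
    ∃ r : ℝ≥0∞, 0 < r ∧ ∀ B : GevreyCocycle s, B.InStep K → gevreyDist K B A < r → B ∈ U
  isOpen_univ := fun _ _ _ _ _ => ⟨1, one_pos, fun _ _ _ => trivial⟩
  isOpen_inter := fun U V hU hV K hK A hA hAK => by
    obtain ⟨r, hr, h⟩ := hU K hK A hA.1 hAK
    obtain ⟨r', hr', h'⟩ := hV K hK A hA.2 hAK
    exact ⟨min r r', lt_min hr hr', fun B hBK hB =>
      ⟨h B hBK (hB.trans_le (min_le_left _ _)), h' B hBK (hB.trans_le (min_le_right _ _))⟩⟩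
  isOpen_sUnion := fun S hS K hK A hA hAK => by
    obtain ⟨U, hU, hAU⟩ := hA
    obtain ⟨r, hr, h⟩ := hS U hU K hK A hAU hAK
    exact ⟨r, hr, fun B hBK hB => ⟨U, hU, h B hBK hB⟩⟩

/-- The `n`-th iterate `A_n(x) = A(T^{n-1} x) ⋯ A(T x) A(x)` over `T x = x + 2πα`. -/
def iterate (α : ℝ) (A : ℝ → SL2) : ℕ → ℝ → SL2
  | 0, _ => 1
  | n + 1, x => A (x + n * (2 * Real.pi * α)) * iterate α A n x

/-- The Euclidean operator norm of a matrix in `SL(2,ℝ)`. -/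
def opNorm (B : SL2) : ℝ :=
  ‖Matrix.toEuclideanCLM (n := Fin 2) (𝕜 := ℝ) (B : Matrix (Fin 2) (Fin 2) ℝ)‖

/-- The Lyapunov exponent of the quasiperiodic cocycle `(α, A)`:
`L(A) = inf_{n ≥ 1} (1/n) ∫ ln ‖A_n(x)‖ dμ(x)`, `μ` the normalized Lebesgue measure of `ℝ / 2πℤ`.
The integrals form a subadditive sequence of nonnegative numbers, so the infimum is the limit. -/
def lyapunov (α : ℝ) {s : ℝ} (A : GevreyCocycle s) : ℝ :=
  ⨅ n : ℕ, (1 / ((n : ℝ) + 1)) *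
    ((1 / (2 * Real.pi)) *
      ∫ x in (0 : ℝ)..(2 * Real.pi), Real.log (opNorm (iterate α A.toFun (n + 1) x)))

/-- Every value of `A` has the form `diag(l, l⁻¹) R_θ`, with `R_θ` a rotation matrix. -/
def HasDiagRotForm (l : ℝ) {s : ℝ} (A : GevreyCocycle s) : Prop :=
  ∀ x : ℝ, ∃ θ : ℝ, (A.toFun x : Matrix (Fin 2) (Fin 2) ℝ) =
    !![l, 0; 0, l⁻¹] * !![Real.cos θ, -Real.sin θ; Real.sin θ, Real.cos θ]

end

end GevreyLE

/-! Write the values of the cocycles as Λ R with Λ = diag(λ, λ⁻¹) and R a rotation. A product M = Λ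
R ⋯ R Λ whose upper left entry is invertible is lower triangular times diagonal times upper
triangular; it is described by the slope v of the image of the first basis vector and the slope w of
that image for the transpose. When M₂ R M₁ is formed, the upper left entries multiply up to the
pivot (1, w₂) R (1, v₁)ᵀ (`LDU.merge`), so growth can only be lost where a pivot is small. Given
functions v, w and f, the rotation (`rotC`, `rotS`) is built so that the pivot for the slopes v, w
is 2f/(1+f²) · √(1+v²) · √(1+w²). The factor f is positive except at the single critical point 0 of
the circle, where it is flat like exp(-H d^(-b)), with d = |sin(x/2)| and b = 2/s.

The exponent s > 2 enters twice. The Gevrey class s/2 > 1 contains cutoffs, and a cutoff at scale r,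
like the flat factor at distance r, costs only a factor exp(C r^(-b)) in class s. Since b < 1 and α
is of bounded type, the depth τ = d^(-b) of a visit is, except on a set of points of small measure,
at most a power β < 1 of the distance in time to the ends of the orbit segment. The cost exp(L τ) of
inverting the pivots then adds up to at most exp(C₂ n) with C₂ independent of λ (`loss_add`), and
for large λ almost all of the growth λ^n survives (`SegData.ok_of_split`,
`Frame.Limit.le_lyapunov`).

The functions v and w have to be essentially the slopes of the cocycle that they define. They are
found scale by scale: in the ball of radius about r_n they are replaced by the slopes of reference
products of length N_n, which only see the orbit outside that ball. Slopes of segments with a common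
end differ by about λ^(-length) (`SegData.Family.compare`), far less than the pivot, so the
prescribed pivot is still a good approximation of the true one at the next scale
(`SegData.ok_extend`, `Frame.Stage.succ`), and the corrections are summable (`Frame.exists_limit`).

For the perturbed cocycles f is multiplied by 1 - χ, so the pivot is exactly 0 on a ball of radius
comparable to r_n. The growth accumulated over N_n steps before a visit to this ball is then
cancelled by the N_n steps after it (`matNorm_collapse_le`, `Frame.opNorm_block_le`). As N_n r_n is
bounded below, such visits waste a fixed proportion of the time, independent of n and λ
(`Frame.lyapunov_cut_le`). The perturbation is small because f is flatter than the cutoff is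
expensive (`exists_factor`).

All Gevrey estimates are made on Taylor series, in a truncated norm that is submultiplicative; real
and Gevrey statements about products are thus the same computation in a commutative ring. -/

namespace GevreyLE

/-! ### Truncated Gevrey norms on power series -/

open Finset in
/-- The truncated Gevrey norm `∑_{k ≤ t} |P_k| (k!)^{1-s}` of a power series. -/
noncomputable def jetNorm (s : ℝ) (t : ℕ) (P : PowerSeries ℝ) : ℝ :=
  ∑ k ∈ range (t + 1), |PowerSeries.coeff k P| * ((k ! : ℕ) : ℝ) ^ (1 - s)

section JetNorm

variable {s : ℝ} {t : ℕ}

lemma weight_pos (s : ℝ) (k : ℕ) : 0 < ((k ! : ℕ) : ℝ) ^ (1 - s) :=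
  Real.rpow_pos_of_pos (by exact_mod_cast k.factorial_pos) _

lemma jetNorm_nonneg (P : PowerSeries ℝ) : 0 ≤ jetNorm s t P :=
  Finset.sum_nonneg fun k _ => mul_nonneg (abs_nonneg _) (weight_pos s k).le

lemma jetNorm_add (P Q : PowerSeries ℝ) :
    jetNorm s t (P + Q) ≤ jetNorm s t P + jetNorm s t Q := by
  unfold jetNorm
  rw [← Finset.sum_add_distrib]
  refine Finset.sum_le_sum fun k _ => ?_
  rw [← add_mul, map_add]
  exact mul_le_mul_of_nonneg_right (abs_add_le _ _) (weight_pos s k).le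

lemma jetNorm_neg (P : PowerSeries ℝ) : jetNorm s t (-P) = jetNorm s t P := by
  simp [jetNorm]

lemma jetNorm_sub (P Q : PowerSeries ℝ) :
    jetNorm s t (P - Q) ≤ jetNorm s t P + jetNorm s t Q := by
  rw [sub_eq_add_neg, ← jetNorm_neg Q]; exact jetNorm_add _ _

lemma jetNorm_sub_comm (P Q : PowerSeries ℝ) :
    jetNorm s t (P - Q) = jetNorm s t (Q - P) := by
  rw [← jetNorm_neg, neg_sub]

lemma jetNorm_zero : jetNorm s t 0 = 0 := by simp [jetNorm]

lemma jetNorm_C (c : ℝ) : jetNorm s t (PowerSeries.C c) = |c| := by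
  unfold jetNorm
  rw [Finset.sum_eq_single 0]
  · simp
  · intro k _ hk; simp [PowerSeries.coeff_C, hk]
  · simp

lemma jetNorm_one : jetNorm s t 1 = 1 := by
  have := jetNorm_C (s := s) (t := t) 1
  simpa using this

/-- The exponent 1 - s is nonpositive and i! j! divides (i+j)!. This is the only use of s ≥ 1 behind
the submultiplicativity of the norm. -/
lemma factorial_weight_mul (hs : 1 ≤ s) (i j : ℕ) :
    (((i + j)! : ℕ) : ℝ) ^ (1 - s) ≤ ((i ! : ℕ) : ℝ) ^ (1 - s) * ((j ! : ℕ) : ℝ) ^ (1 - s) := by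
  rw [← Real.mul_rpow (by positivity) (by positivity)]
  refine Real.rpow_le_rpow_of_nonpos ?_ ?_ (by linarith)
  · exact_mod_cast Nat.mul_pos i.factorial_pos j.factorial_pos
  · exact_mod_cast Nat.le_of_dvd (Nat.factorial_pos _) (Nat.factorial_mul_factorial_dvd_factorial_add i j)

lemma jetNorm_mul (hs : 1 ≤ s) (P Q : PowerSeries ℝ) :
    jetNorm s t (P * Q) ≤ jetNorm s t P * jetNorm s t Q := by
  unfold jetNorm
  rw [Finset.sum_mul_sum, ← Finset.sum_product']
  set F : ℕ × ℕ → ℝ := fun p => |PowerSeries.coeff p.1 P| * ((p.1 ! : ℕ) : ℝ) ^ (1 - s) *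
      (|PowerSeries.coeff p.2 Q| * ((p.2 ! : ℕ) : ℝ) ^ (1 - s)) with hF
  have hF0 : ∀ p, 0 ≤ F p := fun p => mul_nonneg (mul_nonneg (abs_nonneg _) (weight_pos s _).le)
    (mul_nonneg (abs_nonneg _) (weight_pos s _).le)
  have h1 : ∀ k ∈ Finset.range (t + 1), |PowerSeries.coeff k (P * Q)| * ((k ! : ℕ) : ℝ) ^ (1 - s) ≤
      ∑ p ∈ Finset.HasAntidiagonal.antidiagonal k, F p := by
    intro k _
    rw [PowerSeries.coeff_mul]
    refine (mul_le_mul_of_nonneg_right (Finset.abs_sum_le_sum_abs _ _) (weight_pos s k).le).trans ?_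
    rw [Finset.sum_mul]
    refine Finset.sum_le_sum fun p hp => ?_
    rw [Finset.HasAntidiagonal.mem_antidiagonal] at hp
    have := factorial_weight_mul hs p.1 p.2
    rw [hp] at this
    rw [abs_mul]
    calc _ ≤ |PowerSeries.coeff p.1 P| * |PowerSeries.coeff p.2 Q| *
          (((p.1 ! : ℕ) : ℝ) ^ (1 - s) * ((p.2 ! : ℕ) : ℝ) ^ (1 - s)) :=
          mul_le_mul_of_nonneg_left this (by positivity)
      _ = F p := by simp only [hF]; ring
  refine (Finset.sum_le_sum h1).trans ?_
  rw [← Finset.sum_biUnion]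
  · refine Finset.sum_le_sum_of_subset_of_nonneg ?_ fun p _ _ => hF0 p
    intro p hp
    simp only [Finset.mem_biUnion, Finset.mem_range, Finset.HasAntidiagonal.mem_antidiagonal, Finset.mem_product] at hp ⊢
    omega
  · intro k _ l _ hkl
    simp only [Function.onFun, Finset.disjoint_left, Finset.HasAntidiagonal.mem_antidiagonal]
    intro p hp hq
    exact hkl (hp.symm.trans hq)

lemma jetNorm_mul_le (hs : 1 ≤ s) {P Q : PowerSeries ℝ} {a b : ℝ} (ha : jetNorm s t P ≤ a)
    (hb : jetNorm s t Q ≤ b) : jetNorm s t (P * Q) ≤ a * b :=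
  (jetNorm_mul hs P Q).trans (mul_le_mul ha hb (jetNorm_nonneg _) ((jetNorm_nonneg _).trans ha))

lemma abs_coeff_zero_le (P : PowerSeries ℝ) : |PowerSeries.constantCoeff P| ≤ jetNorm s t P := by
  unfold jetNorm
  have := Finset.single_le_sum (f := fun k => |PowerSeries.coeff k P| * ((k ! : ℕ) : ℝ) ^ (1 - s))
    (fun k _ => mul_nonneg (abs_nonneg _) (weight_pos s k).le) (Finset.mem_range.2 t.succ_pos)
  simpa using this

/-- `x` is invertible, with inverse of norm at most `B`. -/
def InvBd (s : ℝ) (t : ℕ) (x : PowerSeries ℝ) (B : ℝ) : Prop :=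
  ∃ y, x * y = 1 ∧ jetNorm s t y ≤ B

lemma InvBd.mono {x : PowerSeries ℝ} {B B' : ℝ} (h : InvBd s t x B) (hB : B ≤ B') :
    InvBd s t x B' := by
  obtain ⟨y, hy, h⟩ := h; exact ⟨y, hy, h.trans hB⟩

lemma InvBd.mul (hs : 1 ≤ s) {x x' : PowerSeries ℝ} {B B' : ℝ} (h : InvBd s t x B)
    (h' : InvBd s t x' B') : InvBd s t (x * x') (B * B') := by
  obtain ⟨y, hy, h⟩ := h
  obtain ⟨y', hy', h'⟩ := h'
  refine ⟨y * y', ?_, jetNorm_mul_le hs h h'⟩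
  linear_combination x' * y' * hy + hy'

/-- The inverse y satisfies y = 1 - e y, so its norm is at most 1 plus half of itself. No Neumann
series is needed, since the truncated norm is finite from the start. -/
lemma InvBd.of_near_one (hs : 1 ≤ s) {e : PowerSeries ℝ} (he : jetNorm s t e ≤ 1 / 2) :
    InvBd s t (1 + e) 2 := by
  have h0 : PowerSeries.constantCoeff (1 + e) ≠ 0 := by
    have h1 := (abs_coeff_zero_le (s := s) (t := t) e).trans he
    rw [map_add, map_one]
    intro h
    have : PowerSeries.constantCoeff e = -1 := by linarith
    rw [this] at h1; norm_num at h1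
  refine ⟨(1 + e)⁻¹, PowerSeries.mul_inv_cancel _ h0, ?_⟩
  have h1 : (1 + e)⁻¹ = 1 - e * (1 + e)⁻¹ := by
    linear_combination PowerSeries.mul_inv_cancel _ h0
  have h2 := jetNorm_sub (s := s) (t := t) 1 (e * (1 + e)⁻¹)
  rw [← h1, jetNorm_one] at h2
  have h3 := jetNorm_mul_le (t := t) hs he (le_refl (jetNorm s t (1 + e)⁻¹))
  linarith

/-- Perturbation of an invertible element. -/
lemma InvBd.perturb (hs : 1 ≤ s) {x x' : PowerSeries ℝ} {B : ℝ} (h : InvBd s t x B)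
    (hx : B * jetNorm s t (x' - x) ≤ 1 / 2) : InvBd s t x' (2 * B) := by
  obtain ⟨y, hy, hB⟩ := h
  have h1 : InvBd s t (1 + y * (x' - x)) 2 := by
    refine InvBd.of_near_one hs ?_
    exact (jetNorm_mul_le hs hB le_rfl).trans hx
  obtain ⟨z, hz, hz2⟩ := h1
  refine ⟨y * z, ?_, ?_⟩
  · linear_combination hz + (z - y * z * (x' - x) + y * z * (x' - x)) * hy
  · rw [mul_comm 2 B]; exact jetNorm_mul_le hs hB hz2

lemma jetNorm_rescale_le {θ : ℝ} (h0 : 0 ≤ θ) (h1 : θ ≤ 1) (P : PowerSeries ℝ) :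
    jetNorm s t (PowerSeries.rescale θ P) ≤ jetNorm s t P := by
  refine Finset.sum_le_sum fun k _ => mul_le_mul_of_nonneg_right ?_ (weight_pos s k).le
  rw [PowerSeries.coeff_rescale, abs_mul, abs_of_nonneg (pow_nonneg h0 k)]
  exact mul_le_of_le_one_left (abs_nonneg _) (pow_le_one₀ h0 h1)

lemma continuous_jetNorm_rescale (P : PowerSeries ℝ) :
    Continuous fun θ : ℝ => jetNorm s t (PowerSeries.rescale θ P) := by
  unfold jetNorm
  simp only [PowerSeries.coeff_rescale]
  fun_prop

/-- The norm of a square root near `1`. -/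
lemma jetNorm_sqrt_sub_one (hs : 1 ≤ s) {u g : PowerSeries ℝ} (hu : u * u = 1 + g)
    (hpos : 0 < PowerSeries.constantCoeff u) (hg : jetNorm s t g ≤ 1 / 2) :
    jetNorm s t (u - 1) ≤ jetNorm s t g := by
  set G := jetNorm s t g
  -- The equation 2(u-1) = g - (u-1)² gives 2y ≤ G + y², which leaves a small branch y ≤ G and a
  -- large one y > 1. Rescaling the variable by θ connects u with its constant term, which lies on
  -- the small branch, and continuity forbids a jump.
  set y : ℝ → ℝ := fun θ => jetNorm s t (PowerSeries.rescale θ (u - 1)) with hy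
  have hG0 : 0 ≤ G := jetNorm_nonneg _
  have key : ∀ θ : ℝ, 0 ≤ θ → θ ≤ 1 → 2 * y θ ≤ G + y θ * y θ := by
    intro θ h0 h1
    have e : u - 1 + (u - 1) = g - (u - 1) * (u - 1) := by linear_combination hu
    have e2 : PowerSeries.rescale θ (u - 1) + PowerSeries.rescale θ (u - 1) =
        PowerSeries.rescale θ g - PowerSeries.rescale θ (u - 1) * PowerSeries.rescale θ (u - 1) := by
      rw [← map_add, e, map_sub, map_mul]
    have e3 : 2 * y θ = jetNorm s t (PowerSeries.rescale θ (u - 1) + PowerSeries.rescale θ (u - 1)) := by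
      simp only [hy, jetNorm, map_add]
      rw [Finset.mul_sum]
      refine Finset.sum_congr rfl fun k _ => ?_
      rw [← two_mul, abs_mul, abs_two, mul_assoc]
    rw [e3, e2]
    refine (jetNorm_sub _ _).trans (add_le_add (jetNorm_rescale_le h0 h1 g) (jetNorm_mul hs _ _))
  have hno : ∀ θ : ℝ, 0 ≤ θ → θ ≤ 1 → y θ ≤ 1 → y θ ≤ G := by
    intro θ h0 h1 h
    have := key θ h0 h1
    have h2 : 0 ≤ y θ := jetNorm_nonneg _
    nlinarith
  have hone : y 1 = jetNorm s t (u - 1) := by simp [hy]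
  have hzero : y 0 ≤ 1 := by
    have hu2 := congrArg PowerSeries.constantCoeff hu
    simp only [map_mul, map_add, map_one] at hu2
    have hg0 := (abs_coeff_zero_le (s := s) (t := t) g).trans hg
    have : y 0 = |PowerSeries.constantCoeff u - 1| := by
      simp only [hy, PowerSeries.rescale_zero, RingHom.comp_apply, jetNorm_C]
      simp
    rw [this, abs_le]
    rw [abs_le] at hg0
    constructor <;> nlinarith
  rw [← hone]
  refine hno 1 zero_le_one le_rfl ?_
  by_contra hcon
  push Not at hcon
  have hcont : ContinuousOn y (Set.Icc 0 1) := (continuous_jetNorm_rescale _).continuousOn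
  have h0 := hno 0 le_rfl zero_le_one hzero
  have := intermediate_value_Icc (zero_le_one (α := ℝ)) hcont
  -- Any value strictly between the bound 1/2 for G and 1 separates the branches.
  obtain ⟨θ, hθ, hθ1⟩ := this (show (3 / 4 : ℝ) ∈ Set.Icc (y 0) (y 1) from ⟨by linarith, by linarith⟩)
  have := hno θ hθ.1 hθ.2 (by linarith)
  linarith

end JetNorm

/-! ### Taylor series as a ring homomorphism, and their norms -/

/-- The Taylor series of `g` at `x`. -/
noncomputable def jet (g : ℝ → ℝ) (x : ℝ) : PowerSeries ℝ :=
  PowerSeries.mk fun k => iteratedDeriv k g x / ((k ! : ℕ) : ℝ)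

section Jet

lemma coeff_jet (g : ℝ → ℝ) (x : ℝ) (k : ℕ) :
    PowerSeries.coeff k (jet g x) = iteratedDeriv k g x / ((k ! : ℕ) : ℝ) := by
  simp [jet]

lemma constantCoeff_jet (g : ℝ → ℝ) (x : ℝ) : PowerSeries.constantCoeff (jet g x) = g x := by
  rw [← PowerSeries.coeff_zero_eq_constantCoeff_apply, coeff_jet]; simp

lemma jet_congr {g h : ℝ → ℝ} {x : ℝ} (e : g =ᶠ[𝓝 x] h) : jet g x = jet h x := by
  ext k; rw [coeff_jet, coeff_jet, e.iteratedDeriv_eq]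

lemma jet_const (c x : ℝ) : jet (fun _ => c) x = PowerSeries.C c := by
  ext k
  rw [coeff_jet, iteratedDeriv_const, PowerSeries.coeff_C]
  split_ifs with h <;> simp [h]

variable {g h : ℝ → ℝ} {x : ℝ}

lemma jet_add (hg : ContDiffAt ℝ ∞ g x) (hh : ContDiffAt ℝ ∞ h x) :
    jet (fun y => g y + h y) x = jet g x + jet h x := by
  ext k
  rw [map_add, coeff_jet, coeff_jet, coeff_jet,
    iteratedDeriv_fun_add (hg.of_le (by exact_mod_cast le_top)) (hh.of_le (by exact_mod_cast le_top)),
    add_div]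

lemma jet_neg : jet (fun y => -g y) x = -jet g x := by
  ext k
  rw [map_neg, coeff_jet, coeff_jet, iteratedDeriv_fun_neg, neg_div]

lemma jet_sub (hg : ContDiffAt ℝ ∞ g x) (hh : ContDiffAt ℝ ∞ h x) :
    jet (fun y => g y - h y) x = jet g x - jet h x := by
  simp only [sub_eq_add_neg]
  rw [jet_add hg hh.neg, jet_neg]

lemma jet_mul (hg : ContDiffAt ℝ ∞ g x) (hh : ContDiffAt ℝ ∞ h x) :
    jet (fun y => g y * h y) x = jet g x * jet h x := by
  ext k
  rw [PowerSeries.coeff_mul, coeff_jet,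
    iteratedDeriv_fun_mul (hg.of_le (by exact_mod_cast le_top)) (hh.of_le (by exact_mod_cast le_top)),
    Finset.Nat.sum_antidiagonal_eq_sum_range_succ_mk, Finset.sum_div]
  refine Finset.sum_congr rfl fun i hi => ?_
  have hik : i ≤ k := Nat.lt_succ_iff.1 (Finset.mem_range.1 hi)
  rw [coeff_jet, coeff_jet, Nat.cast_choose ℝ hik]
  have h1 : ((i ! : ℕ) : ℝ) ≠ 0 := by positivity
  have h2 : (((k - i)! : ℕ) : ℝ) ≠ 0 := by positivity
  have h3 : ((k ! : ℕ) : ℝ) ≠ 0 := by positivity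
  field_simp

lemma jet_inv (hg : ContDiffAt ℝ ∞ g x) (h0 : g x ≠ 0) :
    jet (fun y => (g y)⁻¹) x = (jet g x)⁻¹ := by
  have h1 : jet g x * jet (fun y => (g y)⁻¹) x = 1 := by
    have h2 : jet (fun y => g y * (g y)⁻¹) x = jet g x * jet (fun y => (g y)⁻¹) x :=
      jet_mul hg (hg.inv h0)
    rw [← h2, ← map_one PowerSeries.C, ← jet_const 1 x]
    refine jet_congr ?_
    filter_upwards [hg.continuousAt.eventually_ne h0] with y hy using mul_inv_cancel₀ hy
  have h2 := PowerSeries.mul_inv_cancel (jet g x) (by rwa [constantCoeff_jet])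
  linear_combination (jet g x)⁻¹ * h1 - jet (fun y => (g y)⁻¹) x * h2

lemma jet_comp_add (g : ℝ → ℝ) (x a : ℝ) : jet (fun y => g (y + a)) x = jet g (x + a) := by
  ext k
  rw [coeff_jet, coeff_jet, iteratedDeriv_comp_add_const]

lemma jetNorm_jet (s : ℝ) (t : ℕ) (g : ℝ → ℝ) (x : ℝ) :
    jetNorm s t (jet g x) =
      ∑ k ∈ Finset.range (t + 1), |iteratedDeriv k g x| * ((k ! : ℕ) : ℝ) ^ (-s) := by
  refine Finset.sum_congr rfl fun k _ => ?_
  have h3 : 0 < ((k ! : ℕ) : ℝ) := by positivity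
  rw [coeff_jet, abs_div, abs_of_pos h3, sub_eq_add_neg, Real.rpow_add h3, Real.rpow_one]
  field_simp

lemma abs_iteratedDeriv_le_jetNorm (s : ℝ) (k : ℕ) (g : ℝ → ℝ) (x : ℝ) :
    |iteratedDeriv k g x| ≤ ((k ! : ℕ) : ℝ) ^ s * jetNorm s k (jet g x) := by
  have h3 : 0 < ((k ! : ℕ) : ℝ) := by positivity
  rw [jetNorm_jet]
  have := Finset.single_le_sum (f := fun i => |iteratedDeriv i g x| * ((i ! : ℕ) : ℝ) ^ (-s))
    (fun i _ => mul_nonneg (abs_nonneg _) (Real.rpow_nonneg (by positivity) _))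
    (Finset.mem_range.2 k.lt_succ_self)
  refine le_trans ?_ (mul_le_mul_of_nonneg_left this (Real.rpow_nonneg h3.le _))
  rw [Real.rpow_neg h3.le]
  have : 0 < ((k ! : ℕ) : ℝ) ^ s := Real.rpow_pos_of_pos h3 _
  apply le_of_eq
  field_simp

/-- A geometric-factorial bound of the derivatives bounds the jet norm. -/
lemma sum_pow_factorial_le {σ A : ℝ} (hσ : 0 < σ) (hA : 0 ≤ A) (t : ℕ) :
    ∑ k ∈ Finset.range (t + 1), A ^ k * ((k ! : ℕ) : ℝ) ^ (-σ) ≤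
      2 * Real.exp (σ * (2 * A) ^ (1 / σ)) := by
  -- The bound a^k / k! ≤ exp a raised to the power σ becomes (2A)^k (k!)^(-σ) ≤ exp(σ a); the spare
  -- factor 2^(-k) makes the sum converge.
  set a : ℝ := (2 * A) ^ (1 / σ) with ha
  have ha0 : 0 ≤ a := Real.rpow_nonneg (by positivity) _
  have haσ : a ^ σ = 2 * A := by
    rw [ha, ← Real.rpow_mul (by positivity), one_div, inv_mul_cancel₀ hσ.ne', Real.rpow_one]
  have hterm : ∀ k ∈ Finset.range (t + 1), A ^ k * ((k ! : ℕ) : ℝ) ^ (-σ) ≤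
      (1 / 2) ^ k * Real.exp (σ * a) := by
    intro k _
    have h3 : 0 < ((k ! : ℕ) : ℝ) := by positivity
    have h1 : a ^ k / ((k ! : ℕ) : ℝ) ≤ Real.exp a := Real.pow_div_factorial_le_exp a ha0 k
    have h2 := Real.rpow_le_rpow (by positivity) h1 hσ.le
    rw [← Real.exp_mul, mul_comm a σ, Real.div_rpow (by positivity) h3.le, ← Real.rpow_natCast a k,
      ← Real.rpow_mul ha0, mul_comm (k : ℝ), Real.rpow_mul ha0, haσ, Real.rpow_natCast] at h2
    rw [Real.rpow_neg h3.le]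
    calc A ^ k * (((k ! : ℕ) : ℝ) ^ σ)⁻¹ = (1 / 2) ^ k * ((2 * A) ^ k / ((k ! : ℕ) : ℝ) ^ σ) := by
          rw [mul_pow, one_div, inv_pow]; field_simp
      _ ≤ _ := mul_le_mul_of_nonneg_left h2 (by positivity)
  refine (Finset.sum_le_sum hterm).trans ?_
  rw [← Finset.sum_mul]
  refine mul_le_mul_of_nonneg_right ?_ (Real.exp_pos _).le
  have := Summable.sum_le_tsum (Finset.range (t + 1)) (fun k _ => by positivity) summable_geometric_two
  rwa [tsum_geometric_two] at this

/-- The spare Gevrey exponent σ pays for the radius 1/A. With A proportional to 1/r this produces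
the cost exp(C r^(-1/σ)) of working at scale r, which fixes the depth exponent b = 1/σ used
throughout. -/
lemma jetNorm_jet_le_of_bound {s σ A B : ℝ} (hσ : 0 < σ) (hA : 0 ≤ A) (t : ℕ)
    (hb : ∀ k, |iteratedDeriv k g x| ≤ B * A ^ k * ((k ! : ℕ) : ℝ) ^ (s - σ)) :
    jetNorm s t (jet g x) ≤ B * (2 * Real.exp (σ * (2 * A) ^ (1 / σ))) := by
  have hB : 0 ≤ B := by have := (abs_nonneg _).trans (hb 0); simpa using this
  rw [jetNorm_jet]
  refine le_trans ?_ (mul_le_mul_of_nonneg_left (sum_pow_factorial_le hσ hA t) hB)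
  rw [Finset.mul_sum]
  refine Finset.sum_le_sum fun k _ => ?_
  have h3 : 0 < ((k ! : ℕ) : ℝ) := by positivity
  refine (mul_le_mul_of_nonneg_right (hb k) (Real.rpow_nonneg h3.le _)).trans (le_of_eq ?_)
  rw [mul_assoc (B * A ^ k), ← Real.rpow_add h3]
  ring_nf

end Jet

/-! ### Algebra of products along orbit segments -/

section SegmentAlgebra

variable {R : Type*} [CommRing R]

/-- The matrix `(c, -σ; σ, c)`. -/
def rot (c σ : R) : Matrix (Fin 2) (Fin 2) R := !![c, -σ; σ, c]

/-- The product `Λ R_{a+n-1} Λ ⋯ R_a Λ` with `Λ = diag(l, l')`. -/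
def seg (l l' : R) (c σ : ℤ → R) (a : ℤ) : ℕ → Matrix (Fin 2) (Fin 2) R
  | 0 => !![l, 0; 0, l']
  | n + 1 => !![l, 0; 0, l'] * rot (c (a + n)) (σ (a + n)) * seg l l' c σ a n

lemma seg_split (l l' : R) (c σ : ℤ → R) (a : ℤ) (i j : ℕ) :
    seg l l' c σ a (i + 1 + j) =
      seg l l' c σ (a + i + 1) j * rot (c (a + i)) (σ (a + i)) * seg l l' c σ a i := by
  induction j with
  | zero => rfl
  | succ j ih =>
    rw [← add_assoc, seg, ih, seg]
    have : a + ((i + 1 + j : ℕ) : ℤ) = a + i + 1 + j := by push_cast; ring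
    rw [this]
    simp only [Matrix.mul_assoc]

lemma seg_congr {l l' : R} {c σ c' σ' : ℤ → R} {a : ℤ} {n : ℕ}
    (h : ∀ i < n, c (a + i) = c' (a + i) ∧ σ (a + i) = σ' (a + i)) :
    seg l l' c σ a n = seg l l' c' σ' a n := by
  induction n with
  | zero => rfl
  | succ n ih =>
    rw [seg, seg, ih fun i hi => h i (by omega), (h n (by omega)).1, (h n (by omega)).2]

/-- Transposition reverses the order of the factors, fixes the diagonal ones and changes the sign of
the sines. It turns every statement about slopes into one about coslopes. -/
lemma seg_transpose (l l' : R) (c σ : ℤ → R) (a : ℤ) (n : ℕ) :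
    (seg l l' c σ a n).transpose =
      seg l l' (fun m => c (-m)) (fun m => -σ (-m)) (-a - n + 1) n := by
  induction n with
  | zero =>
    ext i j; fin_cases i <;> fin_cases j <;> simp [seg]
  | succ n ih =>
    have h1 := seg_split l l' (fun m => c (-m)) (fun m => -σ (-m)) (-a - (n + 1 : ℕ) + 1) 0 n
    have h2 : 0 + 1 + n = n + 1 := by omega
    rw [h2] at h1
    have h5 : seg l l' c σ a (n + 1) =
        !![l, 0; 0, l'] * rot (c (a + n)) (σ (a + n)) * seg l l' c σ a n := rfl
    have h6 : seg l l' (fun m => c (-m)) (fun m => -σ (-m)) (-a - (n + 1 : ℕ) + 1) 0 =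
        !![l, 0; 0, l'] := rfl
    rw [h1, h5, h6, Matrix.transpose_mul, Matrix.transpose_mul, ih]
    have h3 : -a - ((n + 1 : ℕ) : ℤ) + 1 + ((0 : ℕ) : ℤ) + 1 = -a - n + 1 := by push_cast; ring
    have h4 : -(-a - ((n + 1 : ℕ) : ℤ) + 1 + ((0 : ℕ) : ℤ)) = a + n := by push_cast; ring
    rw [h3]
    simp only [h4]
    rw [Matrix.mul_assoc]
    congr 2
    · ext i j; fin_cases i <;> fin_cases j <;> simp [rot]
    · ext i j; fin_cases i <;> fin_cases j <;> simp

/-- The pivot `(1, w) R (1, v)ᵀ` of a rotation `R`. -/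
def kap (c σ w v : R) : R := c * (1 + w * v) + σ * (w - v)

/-- `M = (1, 0; v, 1) diag(p, q) (1, w; 0, 1)` with `p q = 1`. -/
structure LDU (M : Matrix (Fin 2) (Fin 2) R) (p q v w : R) : Prop where
  h00 : M 0 0 = p
  h01 : M 0 1 = p * w
  h10 : M 1 0 = p * v
  h11 : M 1 1 = q + p * v * w
  hpq : p * q = 1

/-- The determinant forces the last entry, so a merge only has to be computed in three entries. -/
lemma LDU.of_det {M : Matrix (Fin 2) (Fin 2) R} {p q v w : R} (hd : M.det = 1) (h00 : M 0 0 = p)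
    (h01 : M 0 1 = p * w) (h10 : M 1 0 = p * v) (hpq : p * q = 1) : LDU M p q v w := by
  refine ⟨h00, h01, h10, ?_, hpq⟩
  rw [Matrix.det_fin_two, h00, h01, h10] at hd
  linear_combination q * hd + (p * v * w - M 1 1) * hpq

lemma LDU.det {M : Matrix (Fin 2) (Fin 2) R} {p q v w : R} (h : LDU M p q v w) : M.det = 1 := by
  rw [Matrix.det_fin_two, h.h00, h.h01, h.h10, h.h11]
  linear_combination h.hpq

lemma LDU.transpose {M : Matrix (Fin 2) (Fin 2) R} {p q v w : R} (h : LDU M p q v w) :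
    LDU M.transpose p q w v :=
  ⟨h.h00, h.h10, h.h01, by rw [Matrix.transpose_apply, h.h11]; ring, h.hpq⟩

/-- The basic step of the estimates. The inverse q of the large entry picks up only the inverse k of
the pivot, and the slope of the left factor changes by a term containing q₂², hence exponentially
small in its length. -/
lemma LDU.merge {M₂ M₁ : Matrix (Fin 2) (Fin 2) R} {p₁ q₁ v₁ w₁ p₂ q₂ v₂ w₂ c σ k : R}
    (h₂ : LDU M₂ p₂ q₂ v₂ w₂) (h₁ : LDU M₁ p₁ q₁ v₁ w₁) (hc : c * c + σ * σ = 1)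
    (hk : kap c σ w₂ v₁ * k = 1) :
    LDU (M₂ * rot c σ * M₁) (p₂ * kap c σ w₂ v₁ * p₁) (q₁ * k * q₂)
      (v₂ + (σ + c * v₁) * k * (q₂ * q₂)) (w₁ + (c * w₂ - σ) * k * (q₁ * q₁)) := by
  have e1 := h₁.hpq
  have e2 := h₂.hpq
  have a0 : (M₂ * rot c σ * M₁) 0 0 = p₂ * kap c σ w₂ v₁ * p₁ := by
    simp only [Matrix.mul_apply, Fin.sum_univ_two, h₁.h00, h₁.h10, h₂.h00, h₂.h01, rot, kap,
      Matrix.of_apply, Matrix.cons_val_zero, Matrix.cons_val_one, Matrix.cons_val', Matrix.cons_val_fin_one]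
    ring
  refine LDU.of_det ?_ a0 ?_ ?_ ?_
  · rw [Matrix.det_mul, Matrix.det_mul, h₁.det, h₂.det, rot, Matrix.det_fin_two_of]
    linear_combination hc
  · have : (M₂ * rot c σ * M₁) 0 1 = p₂ * kap c σ w₂ v₁ * p₁ * w₁ + p₂ * q₁ * (c * w₂ - σ) := by
      simp only [Matrix.mul_apply, Fin.sum_univ_two, h₁.h01, h₁.h11, h₂.h00, h₂.h01, rot, kap,
        Matrix.of_apply, Matrix.cons_val_zero, Matrix.cons_val_one, Matrix.cons_val', Matrix.cons_val_fin_one]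
      ring
    rw [this]
    linear_combination (-(p₂ * q₁ * (c * w₂ - σ))) * (hk + kap c σ w₂ v₁ * k * e1)
  · have : (M₂ * rot c σ * M₁) 1 0 = p₂ * kap c σ w₂ v₁ * p₁ * v₂ + p₁ * q₂ * (σ + c * v₁) := by
      simp only [Matrix.mul_apply, Fin.sum_univ_two, h₁.h00, h₁.h10, h₂.h10, h₂.h11, rot, kap,
        Matrix.of_apply, Matrix.cons_val_zero, Matrix.cons_val_one, Matrix.cons_val', Matrix.cons_val_fin_one]
      ring
    rw [this]
    linear_combination (-(p₁ * q₂ * (σ + c * v₁))) * (hk + kap c σ w₂ v₁ * k * e2)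
  · linear_combination hk + kap c σ w₂ v₁ * k * e1 + kap c σ w₂ v₁ * k * p₁ * q₁ * e2

/-- The difference of the images of two slopes under a rotation. -/
lemma slope_image_sub {c σ w v v' k k' : R} (hc : c * c + σ * σ = 1) (hk : kap c σ w v * k = 1)
    (hk' : kap c σ w v' * k' = 1) :
    (σ + c * v') * k' - (σ + c * v) * k = (v' - v) * k * k' := by
  -- A determinant of two image vectors, preserved because the rotation has determinant one.
  have e : (σ + c * v') * kap c σ w v - (σ + c * v) * kap c σ w v' = v' - v := by
    unfold kap
    linear_combination (v' - v) * hc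
  linear_combination k * k' * e - (σ + c * v') * k' * hk + (σ + c * v) * k * hk'

end SegmentAlgebra

/-- The slope of the image of the first basis vector. -/
noncomputable def slope (M : Matrix (Fin 2) (Fin 2) (PowerSeries ℝ)) : PowerSeries ℝ :=
  M 1 0 * (M 0 0)⁻¹

/-- The slope of the image of the first basis vector under the transpose. -/
noncomputable def coslope (M : Matrix (Fin 2) (Fin 2) (PowerSeries ℝ)) : PowerSeries ℝ :=
  M 0 1 * (M 0 0)⁻¹

lemma slope_transpose (M : Matrix (Fin 2) (Fin 2) (PowerSeries ℝ)) :
    slope M.transpose = coslope M := rfl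

lemma coslope_transpose (M : Matrix (Fin 2) (Fin 2) (PowerSeries ℝ)) :
    coslope M.transpose = slope M := rfl

lemma inv_eq_of_mul_eq_one {p q : PowerSeries ℝ} (h : p * q = 1) : p⁻¹ = q := by
  have h0 : PowerSeries.constantCoeff p ≠ 0 := by
    intro h0
    have := congrArg PowerSeries.constantCoeff h
    simp [h0] at this
  have h1 := PowerSeries.mul_inv_cancel p h0
  linear_combination q * h1 - p⁻¹ * h

lemma LDU.slope_eq {M : Matrix (Fin 2) (Fin 2) (PowerSeries ℝ)} {p q v w : PowerSeries ℝ}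
    (h : LDU M p q v w) : slope M = v := by
  rw [slope, h.h00, h.h10, inv_eq_of_mul_eq_one h.hpq]
  linear_combination v * h.hpq

lemma LDU.coslope_eq {M : Matrix (Fin 2) (Fin 2) (PowerSeries ℝ)} {p q v w : PowerSeries ℝ}
    (h : LDU M p q v w) : coslope M = w := by
  rw [coslope, h.h00, h.h01, inv_eq_of_mul_eq_one h.hpq]
  linear_combination w * h.hpq

lemma LDU.inv_eq {M : Matrix (Fin 2) (Fin 2) (PowerSeries ℝ)} {p q v w : PowerSeries ℝ}
    (h : LDU M p q v w) : (M 0 0)⁻¹ = q := by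
  rw [h.h00, inv_eq_of_mul_eq_one h.hpq]

/-! ### Growth and slopes along good segments -/

/-- Numerical constants governing the products along the good orbit segments. -/
structure SegConst where
  lam : ℝ
  B : ℝ
  τ₀ : ℝ
  β : ℝ
  L : ℝ
  Φ : ℕ → ℝ
  two_le_lam : 2 ≤ lam
  one_le_B : 1 ≤ B
  L_nonneg : 0 ≤ L
  Φ_zero : Φ 0 = 0
  -- The exponent `Φ n` is the loss allowed over n steps. It must absorb the cost L τ of each merge,
  -- but only for depths that are bounded or small compared with both pieces.
  Φ_add : ∀ (i j : ℕ) (τ : ℝ), 1 ≤ τ → (τ ≤ τ₀ ∨ (τ ≤ (i : ℝ) ^ β ∧ τ ≤ (j : ℝ) ^ β)) →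
    Φ i + Φ j + L * τ ≤ Φ (i + 1 + j)
  -- Says that one factor λ^(-(j+1)) out of the two in q² beats all losses in the correction of a
  -- slope.
  big : ∀ (j : ℕ) (τ : ℝ), 1 ≤ τ → (τ ≤ τ₀ ∨ τ ≤ (j : ℝ) ^ β) →
    8 * B * Real.exp (2 * (L * τ) + 2 * Φ j) ≤ lam ^ (j + 1)

/-- A sequence of rotations together with the depths `τ` of the visits near the critical point. -/
structure SegData (K : SegConst) (s : ℝ) (t : ℕ) where
  hs : 1 ≤ s
  c : ℤ → PowerSeries ℝ
  σ : ℤ → PowerSeries ℝ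
  unit : ∀ m, c m * c m + σ m * σ m = 1
  c_le : ∀ m, jetNorm s t (c m) ≤ K.B
  σ_le : ∀ m, jetNorm s t (σ m) ≤ K.B
  τ : ℤ → ℝ
  D : Set ℤ
  one_le_τ : ∀ m ∈ D, 1 ≤ τ m
  -- Two visits cannot both be deep and close in time: the shallower one is controlled by the gap.
  sep : ∀ m ∈ D, ∀ m' ∈ D, ∀ k : ℕ, |m - m'| = k + 1 → τ m' ≤ τ m →
    τ m' ≤ K.τ₀ ∨ τ m' ≤ (k : ℝ) ^ K.β

/-- Good segments: deep visits are far away from the two ends. -/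
def Good (τ : ℤ → ℝ) (τ₀ β : ℝ) (a : ℤ) (n : ℕ) : Prop :=
  ∀ i j : ℕ, i + 1 + j = n → τ (a + i) ≤ τ₀ ∨ (τ (a + i) ≤ (i : ℝ) ^ β ∧ τ (a + i) ≤ (j : ℝ) ^ β)

/-- The segment only visits indices in `D`. -/
def InSet (D : Set ℤ) (a : ℤ) (n : ℕ) : Prop := ∀ i < n, a + (i : ℤ) ∈ D

/-- `a + i` is a deepest visit of the segment. -/
def Deepest (τ : ℤ → ℝ) (a : ℤ) (n i : ℕ) : Prop := ∀ k < n, τ (a + k) ≤ τ (a + i)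

lemma exists_deepest (τ : ℤ → ℝ) (a : ℤ) {n : ℕ} (hn : 0 < n) :
    ∃ i j : ℕ, n = i + 1 + j ∧ Deepest τ a n i := by
  obtain ⟨i, hi, h⟩ := Finset.exists_max_image (Finset.range n) (fun k : ℕ => τ (a + k))
    ⟨0, Finset.mem_range.2 hn⟩
  rw [Finset.mem_range] at hi
  exact ⟨i, n - 1 - i, by omega, fun k hk => h k (Finset.mem_range.2 hk)⟩

/-- Partial sums of the geometric series `∑_{k ≥ 1} lam^{-k}`. -/
noncomputable def geomSum (lam : ℝ) (n : ℕ) : ℝ := ∑ k ∈ Finset.range n, lam⁻¹ ^ (k + 1)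

lemma geomSum_mono {lam : ℝ} (h : 2 ≤ lam) {m n : ℕ} (hmn : m ≤ n) :
    geomSum lam m ≤ geomSum lam n :=
  Finset.sum_le_sum_of_subset_of_nonneg (Finset.range_mono hmn)
    fun k _ _ => pow_nonneg (by positivity) _

lemma sum_Ico_pow_le {lam : ℝ} (h : 2 ≤ lam) (m n : ℕ) :
    ∑ k ∈ Finset.Ico m n, lam⁻¹ ^ k ≤ 2 * lam⁻¹ ^ m := by
  have h0 : 0 ≤ lam⁻¹ := by positivity
  have h1 : lam⁻¹ ≤ 1 / 2 := by rw [← one_div]; gcongr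
  have h2 : ∀ n, ∑ k ∈ Finset.range n, lam⁻¹ ^ k ≤ 2 := by
    intro n
    refine (Finset.sum_le_sum fun k _ => pow_le_pow_left₀ h0 h1 k).trans ?_
    have := Summable.sum_le_tsum (Finset.range n) (fun k _ => by positivity) summable_geometric_two
    rwa [tsum_geometric_two] at this
  rw [Finset.sum_Ico_eq_sum_range]
  simp only [pow_add]
  rw [← Finset.mul_sum, mul_comm 2]
  exact mul_le_mul_of_nonneg_left (h2 _) (pow_nonneg h0 _)

lemma geomSum_le {lam : ℝ} (h : 2 ≤ lam) (n : ℕ) : geomSum lam n ≤ 2 * lam⁻¹ := by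
  have := sum_Ico_pow_le h 1 (n + 1)
  rw [Finset.sum_Ico_eq_sum_range] at this
  simpa [geomSum, add_comm] using this

namespace SegData

variable {K : SegConst} {s : ℝ} {t : ℕ} (S : SegData K s t)

/-- The matrix product along a segment. -/
noncomputable def mat (a : ℤ) (n : ℕ) : Matrix (Fin 2) (Fin 2) (PowerSeries ℝ) :=
  seg (PowerSeries.C K.lam) (PowerSeries.C K.lam⁻¹) S.c S.σ a n

/-- The pivot of the rotation at `m` between the segments `[a, m)` and `(m, m + j]`. -/
noncomputable def pivot (a : ℤ) (i j : ℕ) : PowerSeries ℝ :=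
  kap (S.c (a + i)) (S.σ (a + i)) (coslope (S.mat (a + i + 1) j)) (slope (S.mat a i))

/-- The estimates satisfied by the products along good segments. -/
def OK (a : ℤ) (n : ℕ) : Prop :=
  (∃ p q v w, LDU (S.mat a n) p q v w ∧
    jetNorm s t q ≤ K.lam⁻¹ ^ (n + 1) * Real.exp (K.Φ n) ∧
    jetNorm s t v ≤ geomSum K.lam n / 4 ∧ jetNorm s t w ≤ geomSum K.lam n / 4) ∧
  ∀ i j : ℕ, n = i + 1 + j → Deepest S.τ a n i →
    InvBd s t (S.pivot a i j) (Real.exp (K.L * S.τ (a + i)))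

variable {S}

lemma lam_pos : 0 < K.lam := by linarith [K.two_le_lam]

lemma inv_lam_nonneg : 0 ≤ K.lam⁻¹ := inv_nonneg.2 lam_pos.le

lemma inv_lam_le : K.lam⁻¹ ≤ 1 / 2 := by
  rw [← one_div]; have := K.two_le_lam; gcongr

lemma quarter_geomSum_le (n : ℕ) : geomSum K.lam n / 4 ≤ K.lam⁻¹ / 2 := by
  have := geomSum_le K.two_le_lam n; linarith

lemma OK.slope_le {a : ℤ} {n : ℕ} (h : S.OK a n) :
    jetNorm s t (slope (S.mat a n)) ≤ K.lam⁻¹ / 2 := by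
  obtain ⟨p, q, v, w, h1, -, h2, -⟩ := h.1
  rw [h1.slope_eq]; exact h2.trans (quarter_geomSum_le n)

lemma OK.coslope_le {a : ℤ} {n : ℕ} (h : S.OK a n) :
    jetNorm s t (coslope (S.mat a n)) ≤ K.lam⁻¹ / 2 := by
  obtain ⟨p, q, v, w, h1, -, -, h2⟩ := h.1
  rw [h1.coslope_eq]; exact h2.trans (quarter_geomSum_le n)

/-- The key smallness: the correction of a slope by a merge. -/
lemma correction_le {x k q : PowerSeries ℝ} {τ A : ℝ} {j : ℕ} (hs : 1 ≤ s) (hτ : 1 ≤ τ)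
    (hj : τ ≤ K.τ₀ ∨ τ ≤ (j : ℝ) ^ K.β) (hA : 0 ≤ A)
    (hx : jetNorm s t x ≤ 2 * K.B * A) (hk : jetNorm s t k ≤ Real.exp (2 * (K.L * τ)))
    (hq : jetNorm s t q ≤ K.lam⁻¹ ^ (j + 1) * Real.exp (K.Φ j)) :
    jetNorm s t (x * k * (q * q)) ≤ K.lam⁻¹ ^ (j + 1) / 4 * A := by
  have h1 := jetNorm_mul_le (t := t) hs (jetNorm_mul_le hs hx hk) (jetNorm_mul_le hs hq hq)
  refine h1.trans ?_
  -- The factor exp(2Lτ) leaves room for two inverse pivots, as needed when the images of two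
  -- different slopes are compared.
  have h2 := K.big j τ hτ hj
  rw [Real.exp_add, two_mul (K.Φ j), Real.exp_add] at h2
  have h3 : K.lam⁻¹ ^ (j + 1) * K.lam ^ (j + 1) = 1 := by
    rw [← mul_pow, inv_mul_cancel₀ lam_pos.ne', one_pow]
  set r := K.lam⁻¹ ^ (j + 1) with hr
  have hr0 : 0 ≤ r := pow_nonneg inv_lam_nonneg _
  have h4 := mul_le_mul_of_nonneg_left h2 (mul_nonneg (mul_nonneg hr0 hr0) hA)
  have h5 : r * r * A * K.lam ^ (j + 1) = r * A := by linear_combination r * A * h3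
  linarith

lemma OK.merge {a : ℤ} {i j : ℕ} (h₁ : S.OK a i) (h₂ : S.OK (a + i + 1) j)
    (hpiv : InvBd s t (S.pivot a i j) (Real.exp (K.L * S.τ (a + i)))) :
    ∃ p₁ q₁ v₁ w₁ p₂ q₂ v₂ w₂ k,
      LDU (S.mat a i) p₁ q₁ v₁ w₁ ∧ LDU (S.mat (a + i + 1) j) p₂ q₂ v₂ w₂ ∧
      kap (S.c (a + i)) (S.σ (a + i)) w₂ v₁ * k = 1 ∧
      jetNorm s t k ≤ Real.exp (K.L * S.τ (a + i)) ∧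
      jetNorm s t q₁ ≤ K.lam⁻¹ ^ (i + 1) * Real.exp (K.Φ i) ∧
      jetNorm s t q₂ ≤ K.lam⁻¹ ^ (j + 1) * Real.exp (K.Φ j) ∧
      jetNorm s t v₁ ≤ geomSum K.lam i / 4 ∧ jetNorm s t w₁ ≤ geomSum K.lam i / 4 ∧
      jetNorm s t v₂ ≤ geomSum K.lam j / 4 ∧ jetNorm s t w₂ ≤ geomSum K.lam j / 4 ∧
      LDU (S.mat a (i + 1 + j)) (p₂ * kap (S.c (a + i)) (S.σ (a + i)) w₂ v₁ * p₁) (q₁ * k * q₂)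
        (v₂ + (S.σ (a + i) + S.c (a + i) * v₁) * k * (q₂ * q₂))
        (w₁ + (S.c (a + i) * w₂ - S.σ (a + i)) * k * (q₁ * q₁)) := by
  obtain ⟨p₁, q₁, v₁, w₁, l₁, hq₁, hv₁, hw₁⟩ := h₁.1
  obtain ⟨p₂, q₂, v₂, w₂, l₂, hq₂, hv₂, hw₂⟩ := h₂.1
  unfold SegData.pivot at hpiv
  rw [l₁.slope_eq, l₂.coslope_eq] at hpiv
  obtain ⟨k, hk, hkn⟩ := hpiv
  refine ⟨p₁, q₁, v₁, w₁, p₂, q₂, v₂, w₂, k, l₁, l₂, hk, hkn, hq₁, hq₂, hv₁, hw₁, hv₂, hw₂, ?_⟩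
  have := l₂.merge l₁ (S.unit (a + i)) hk
  rw [mat, seg_split]
  exact this

lemma vec_le {c σ v : PowerSeries ℝ} (hs : 1 ≤ s) {n : ℕ} (hc : jetNorm s t c ≤ K.B)
    (hσ : jetNorm s t σ ≤ K.B) (hv : jetNorm s t v ≤ geomSum K.lam n / 4) :
    jetNorm s t (σ + c * v) ≤ 2 * K.B * 1 := by
  have hB := K.one_le_B
  have h1 : jetNorm s t v ≤ 1 := by
    have := quarter_geomSum_le (K := K) n; have := inv_lam_le (K := K); linarith
  have := jetNorm_mul_le (t := t) hs hc h1
  have := jetNorm_add (s := s) (t := t) σ (c * v)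
  linarith

lemma covec_le {c σ w : PowerSeries ℝ} (hs : 1 ≤ s) {n : ℕ} (hc : jetNorm s t c ≤ K.B)
    (hσ : jetNorm s t σ ≤ K.B) (hv : jetNorm s t w ≤ geomSum K.lam n / 4) :
    jetNorm s t (c * w - σ) ≤ 2 * K.B * 1 := by
  have := vec_le hs hc hσ hv
  have h2 : jetNorm s t (c * w - σ) ≤ jetNorm s t (c * w) + jetNorm s t σ := jetNorm_sub _ _
  have hB := K.one_le_B
  have h1 : jetNorm s t w ≤ 1 := by
    have := quarter_geomSum_le (K := K) n; have := inv_lam_le (K := K); linarith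
  have := jetNorm_mul_le (t := t) hs hc h1
  linarith

lemma exp_le_exp_two {τ : ℝ} (hτ : 1 ≤ τ) : Real.exp (K.L * τ) ≤ Real.exp (2 * (K.L * τ)) := by
  rw [Real.exp_le_exp]
  have := mul_nonneg K.L_nonneg (by linarith : 0 ≤ τ)
  linarith

lemma geomSum_add_le {i n : ℕ} (h : i + 1 ≤ n) :
    geomSum K.lam i / 4 + K.lam⁻¹ ^ (i + 1) / 4 * 1 ≤ geomSum K.lam n / 4 := by
  have h1 : geomSum K.lam (i + 1) = geomSum K.lam i + K.lam⁻¹ ^ (i + 1) := by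
    simp [geomSum, Finset.sum_range_succ]
  have h2 := geomSum_mono K.two_le_lam h
  linarith

/-- Induction step: cut at a deepest visit and merge. The loss is absorbed by `Φ_add`, and the
corrections of the slopes add up to a geometric series. Only the bound on the inverse pivot is left
as a hypothesis; proving it is the task of `ok_extend`. -/
lemma ok_of_split {a : ℤ} {n : ℕ} (hg : Good S.τ K.τ₀ K.β a n) (hD : InSet S.D a n)
    (hsub : ∀ i j : ℕ, n = i + 1 + j → Deepest S.τ a n i → S.OK a i ∧ S.OK (a + i + 1) j ∧
      InvBd s t (S.pivot a i j) (Real.exp (K.L * S.τ (a + i)))) : S.OK a n := by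
  refine ⟨?_, fun i j hn hd => (hsub i j hn hd).2.2⟩
  rcases Nat.eq_zero_or_pos n with rfl | hpos
  · refine ⟨PowerSeries.C K.lam, PowerSeries.C K.lam⁻¹, 0, 0, ⟨?_, ?_, ?_, ?_, ?_⟩, ?_, ?_, ?_⟩
    · simp [mat, seg]
    · simp [mat, seg]
    · simp [mat, seg]
    · simp [mat, seg]
    · rw [← map_mul, mul_inv_cancel₀ lam_pos.ne', map_one]
    · rw [jetNorm_C, abs_of_nonneg inv_lam_nonneg, K.Φ_zero]; simp
    · simp [jetNorm_zero, geomSum]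
    · simp [jetNorm_zero, geomSum]
  obtain ⟨i, j, rfl, hd⟩ := exists_deepest S.τ a hpos
  obtain ⟨h₁, h₂, hpiv⟩ := hsub i j rfl hd
  obtain ⟨p₁, q₁, v₁, w₁, p₂, q₂, v₂, w₂, k, l₁, l₂, hk, hkn, hq₁, hq₂, hv₁, hw₁, hv₂, hw₂, l⟩ :=
    h₁.merge h₂ hpiv
  have hτ1 : 1 ≤ S.τ (a + i) := S.one_le_τ _ (hD i (by omega))
  have hgi := hg i j rfl
  have hk2 := hkn.trans (exp_le_exp_two hτ1)
  refine ⟨_, _, _, _, l, ?_, ?_, ?_⟩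
  · have := jetNorm_mul_le (t := t) S.hs (jetNorm_mul_le S.hs hq₁ hkn) hq₂
    refine this.trans ?_
    have e : K.lam⁻¹ ^ (i + 1) * Real.exp (K.Φ i) * Real.exp (K.L * S.τ (a + i)) *
        (K.lam⁻¹ ^ (j + 1) * Real.exp (K.Φ j)) =
        K.lam⁻¹ ^ (i + 1 + j + 1) * Real.exp (K.Φ i + K.Φ j + K.L * S.τ (a + i)) := by
      rw [Real.exp_add, Real.exp_add]; ring
    rw [e]
    exact mul_le_mul_of_nonneg_left (Real.exp_le_exp.2 (K.Φ_add i j _ hτ1 hgi))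
      (pow_nonneg inv_lam_nonneg _)
  · have := correction_le (K := K) S.hs hτ1 (hgi.imp id And.right) zero_le_one
      (vec_le S.hs (S.c_le (a + i)) (S.σ_le (a + i)) hv₁) hk2 hq₂
    exact ((jetNorm_add _ _).trans (add_le_add hv₂ this)).trans (geomSum_add_le (by omega))
  · have := correction_le (K := K) S.hs hτ1 (hgi.imp id And.left) zero_le_one
      (covec_le S.hs (S.c_le (a + i)) (S.σ_le (a + i)) hw₂) hk2 hq₁
    exact ((jetNorm_add _ _).trans (add_le_add hw₁ this)).trans (geomSum_add_le (by omega))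

lemma inSet_left {D : Set ℤ} {a : ℤ} {i n : ℕ} (h : InSet D a n) (hi : i ≤ n) : InSet D a i :=
  fun k hk => h k (by omega)

lemma inSet_right {D : Set ℤ} {a : ℤ} {i j : ℕ} (h : InSet D a (i + 1 + j)) :
    InSet D (a + i + 1) j := fun k hk => by
  have := h (i + 1 + k) (by omega)
  have e : a + ((i + 1 + k : ℕ) : ℤ) = a + i + 1 + k := by push_cast; ring
  rwa [e] at this

/-- A cut creates a new end next to the deepest visit. The other visits are shallower, so separation
bounds their depth by their distance to this new end. This is why segments are always cut at a
deepest visit. -/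
lemma good_left {a : ℤ} {i j : ℕ} (hD : InSet S.D a (i + 1 + j))
    (hg : Good S.τ K.τ₀ K.β a (i + 1 + j)) (hd : Deepest S.τ a (i + 1 + j) i) :
    Good S.τ K.τ₀ K.β a i := by
  intro i' j' hi
  rcases hg i' (j' + 1 + j) (by omega) with h | h
  · exact Or.inl h
  · rcases S.sep (a + i) (hD i (by omega)) (a + i') (hD i' (by omega)) j' (by
      have : a + (i : ℤ) - (a + i') = j' + 1 := by omega
      rw [this, abs_of_nonneg (by positivity)]) (hd i' (by omega)) with h2 | h2
    · exact Or.inl h2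
    · exact Or.inr ⟨h.1, h2⟩

lemma good_right {a : ℤ} {i j : ℕ} (hD : InSet S.D a (i + 1 + j))
    (hg : Good S.τ K.τ₀ K.β a (i + 1 + j)) (hd : Deepest S.τ a (i + 1 + j) i) :
    Good S.τ K.τ₀ K.β (a + i + 1) j := by
  intro i' j' hi
  have e : a + (i : ℤ) + 1 + i' = a + ((i + 1 + i' : ℕ) : ℤ) := by push_cast; ring
  rw [e]
  rcases hg (i + 1 + i') j' (by omega) with h | h
  · exact Or.inl h
  · rcases S.sep (a + i) (hD i (by omega)) (a + ((i + 1 + i' : ℕ) : ℤ)) (hD _ (by omega)) i' (by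
      have : a + (i : ℤ) - (a + ((i + 1 + i' : ℕ) : ℤ)) = -(i' + 1) := by push_cast; ring
      rw [this, abs_neg, abs_of_nonneg (by positivity)]) (hd _ (by omega)) with h2 | h2
    · exact Or.inl h2
    · exact Or.inr ⟨h2, h.2⟩

/-- A family of good segments with estimates, closed under splitting at a deepest visit. -/
def Family (S : SegData K s t) (Q : ℤ → ℕ → Prop) : Prop :=
  ∀ a n, Q a n → S.OK a n ∧ Good S.τ K.τ₀ K.β a n ∧ InSet S.D a n ∧
    ∀ i j : ℕ, n = i + 1 + j → Deepest S.τ a n i → Q a i ∧ Q (a + i + 1) j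

/-- Slopes of good segments with the same end point are close. -/
lemma Family.compare {Q : ℤ → ℕ → Prop} (hQ : S.Family Q) (n' : ℕ) :
    ∀ n ≤ n', ∀ a a' : ℤ, a' + n' = a + n → Q a n → Q a' n' →
      jetNorm s t (slope (S.mat a' n') - slope (S.mat a n)) ≤
        ∑ k ∈ Finset.Ico n (n' + 1), K.lam⁻¹ ^ k := by
  induction n' using Nat.strong_induction_on with
  | _ n' ih =>
  intro n hn a a' haa hq hq'
  have hsum0 : ∀ m m' : ℕ, 0 ≤ ∑ k ∈ Finset.Ico m m', K.lam⁻¹ ^ k := fun _ _ =>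
    Finset.sum_nonneg fun k _ => pow_nonneg inv_lam_nonneg _
  rcases hn.eq_or_lt with rfl | hlt
  · have : a' = a := by omega
    rw [this, sub_self, jetNorm_zero]
    exact hsum0 _ _
  obtain ⟨i', j, rfl, hd⟩ := exists_deepest S.τ a' (by omega : 0 < n')
  obtain ⟨ok', hg', hD', hcl'⟩ := hQ a' _ hq'
  obtain ⟨ql', qr'⟩ := hcl' i' j rfl hd
  have hpiv' := ok'.2 i' j rfl hd
  have hτ1 : 1 ≤ S.τ (a' + i') := S.one_le_τ _ (hD' i' (by omega))
  have hgj : S.τ (a' + i') ≤ K.τ₀ ∨ S.τ (a' + i') ≤ (j : ℝ) ^ K.β :=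
    (hg' i' j rfl).imp id And.right
  obtain ⟨p₁, q₁, v₁, w₁, p₂, q₂, v₂, w₂, k', l₁, l₂, hk', hkn', hq₁, hq₂, hv₁, hw₁, hv₂, hw₂, l'⟩ :=
    (hQ _ _ ql').1.merge (hQ _ _ qr').1 hpiv'
  have hs := S.hs
  -- The longer segment is cut at its deepest visit, at distance j from the common end. If that
  -- visit also lies in the shorter segment, it is deepest there too, both segments have the same
  -- right piece, and the difference of the left slopes is contracted by q₂² k k'.
  by_cases hj : j < n
  · obtain ⟨i, rfl⟩ : ∃ i, n = i + 1 + j := ⟨n - 1 - j, by omega⟩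
    have hm : a' + (i' : ℤ) = a + i := by push_cast at haa; omega
    obtain ⟨ok, hg, hD, hcl⟩ := hQ a _ hq
    have hd2 : Deepest S.τ a (i + 1 + j) i := by
      intro k hk
      have := hd (i' - i + k) (by omega)
      rw [hm] at this
      have e : a' + ((i' - i + k : ℕ) : ℤ) = a + k := by
        have : i ≤ i' := by omega
        push_cast [this]; omega
      rwa [e] at this
    obtain ⟨ql, qr⟩ := hcl i j rfl hd2
    have hpiv := ok.2 i j rfl hd2
    obtain ⟨P₁, Q₁, V₁, W₁, P₂, Q₂, V₂, W₂, k, L₁, L₂, hk, hkn, -, -, -, -, -, -, l⟩ :=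
      (hQ _ _ ql).1.merge (hQ _ _ qr).1 hpiv
    have hv2 : V₂ = v₂ := by rw [← L₂.slope_eq, ← l₂.slope_eq, hm]
    have hw2 : W₂ = w₂ := by rw [← L₂.coslope_eq, ← l₂.coslope_eq, hm]
    have hq2 : Q₂ = q₂ := by rw [← L₂.inv_eq, ← l₂.inv_eq, hm]
    subst hv2 hw2 hq2
    have ih1 := ih i' (by omega) i (by omega) a a' hm ql ql'
    rw [l₁.slope_eq, L₁.slope_eq] at ih1
    rw [l'.slope_eq, l.slope_eq, hm]
    rw [hm] at hk'
    have e := slope_image_sub (S.unit (a + i)) hk hk'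
    have e2 : V₂ + (S.σ (a + i) + S.c (a + i) * v₁) * k' * (Q₂ * Q₂) -
        (V₂ + (S.σ (a + i) + S.c (a + i) * V₁) * k * (Q₂ * Q₂)) =
        (v₁ - V₁) * (k * k') * (Q₂ * Q₂) := by linear_combination (Q₂ * Q₂) * e
    rw [e2]
    rw [hm] at hkn' hτ1 hgj
    have hkk : jetNorm s t (k * k') ≤ Real.exp (2 * (K.L * S.τ (a + i))) := by
      rw [two_mul, Real.exp_add]; exact jetNorm_mul_le hs hkn hkn'
    have hB := K.one_le_B
    have hs0 := hsum0 i (i' + 1)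
    have h3 := correction_le (K := K) hs hτ1 hgj hs0 (ih1.trans (by nlinarith)) hkk hq₂
    refine h3.trans ?_
    have h4 : K.lam⁻¹ ^ (j + 1) * ∑ k ∈ Finset.Ico i (i' + 1), K.lam⁻¹ ^ k =
        ∑ k ∈ Finset.Ico (i + 1 + j) (i' + 1 + j + 1), K.lam⁻¹ ^ k := by
      have e1 : i + 1 + j = i + (j + 1) := by omega
      have e2 : i' + 1 + j + 1 = i' + 1 + (j + 1) := by omega
      rw [e1, e2, ← Finset.sum_Ico_add', Finset.mul_sum]
      exact Finset.sum_congr rfl fun k _ => by ring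
    rw [← h4]
    have : 0 ≤ K.lam⁻¹ ^ (j + 1) * ∑ k ∈ Finset.Ico i (i' + 1), K.lam⁻¹ ^ k :=
      mul_nonneg (pow_nonneg inv_lam_nonneg _) hs0
    nlinarith
  -- Otherwise the shorter segment lies in the right piece of the longer one; passing from that
  -- piece to the whole costs one correction of size λ^(-(j+1)).
  · push Not at hj
    have ih1 := ih j (by omega) n hj a (a' + i' + 1) (by push_cast at haa ⊢; omega) hq qr'
    rw [l₂.slope_eq] at ih1
    rw [l'.slope_eq]
    have h3 := correction_le (K := K) hs hτ1 hgj zero_le_one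
      (vec_le hs (S.c_le (a' + i')) (S.σ_le (a' + i')) hv₁) (hkn'.trans (exp_le_exp_two hτ1)) hq₂
    have e : v₂ + (S.σ (a' + i') + S.c (a' + i') * v₁) * k' * (q₂ * q₂) - slope (S.mat a n) =
        (v₂ - slope (S.mat a n)) + (S.σ (a' + i') + S.c (a' + i') * v₁) * k' * (q₂ * q₂) := by ring
    rw [e]
    refine (jetNorm_add _ _).trans ((add_le_add ih1 h3).trans ?_)
    have h5 : ∑ k ∈ Finset.Ico n (j + 1 + 1), K.lam⁻¹ ^ k ≤
        ∑ k ∈ Finset.Ico n (i' + 1 + j + 1), K.lam⁻¹ ^ k :=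
      Finset.sum_le_sum_of_subset_of_nonneg (Finset.Ico_subset_Ico_right (by omega))
        fun k _ _ => pow_nonneg inv_lam_nonneg _
    rw [Finset.sum_Ico_succ_top (by omega)] at h5
    have := pow_nonneg (inv_lam_nonneg (K := K)) (j + 1)
    linarith

lemma Family.compare_le {Q : ℤ → ℕ → Prop} (hQ : S.Family Q) {n n' k : ℕ} {a a' : ℤ}
    (haa : a' + n' = a + n) (hq : Q a n) (hq' : Q a' n') (hn : k ≤ n) (hn' : k ≤ n') :
    jetNorm s t (slope (S.mat a' n') - slope (S.mat a n)) ≤ 2 * K.lam⁻¹ ^ k := by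
  have mono : ∀ m, k ≤ m → 2 * K.lam⁻¹ ^ m ≤ 2 * K.lam⁻¹ ^ k := fun m hm => by
    have := pow_le_pow_of_le_one (inv_lam_nonneg (K := K)) (by linarith [inv_lam_le (K := K)]) hm
    linarith
  rcases le_total n n' with h | h
  · exact ((hQ.compare n' n h a a' haa hq hq').trans (sum_Ico_pow_le K.two_le_lam _ _)).trans
      (mono n hn)
  · rw [jetNorm_sub_comm]
    exact ((hQ.compare n n' h a' a haa.symm hq' hq).trans (sum_Ico_pow_le K.two_le_lam _ _)).trans
      (mono n' hn')

variable (S)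

/-- Time reversal. -/
noncomputable def reverse : SegData K s t where
  hs := S.hs
  c m := S.c (-m)
  σ m := -S.σ (-m)
  unit m := by have := S.unit (-m); linear_combination this
  c_le m := S.c_le _
  σ_le m := by rw [jetNorm_neg]; exact S.σ_le _
  τ m := S.τ (-m)
  D := {m | -m ∈ S.D}
  one_le_τ m hm := S.one_le_τ _ hm
  sep m hm m' hm' k hk h := S.sep _ hm _ hm' k (by
    rw [← hk, ← abs_neg]; congr 1; ring) h

variable {S}

lemma reverse_mat (a : ℤ) (n : ℕ) : S.reverse.mat (-a - n + 1) n = (S.mat a n).transpose :=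
  (seg_transpose _ _ _ _ _ _).symm

lemma reverse_mat' (a : ℤ) (n : ℕ) : S.reverse.mat a n = (S.mat (-a - n + 1) n).transpose := by
  rw [← reverse_mat]; congr 1; ring

lemma reverse_good {a : ℤ} {n : ℕ} (h : Good S.τ K.τ₀ K.β a n) :
    Good S.reverse.τ K.τ₀ K.β (-a - n + 1) n := by
  intro i j hij
  have e : S.reverse.τ (-a - n + 1 + i) = S.τ (a + j) := by
    change S.τ _ = _; congr 1; push_cast [← hij]; ring
  rw [e]
  exact (h j i (by omega)).imp id And.symm

lemma reverse_inSet {D : Set ℤ} {a : ℤ} {n : ℕ} (h : InSet D a n) :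
    InSet {m | -m ∈ D} (-a - n + 1) n := by
  intro i hi
  have := h (n - 1 - i) (by omega)
  have e : a + ((n - 1 - i : ℕ) : ℤ) = -(-a - n + 1 + i) := by omega
  rwa [e] at this

lemma reverse_ok {a : ℤ} {n : ℕ} (h : S.OK a n) : S.reverse.OK (-a - n + 1) n := by
  obtain ⟨⟨p, q, v, w, l, hq, hv, hw⟩, h2⟩ := h
  refine ⟨⟨p, q, w, v, ?_, hq, hw, hv⟩, ?_⟩
  · rw [reverse_mat]; exact l.transpose
  · intro i j hn hd
    have ei : (-a - (n : ℤ) + 1 + i) = -(a + j) := by rw [hn]; push_cast; ring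
    have hd2 : Deepest S.τ a n j := by
      intro k hk
      have := hd (n - 1 - k) (by omega)
      change S.τ _ ≤ S.τ _ at this
      rw [ei, neg_neg] at this
      have e : -(-a - (n : ℤ) + 1 + ((n - 1 - k : ℕ) : ℤ)) = a + k := by omega
      rwa [e] at this
    have := h2 j i (by omega) hd2
    have e1 : S.reverse.τ (-a - n + 1 + i) = S.τ (a + j) := by
      change S.τ _ = _; rw [ei, neg_neg]
    rw [e1]
    have e2 : S.reverse.pivot (-a - n + 1) i j = S.pivot a j i := by
      unfold pivot
      rw [reverse_mat', reverse_mat', slope_transpose, coslope_transpose, ei]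
      change kap (S.c _) (-S.σ _) _ _ = _
      have e3 : -(-a - (n : ℤ) + 1) - i + 1 = a + j + 1 := by rw [hn]; push_cast; ring
      have e4 : -(-(a + (j : ℤ)) + 1) - j + 1 = a := by ring
      rw [e3, e4, neg_neg]
      unfold kap; ring
    rw [e2]; exact this

lemma reverse_deepest {a : ℤ} {n i j : ℕ} (hn : n = i + 1 + j)
    (hd : Deepest S.reverse.τ (-a - n + 1) n i) : Deepest S.τ a n j := by
  intro k hk
  have := hd (n - 1 - k) (by omega)
  change S.τ _ ≤ S.τ _ at this
  have e : -(-a - (n : ℤ) + 1 + ((n - 1 - k : ℕ) : ℤ)) = a + k := by omega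
  have ei : -(-a - (n : ℤ) + 1 + i) = a + j := by rw [hn]; push_cast; ring
  rwa [e, ei] at this

lemma Family.reverse {Q : ℤ → ℕ → Prop} (hQ : S.Family Q) :
    S.reverse.Family fun a n => Q (-a - n + 1) n := by
  intro a n h
  obtain ⟨h1, h2, h3, h4⟩ := hQ _ _ h
  have e : -(-a - (n : ℤ) + 1) - n + 1 = a := by ring
  have r1 := reverse_ok h1
  have r2 := reverse_good h2
  have r3 := reverse_inSet h3
  rw [e] at r1 r2 r3
  refine ⟨r1, r2, r3, fun i j hn hd => ?_⟩
  rw [← e] at hd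
  obtain ⟨hl, hr⟩ := h4 j i (by omega) (reverse_deepest hn hd)
  constructor
  · convert hr using 1; rw [hn]; push_cast; ring
  · convert hl using 1; rw [hn]; push_cast; ring

/-- Time reversal exchanges slopes and coslopes, and segments with a common start become segments
with a common end. -/
lemma Family.compare_coslope_le {Q : ℤ → ℕ → Prop} (hQ : S.Family Q) {n n' k : ℕ} {a : ℤ}
    (hq : Q a n) (hq' : Q a n') (hn : k ≤ n) (hn' : k ≤ n') :
    jetNorm s t (coslope (S.mat a n') - coslope (S.mat a n)) ≤ 2 * K.lam⁻¹ ^ k := by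
  have e : ∀ n : ℕ, -(-a - (n : ℤ) + 1) - n + 1 = a := fun n => by ring
  have := hQ.reverse.compare_le (a := -a - n + 1) (a' := -a - n' + 1) (n := n) (n' := n') (k := k)
    (by ring) (by rwa [e]) (by rwa [e]) hn hn'
  rwa [reverse_mat, reverse_mat, slope_transpose, slope_transpose] at this

end SegData

/-! ### From one scale to the next -/

namespace SegData

variable {K : SegConst} {s : ℝ} {t : ℕ} {S : SegData K s t}

/-- Stability of the pivot under perturbation of the slopes. -/
lemma jetNorm_kap_sub_le (hs : 1 ≤ s) {c σ w v w' v' : PowerSeries ℝ} {B x y : ℝ}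
    (hc : jetNorm s t c ≤ B) (hσ : jetNorm s t σ ≤ B) (hv : jetNorm s t v ≤ 1)
    (hw' : jetNorm s t w' ≤ 1) (hx : jetNorm s t (v - v') ≤ x) (hy : jetNorm s t (w - w') ≤ y) :
    jetNorm s t (kap c σ w v - kap c σ w' v') ≤ 2 * B * (x + y) := by
  have e : kap c σ w v - kap c σ w' v' =
      c * ((w - w') * v + w' * (v - v')) + σ * ((w - w') - (v - v')) := by
    unfold kap; ring
  have h1 : jetNorm s t ((w - w') * v + w' * (v - v')) ≤ x + y := by
    have := jetNorm_mul_le (t := t) hs hy hv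
    have := jetNorm_mul_le (t := t) hs hw' hx
    have := jetNorm_add (s := s) (t := t) ((w - w') * v) (w' * (v - v'))
    linarith
  have h2 : jetNorm s t ((w - w') - (v - v')) ≤ x + y := by
    have := jetNorm_sub (s := s) (t := t) (w - w') (v - v')
    linarith
  rw [e]
  have h3 := jetNorm_mul_le (t := t) hs hc h1
  have h4 := jetNorm_mul_le (t := t) hs hσ h2
  have := jetNorm_add (s := s) (t := t) (c * ((w - w') * v + w' * (v - v')))
    (σ * ((w - w') - (v - v')))
  linarith

/-- In the transition zone of a cutoff X the prescribed slope interpolates between two reference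
slopes. The weights sum to one, so closeness to both is closeness to the interpolation, up to the
size of the cutoff. -/
lemma jetNorm_interp_le (hs : 1 ≤ s) {X u u₁ u₂ : PowerSeries ℝ} {E e : ℝ} (hE : 1 ≤ E)
    (hX : jetNorm s t X ≤ E) (h1 : jetNorm s t (u - u₁) ≤ e) (h2 : jetNorm s t (u - u₂) ≤ e) :
    jetNorm s t (u - ((1 - X) * u₁ + X * u₂)) ≤ 3 * E * e := by
  have e1 : u - ((1 - X) * u₁ + X * u₂) = (1 - X) * (u - u₁) + X * (u - u₂) := by ring
  have h0 : jetNorm s t (1 - X) ≤ 1 + E := by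
    have := jetNorm_sub (s := s) (t := t) 1 X
    rw [jetNorm_one] at this; linarith
  have h3 := jetNorm_mul_le (t := t) hs h0 h1
  have h4 := jetNorm_mul_le (t := t) hs hX h2
  have h5 := jetNorm_add (s := s) (t := t) ((1 - X) * (u - u₁)) (X * (u - u₂))
  have he : 0 ≤ e := (jetNorm_nonneg _).trans h1
  rw [e1]
  nlinarith

/-- Segments of length `n` on both sides of `m` which are good and stay in `D₀`. -/
def RefSeg (S : SegData K s t) (D₀ : Set ℤ) (m : ℤ) (n : ℕ) : Prop :=
  Good S.τ K.τ₀ K.β (m - n) n ∧ InSet D₀ (m - n) n ∧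
    Good S.τ K.τ₀ K.β (m + 1) n ∧ InSet D₀ (m + 1) n

/-- Estimates on good segments avoiding a neighbourhood of the critical point extend to good
segments with deeper visits, where the rotation is adapted to the slopes of reference segments. -/
theorem ok_extend {D₀ : Set ℤ} (hD₀ : D₀ ⊆ S.D)
    (hmono : ∀ m ∈ D₀, ∀ m' ∈ S.D, S.τ m' ≤ S.τ m → m' ∈ D₀)
    (h0 : ∀ a n, Good S.τ K.τ₀ K.β a n → InSet D₀ a n → S.OK a n)
    {V W : ℤ → PowerSeries ℝ} {L₁ C₃ e₀ : ℝ} (hC₃ : 0 ≤ C₃)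
    (hκ : ∀ m ∈ S.D, InvBd s t (kap (S.c m) (S.σ m) (W m) (V m)) (Real.exp (L₁ * S.τ m)))
    (hW : ∀ m, jetNorm s t (W m) ≤ 1)
    (hL : ∀ τ : ℝ, 1 ≤ τ → 2 * Real.exp (L₁ * τ) ≤ Real.exp (K.L * τ))
    (hdeep : ∀ (k : ℕ) (τ : ℝ), 1 ≤ τ → τ ≤ (k : ℝ) ^ K.β →
      48 * K.B * (Real.exp (L₁ * τ) * Real.exp (C₃ * τ)) ≤ K.lam ^ k)
    (he₀ : K.lam⁻¹ ≤ e₀)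
    (hshallow : ∀ τ : ℝ, 1 ≤ τ → τ ≤ K.τ₀ → 16 * K.B * e₀ * Real.exp (L₁ * τ) ≤ 1)
    (href : ∀ m ∈ S.D, m ∉ D₀ →
      (S.τ m ≤ K.τ₀ ∧ jetNorm s t (V m) ≤ e₀ ∧ jetNorm s t (W m) ≤ e₀) ∨
      (K.τ₀ < S.τ m ∧ ∃ (X : PowerSeries ℝ) (n₁ n₂ : ℕ), jetNorm s t X ≤ Real.exp (C₃ * S.τ m) ∧
        S.τ m ≤ (n₁ : ℝ) ^ K.β ∧ S.τ m ≤ (n₂ : ℝ) ^ K.β ∧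
        RefSeg S D₀ m n₁ ∧ RefSeg S D₀ m n₂ ∧
        V m = (1 - X) * slope (S.mat (m - n₁) n₁) + X * slope (S.mat (m - n₂) n₂) ∧
        W m = (1 - X) * coslope (S.mat (m + 1) n₁) + X * coslope (S.mat (m + 1) n₂)))
    (a : ℤ) (n : ℕ) (hg : Good S.τ K.τ₀ K.β a n) (hD : InSet S.D a n) : S.OK a n := by
  induction n using Nat.strong_induction_on generalizing a with
  | _ n ih =>
  by_cases hin : InSet D₀ a n
  · exact h0 a n hg hin
  refine ok_of_split hg hD fun i j hn hd => ?_
  subst hn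
  have gl := good_left hD hg hd
  have gr := good_right hD hg hd
  have dl := inSet_left hD (show i ≤ i + 1 + j by omega)
  have dr := inSet_right hD
  have ok₁ := ih i (by omega) a gl dl
  have ok₂ := ih j (by omega) (a + i + 1) gr dr
  refine ⟨ok₁, ok₂, ?_⟩
  have hmD : a + (i : ℤ) ∈ S.D := hD i (by omega)
  -- If the deepest visit lay in D₀, all shallower visits would as well, a case already treated.
  have hm0 : a + (i : ℤ) ∉ D₀ := by
    intro h
    exact hin fun k hk => hmono _ h _ (hD k hk) (hd k hk)
  set m := a + (i : ℤ) with hm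
  have hτ1 := S.one_le_τ m hmD
  have hB := K.one_le_B
  have hv1 : jetNorm s t (slope (S.mat a i)) ≤ 1 := by
    have := ok₁.slope_le; have := inv_lam_le (K := K); linarith
  refine InvBd.mono ?_ (hL _ hτ1)
  -- The true pivot is a perturbation of the pivot for V and W, whose inverse is known. The factor 2
  -- lost here is the difference between L₁ and L.
  refine InvBd.perturb S.hs (hκ m hmD) ?_
  have hE : 0 < Real.exp (L₁ * S.τ m) := Real.exp_pos _
  rcases href m hmD hm0 with ⟨hsh, hV, hW'⟩ | ⟨hdp, X, n₁, n₂, hX, hτ₁, hτ₂, r₁, r₂, eV, eW⟩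
  · have h1 : jetNorm s t (slope (S.mat a i) - V m) ≤ 2 * e₀ := by
      have := ok₁.slope_le
      have := jetNorm_sub (s := s) (t := t) (slope (S.mat a i)) (V m)
      have := inv_lam_nonneg (K := K)
      linarith
    have h2 : jetNorm s t (coslope (S.mat (m + 1) j) - W m) ≤ 2 * e₀ := by
      have := ok₂.coslope_le
      have := jetNorm_sub (s := s) (t := t) (coslope (S.mat (m + 1) j)) (W m)
      have := inv_lam_nonneg (K := K)
      linarith
    have h3 := jetNorm_kap_sub_le S.hs (S.c_le m) (S.σ_le m) hv1 (hW m) h1 h2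
    have h4 := hshallow _ hτ1 hsh
    have h5 := mul_le_mul_of_nonneg_left h3 hE.le
    unfold pivot
    linarith
  · have hgm := hg i j rfl
    have hnot : ¬ S.τ m ≤ K.τ₀ := not_le.2 hdp
    obtain ⟨hi, hj⟩ := hgm.resolve_left hnot
    -- The slopes of the two pieces must be compared with those of reference segments that may be
    -- longer than the current one. The latter avoid the new visits, so the family mixes segments in
    -- D₀ of any length with shorter segments covered by the induction.
    set Q : ℤ → ℕ → Prop := fun a' n' => Good S.τ K.τ₀ K.β a' n' ∧ InSet S.D a' n' ∧
      (InSet D₀ a' n' ∨ n' < i + 1 + j) with hQ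
    have hfam : S.Family Q := by
      rintro a' n' ⟨q1, q2, q3⟩
      refine ⟨?_, q1, q2, fun i' j' hn' hd' => ?_⟩
      · rcases q3 with q3 | q3
        · exact h0 _ _ q1 q3
        · exact ih n' q3 a' q1 q2
      · subst hn'
        refine ⟨⟨good_left q2 q1 hd', inSet_left q2 (by omega), ?_⟩,
          ⟨good_right q2 q1 hd', inSet_right q2, ?_⟩⟩
        · exact q3.imp (fun h => inSet_left h (by omega)) (fun h => by omega)
        · exact q3.imp (fun h => inSet_right h) (fun h => by omega)
    have hQl : Q a i := ⟨gl, dl, Or.inr (by omega)⟩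
    have hQr : Q (m + 1) j := ⟨gr, dr, Or.inr (by omega)⟩
    have sub : ∀ {a' n'}, InSet D₀ a' n' → InSet S.D a' n' := fun h k hk => hD₀ (h k hk)
    -- The constant is set so that the factor 3 of the interpolation and the factor 4B of the pivot
    -- end at 1/2.
    have small : ∀ {k : ℕ}, S.τ m ≤ (k : ℝ) ^ K.β →
        2 * K.lam⁻¹ ^ k ≤
          1 / (24 * K.B * (Real.exp (L₁ * S.τ m) * Real.exp (C₃ * S.τ m))) := by
      intro k hk
      have h1 := hdeep k _ hτ1 hk
      have h2 : 0 < Real.exp (C₃ * S.τ m) := Real.exp_pos _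
      have h3 : 0 < K.lam ^ k := pow_pos lam_pos _
      rw [inv_pow, le_div_iff₀ (by positivity)]
      have h4 : (K.lam ^ k)⁻¹ * K.lam ^ k = 1 := inv_mul_cancel₀ h3.ne'
      have h5 := mul_le_mul_of_nonneg_left h1 (inv_nonneg.2 h3.le)
      linarith
    have min_le : ∀ {k l : ℕ}, S.τ m ≤ (k : ℝ) ^ K.β → S.τ m ≤ (l : ℝ) ^ K.β →
        S.τ m ≤ ((min k l : ℕ) : ℝ) ^ K.β := by
      intro k l hk hl
      rcases min_choice k l with h | h <;> rw [h] <;> assumption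
    have cmpl : ∀ n' : ℕ, S.τ m ≤ (n' : ℝ) ^ K.β → RefSeg S D₀ m n' →
        jetNorm s t (slope (S.mat a i) - slope (S.mat (m - n') n')) ≤
          1 / (24 * K.B * (Real.exp (L₁ * S.τ m) * Real.exp (C₃ * S.τ m))) := by
      intro n' hτ' r
      refine (hfam.compare_le (k := min n' i) (a := m - n') (n := n') (a' := a) (n' := i) ?_
        ⟨r.1, sub r.2.1, Or.inl r.2.1⟩ hQl (min_le_left _ _) (min_le_right _ _)).trans
        (small (min_le hτ' hi))
      rw [hm]; ring
    have cmpr : ∀ n' : ℕ, S.τ m ≤ (n' : ℝ) ^ K.β → RefSeg S D₀ m n' →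
        jetNorm s t (coslope (S.mat (m + 1) j) - coslope (S.mat (m + 1) n')) ≤
          1 / (24 * K.B * (Real.exp (L₁ * S.τ m) * Real.exp (C₃ * S.τ m))) := by
      intro n' hτ' r
      exact (hfam.compare_coslope_le (k := min n' j) (a := m + 1) (n := n') (n' := j)
        ⟨r.2.2.1, sub r.2.2.2, Or.inl r.2.2.2⟩ hQr (min_le_left _ _) (min_le_right _ _)).trans
        (small (min_le hτ' hj))
    have hE3 : 1 ≤ Real.exp (C₃ * S.τ m) := Real.one_le_exp (by positivity)
    have h1 := jetNorm_interp_le S.hs hE3 hX (cmpl n₁ hτ₁ r₁) (cmpl n₂ hτ₂ r₂)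
    have h2 := jetNorm_interp_le S.hs hE3 hX (cmpr n₁ hτ₁ r₁) (cmpr n₂ hτ₂ r₂)
    rw [← eV] at h1
    rw [← eW] at h2
    have h3 := jetNorm_kap_sub_le S.hs (S.c_le m) (S.σ_le m) hv1 (hW m) h1 h2
    have h5 := mul_le_mul_of_nonneg_left h3 hE.le
    unfold pivot
    refine h5.trans (le_of_eq ?_)
    have : K.B ≠ 0 := by positivity
    field_simp
    norm_num

end SegData

/-! ### Numbers of bounded type are badly approximable -/

section Diophantine

open GenContFract

lemma not_terminatedAt_of_irrational {α : ℝ} (hα : Irrational α) (n : ℕ) :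
    ¬ (GenContFract.of α).TerminatedAt n := by
  intro h
  obtain ⟨q, hq⟩ := (terminates_iff_rat α).1 ⟨n, h⟩
  exact hα ⟨q, hq.symm⟩

/-- Two consecutive terms are carried along because the recurrence has order two. Integrality is
what makes a nonzero m p_k - p q_k at least 1 in absolute value. -/
lemma contsAux_int {α : ℝ} (hα : Irrational α) (n : ℕ) :
    (∃ a b : ℤ, ((GenContFract.of α).contsAux n) = ⟨(a : ℝ), (b : ℝ)⟩) ∧
    (∃ a b : ℤ, ((GenContFract.of α).contsAux (n + 1)) = ⟨(a : ℝ), (b : ℝ)⟩) := by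
  induction n with
  | zero =>
    refine ⟨⟨1, 0, by simp [contsAux]⟩, ⟨⌊α⌋, 1, by simp [contsAux, of_h_eq_floor]⟩⟩
  | succ n ih =>
    refine ⟨ih.2, ?_⟩
    obtain ⟨⟨a, b, h1⟩, ⟨a', b', h2⟩⟩ := ih
    obtain ⟨gp, hgp⟩ : ∃ gp, (GenContFract.of α).s.get? n = some gp :=
      Option.ne_none_iff_exists'.1 (not_terminatedAt_of_irrational hα n)
    obtain ⟨ha, z, hz⟩ := of_partNum_eq_one_and_exists_int_partDen_eq hgp
    have := contsAux_recurrence hgp h1 h2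
    refine ⟨z * a' + a, z * b' + b, ?_⟩
    rw [this, ha, hz]
    push_cast
    simp

lemma exists_int_nums_dens {α : ℝ} (hα : Irrational α) (n : ℕ) :
    ∃ a b : ℤ, (GenContFract.of α).nums n = a ∧ (GenContFract.of α).dens n = b := by
  obtain ⟨a, b, h⟩ := (contsAux_int hα n).2
  refine ⟨a, b, ?_, ?_⟩
  · rw [num_eq_conts_a, nth_cont_eq_succ_nth_contAux, h]
  · rw [den_eq_conts_b, nth_cont_eq_succ_nth_contAux, h]

lemma fib_le_convDen {α : ℝ} (hα : Irrational α) (n : ℕ) : (Nat.fib (n + 1) : ℝ) ≤ convDen α n :=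
  succ_nth_fib_le_of_nth_den (Or.inr (not_terminatedAt_of_irrational hα _))

lemma one_le_convDen {α : ℝ} (hα : Irrational α) (n : ℕ) : 1 ≤ convDen α n :=
  le_trans (by exact_mod_cast Nat.fib_pos.2 n.succ_pos) (fib_le_convDen hα n)

lemma natCast_le_convDen {α : ℝ} (hα : Irrational α) {n : ℕ} (hn : 5 ≤ n) :
    (n : ℝ) ≤ convDen α n := by
  refine le_trans ?_ (fib_le_convDen hα n)
  exact_mod_cast (Nat.le_fib_self hn).trans (Nat.fib_le_fib_succ)

lemma abs_convDen_mul_sub_le {α : ℝ} (hα : Irrational α) (n : ℕ) :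
    |convDen α n * α - (GenContFract.of α).nums n| ≤ 1 / convDen α (n + 1) := by
  have h := abs_sub_convs_le (not_terminatedAt_of_irrational hα n)
  have h1 := one_le_convDen hα n
  have h2 := one_le_convDen hα (n + 1)
  have e : (GenContFract.of α).convs n = (GenContFract.of α).nums n / convDen α n := rfl
  have e2 : convDen α n * α - (GenContFract.of α).nums n =
      convDen α n * (α - (GenContFract.of α).convs n) := by
    rw [e]; field_simp
  rw [e2, abs_mul, abs_of_pos (by linarith)]
  refine (mul_le_mul_of_nonneg_left h (by linarith)).trans (le_of_eq ?_)
  change convDen α n * (1 / (convDen α n * convDen α (n + 1))) = _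
  field_simp

/-- A number of bounded type is badly approximable. -/
lemma IsBoundedType.badlyApproximable {α : ℝ} (h : IsBoundedType α) :
    ∃ c : ℝ, 0 < c ∧ ∀ (m : ℕ) (p : ℤ), 0 < m → c ≤ m * |m * α - p| := by
  obtain ⟨hα, M, hM, hb⟩ := h
  refine ⟨1 / (4 * (M * M)), by positivity, fun m p hm => ?_⟩
  have hex : ∃ n, 2 * (m : ℝ) < convDen α n := by
    refine ⟨2 * m + 5, ?_⟩
    have := natCast_le_convDen hα (show 5 ≤ 2 * m + 5 by omega)
    push_cast at this; linarith
  classical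
  -- The first denominator beyond 2m; bounded type prevents it from overshooting.
  obtain ⟨n, hn1, hn2⟩ : ∃ n, 2 * (m : ℝ) < convDen α n ∧ convDen α n ≤ M * (2 * m) := by
    have h0 := Nat.find_spec hex
    refine ⟨Nat.find hex, h0, ?_⟩
    rcases Nat.eq_zero_or_pos (Nat.find hex) with h1 | h1
    · rw [h1] at h0
      have e : convDen α 0 = 1 := by simp [convDen]
      have : (1 : ℝ) ≤ m := by exact_mod_cast hm
      rw [e] at h0; linarith
    · obtain ⟨k, hk⟩ : ∃ k, Nat.find hex = k + 1 := ⟨_, (Nat.succ_pred_eq_of_pos h1).symm⟩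
      have := Nat.find_min hex (show k < Nat.find hex by omega)
      push Not at this
      rw [hk]
      exact (hb k).trans (mul_le_mul_of_nonneg_left this hM.le)
  have hm1 : (1 : ℝ) ≤ m := by exact_mod_cast hm
  have mono : ∀ k, convDen α k ≤ convDen α (k + 1) := fun k => of_den_mono
  have hdet : (GenContFract.of α).nums n * convDen α (n + 1) -
      convDen α n * (GenContFract.of α).nums (n + 1) = (-1) ^ (n + 1) :=
    SimpContFract.determinant (s := SimpContFract.of α) (not_terminatedAt_of_irrational hα n)
  -- Consecutive convergents have determinant ±1, so p/m differs from at least one of the two. The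
  -- possible shift from n to n+1 costs the second factor M.
  obtain ⟨k, hk1, hk2, hk3⟩ : ∃ k, convDen α k ≤ M * (M * (2 * m)) ∧ 2 * (m : ℝ) < convDen α (k + 1) ∧
      1 ≤ |m * (GenContFract.of α).nums k - p * convDen α k| := by
    have hint : ∀ k, m * (GenContFract.of α).nums k - p * convDen α k ≠ 0 →
        1 ≤ |m * (GenContFract.of α).nums k - p * convDen α k| := by
      intro k hk
      obtain ⟨a, b, ha, hb⟩ := exists_int_nums_dens hα k
      change convDen α k = b at hb
      rw [ha, hb] at hk ⊢
      have : ((m * a - p * b : ℤ) : ℝ) = m * a - p * b := by push_cast; ring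
      rw [← this] at hk ⊢
      rw [← Int.cast_abs]
      exact_mod_cast Int.one_le_abs (by exact_mod_cast hk)
    have hM1 : 1 ≤ M := by
      have := (mono 0).trans (hb 0)
      have e : convDen α 0 = 1 := by simp [convDen]
      rw [e] at this; linarith
    by_cases h0 : m * (GenContFract.of α).nums n - p * convDen α n = 0
    · refine ⟨n + 1, (hb n).trans (mul_le_mul_of_nonneg_left hn2 hM.le),
        (hn1.trans_le (mono n)).trans_le (mono _), hint _ ?_⟩
      intro h1
      have : (m : ℝ) * (-1) ^ (n + 1) = 0 := by
        rw [← hdet]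
        linear_combination convDen α (n + 1) * h0 - convDen α n * h1
      rcases mul_eq_zero.1 this with h2 | h2
      · linarith
      · exact absurd h2 (by simp)
    · refine ⟨n, hn2.trans ?_, hn1.trans_le (mono n), hint _ h0⟩
      nlinarith
  have hq := one_le_convDen hα k
  have h1 := abs_convDen_mul_sub_le hα k
  -- The integer m p_k - p q_k has absolute value at least 1, and replacing p_k by q_k α changes it
  -- by at most m/q_{k+1} ≤ 1/2.
  have h2 : convDen α k * |m * α - p| ≥ 1 / 2 := by
    have e : convDen α k * (m * α - p) = m * (convDen α k * α - (GenContFract.of α).nums k) +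
        (m * (GenContFract.of α).nums k - p * convDen α k) := by ring
    have h3 : convDen α k * |m * α - p| = |convDen α k * (m * α - p)| := by
      rw [abs_mul, abs_of_pos (show 0 < convDen α k by linarith)]
    rw [h3, e]
    have h4 : |m * (convDen α k * α - (GenContFract.of α).nums k)| ≤ 1 / 2 := by
      rw [abs_mul, abs_of_pos (by linarith : (0 : ℝ) < m)]
      refine (mul_le_mul_of_nonneg_left h1 (by linarith)).trans ?_
      rw [mul_one_div, div_le_div_iff₀ (by linarith) two_pos]
      linarith
    have := abs_sub_abs_le_abs_sub (m * (GenContFract.of α).nums k - p * convDen α k)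
      (-(m * (convDen α k * α - (GenContFract.of α).nums k)))
    rw [abs_neg, sub_neg_eq_add, add_comm (m * (GenContFract.of α).nums k - p * convDen α k)] at this
    linarith
  have h5 : 0 ≤ |m * α - p| := abs_nonneg _
  rw [div_le_iff₀ (by positivity)]
  nlinarith

end Diophantine

/-! ### Distance on the circle, separation and record returns -/

/-- The distance to the critical point. -/
noncomputable def dep (x : ℝ) : ℝ := |Real.sin (x / 2)|

lemma dep_nonneg (x : ℝ) : 0 ≤ dep x := abs_nonneg _

lemma dep_le_one (x : ℝ) : dep x ≤ 1 := Real.abs_sin_le_one _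

lemma dep_neg (x : ℝ) : dep (-x) = dep x := by simp [dep, neg_div]

lemma dep_add_le (x y : ℝ) : dep (x + y) ≤ dep x + dep y := by
  unfold dep
  rw [add_div, Real.sin_add]
  refine (abs_add_le _ _).trans ?_
  rw [abs_mul, abs_mul]
  exact add_le_add (mul_le_of_le_one_right (abs_nonneg _) (Real.abs_cos_le_one _))
    (mul_le_of_le_one_left (abs_nonneg _) (Real.abs_cos_le_one _))

lemma dep_sub_le (x y : ℝ) : dep (x - y) ≤ dep x + dep y := by
  rw [sub_eq_add_neg, ← dep_neg y]; exact dep_add_le _ _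

lemma dep_add_two_pi_int (x : ℝ) (k : ℤ) : dep (x + k * (2 * Real.pi)) = dep x := by
  unfold dep
  have : (x + k * (2 * Real.pi)) / 2 = x / 2 + k * Real.pi := by ring
  rw [this, Real.sin_add_int_mul_pi, abs_mul, abs_zpow, abs_neg, abs_one, one_zpow, one_mul]

lemma dep_add_two_pi (x : ℝ) : dep (x + 2 * Real.pi) = dep x := by
  have := dep_add_two_pi_int x 1
  simpa using this

lemma continuous_dep : Continuous dep := by unfold dep; fun_prop

lemma dep_le_half_abs (x : ℝ) : dep x ≤ |x| / 2 := by
  have := Real.abs_sin_le_abs (x := x / 2)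
  rwa [abs_div, abs_two] at this

lemma abs_div_pi_le_dep {x : ℝ} (hx : |x| ≤ Real.pi) : |x| / Real.pi ≤ dep x := by
  have h1 : ∀ y : ℝ, 0 ≤ y → y ≤ Real.pi → y / Real.pi ≤ dep y := by
    intro y h0 h1
    have := Real.mul_le_sin (x := y / 2) (by positivity) (by linarith)
    refine le_trans (le_of_eq ?_) (this.trans (le_abs_self _))
    field_simp
  rcases le_total 0 x with h | h
  · rw [abs_of_nonneg h] at hx ⊢; exact h1 x h hx
  · rw [abs_of_nonpos h] at hx ⊢; rw [← dep_neg]; exact h1 _ (by linarith) hx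

/-- Separation of the orbit of a rotation of bounded type. -/
lemma IsBoundedType.exists_separation {α : ℝ} (h : IsBoundedType α) :
    ∃ c : ℝ, 0 < c ∧ c ≤ 1 ∧ ∀ m : ℤ, m ≠ 0 → c ≤ |(m : ℝ)| * dep (m * (2 * Real.pi * α)) := by
  obtain ⟨c, hc, hb⟩ := h.badlyApproximable
  have hnat : ∀ m : ℕ, 0 < m → min c 1 ≤ (m : ℝ) * dep (m * (2 * Real.pi * α)) := by
    intro m hm
    set p := round (m * α) with hp
    have h1 := hb m p hm
    have e : (m : ℝ) * (2 * Real.pi * α) = 2 * Real.pi * (m * α - p) + p * (2 * Real.pi) := by ring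
    have h2 : |2 * Real.pi * (m * α - p)| ≤ Real.pi := by
      rw [abs_mul, abs_of_pos Real.two_pi_pos]
      have := abs_sub_round (m * α)
      nlinarith [Real.pi_pos]
    have h3 := abs_div_pi_le_dep h2
    rw [e, dep_add_two_pi_int]
    refine (min_le_left _ _).trans (h1.trans (mul_le_mul_of_nonneg_left (le_trans ?_ h3) (by positivity)))
    rw [abs_mul, abs_of_pos Real.two_pi_pos, le_div_iff₀ Real.pi_pos]
    nlinarith [abs_nonneg (m * α - p), Real.pi_pos]
  refine ⟨min c 1, by positivity, min_le_right _ _, fun m hm => ?_⟩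
  have h1 := hnat m.natAbs (Int.natAbs_pos.2 hm)
  have e1 : ((m.natAbs : ℕ) : ℝ) = |(m : ℝ)| := by rw [Nat.cast_natAbs, Int.cast_abs]
  rw [e1] at h1
  rcases abs_choice (m : ℝ) with h2 | h2
  · rwa [h2] at h1 ⊢
  · rw [h2] at h1 ⊢
    rwa [neg_mul (m : ℝ) (2 * Real.pi * α), dep_neg] at h1

/-- Record returns: `k` realizes the closest return among the times `1, …, Q`. -/
lemma exists_record {α c : ℝ} (hc : ∀ m : ℤ, m ≠ 0 → c ≤ |(m : ℝ)| * dep (m * (2 * Real.pi * α)))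
    {Q : ℕ} (hQ : 0 < Q) :
    ∃ k : ℕ, 0 < k ∧ k ≤ Q ∧ c * (Q + 1) / 4 ≤ k ∧
      ∀ m : ℕ, 0 < m → m ≤ Q → dep (k * (2 * Real.pi * α)) ≤ dep (m * (2 * Real.pi * α)) := by
  obtain ⟨k, hk, hmin⟩ := Finset.exists_min_image (Finset.Icc 1 Q)
    (fun m : ℕ => dep (m * (2 * Real.pi * α))) ⟨1, Finset.mem_Icc.2 ⟨le_rfl, hQ⟩⟩
  rw [Finset.mem_Icc] at hk
  refine ⟨k, hk.1, hk.2, ?_, fun m h1 h2 => hmin m (Finset.mem_Icc.2 ⟨h1, h2⟩)⟩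
  -- Dirichlet makes the closest return at most 4/(Q+1); separation then forces its time to be
  -- comparable to Q.
  obtain ⟨m, hm0, hmQ, hm⟩ := Real.exists_nat_abs_mul_sub_round_le α hQ
  have h1 : dep (m * (2 * Real.pi * α)) ≤ 4 / (Q + 1) := by
    have e : (m : ℝ) * (2 * Real.pi * α) =
      2 * Real.pi * (m * α - round (m * α)) + (round (m * α) : ℤ) * (2 * Real.pi) := by ring
    rw [e, dep_add_two_pi_int]
    refine (dep_le_half_abs _).trans ?_
    rw [abs_mul, abs_of_pos Real.two_pi_pos]
    have : 2 * Real.pi * |m * α - round (m * α)| / 2 ≤ 4 * (1 / (Q + 1)) := by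
      have := Real.pi_le_four
      have := Real.pi_pos
      have h0 : 0 ≤ |(m : ℝ) * α - round (m * α)| := abs_nonneg _
      nlinarith
    rwa [mul_one_div] at this
  have h2 := hmin m (Finset.mem_Icc.2 ⟨hm0, hmQ⟩)
  have h3 := hc k (by exact_mod_cast (show k ≠ 0 by have := hk.1; omega))
  have hk0 : (0 : ℝ) < k := by exact_mod_cast hk.1
  rw [Int.cast_natCast, abs_of_pos hk0] at h3
  have h4 := h3.trans (mul_le_mul_of_nonneg_left (h2.trans h1) hk0.le)
  rw [mul_div_assoc', le_div_iff₀ (by positivity)] at h4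
  linarith

/-! ### Cauchy estimates for exponentials of powers -/

section Cauchy

lemma iteratedDeriv_eq_re {g : ℝ → ℝ} {F : ℂ → ℂ} {x ρ : ℝ}
    (hF : DifferentiableOn ℂ F (Metric.ball (x : ℂ) ρ))
    (hg : ∀ y : ℝ, |y - x| < ρ → F y = g y) (k : ℕ) :
    ∀ y : ℝ, |y - x| < ρ → iteratedDeriv k g y = (iteratedDeriv k F y).re := by
  have hmem : ∀ y : ℝ, |y - x| < ρ → (y : ℂ) ∈ Metric.ball (x : ℂ) ρ := by
    intro y hy
    rw [Metric.mem_ball, dist_eq_norm, ← Complex.ofReal_sub, Complex.norm_real]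
    exact hy
  induction k with
  | zero => intro y hy; simp [hg y hy]
  | succ k ih =>
    intro y hy
    have ha : AnalyticAt ℂ F y :=
      hF.analyticAt (Metric.isOpen_ball.mem_nhds (hmem y hy))
    have h1 : HasDerivAt (iteratedDeriv k F) (iteratedDeriv (k + 1) F y) y := by
      rw [iteratedDeriv_succ, iteratedDeriv_eq_iterate]
      exact (ha.iterated_deriv k).differentiableAt.hasDerivAt
    rw [iteratedDeriv_succ, ← h1.real_of_complex.deriv]
    apply Filter.EventuallyEq.deriv_eq
    have : ∀ᶠ y' in 𝓝 y, |y' - x| < ρ :=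
      (isOpen_lt (by fun_prop) continuous_const).mem_nhds hy
    filter_upwards [this] with y' hy' using ih y' hy'

/-- Cauchy estimates for a real function with a holomorphic extension. -/
lemma abs_iteratedDeriv_le_of_holomorphic {g : ℝ → ℝ} {F : ℂ → ℂ} {x ρ M : ℝ} (hρ : 0 < ρ)
    (hF : DifferentiableOn ℂ F (Metric.ball (x : ℂ) ρ))
    (hg : ∀ y : ℝ, |y - x| < ρ → F y = g y) (hM : ∀ z ∈ Metric.ball (x : ℂ) ρ, ‖F z‖ ≤ M)
    (k : ℕ) : |iteratedDeriv k g x| ≤ (k ! : ℕ) * (2 / ρ) ^ k * M := by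
  rw [iteratedDeriv_eq_re hF hg k x (by simpa using hρ)]
  refine (Complex.abs_re_le_norm _).trans ?_
  have h := Complex.norm_iteratedDeriv_le_of_forall_mem_sphere_norm_le k (half_pos hρ)
    (f := F) (c := x) (C := M) ?_ ?_
  · refine h.trans (le_of_eq ?_)
    rw [div_eq_mul_inv, ← inv_pow, inv_div]
    ring
  · have : DifferentiableOn ℂ F (Metric.closedBall (x : ℂ) (ρ / 2)) :=
      hF.mono (Metric.closedBall_subset_ball (by linarith))
    exact this.diffContOnCl_ball subset_rfl
  · intro z hz
    exact hM z (Metric.sphere_subset_closedBall.trans (Metric.closedBall_subset_ball (by linarith)) hz)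

/-- Keeps the real part of the power in [1/2, 3/2] on a complex disc, so there the exponent changes
by at most a factor in this range. -/
lemma exists_cpow_near_one (a : ℝ) : ∃ θ : ℝ, 0 < θ ∧ θ ≤ 1 / 2 ∧
    ∀ z : ℂ, ‖z - 1‖ ≤ θ → ‖z ^ (-a : ℂ) - 1‖ ≤ 1 / 2 := by
  have hc : ContinuousAt (fun z : ℂ => z ^ (-a : ℂ)) 1 :=
    continuousAt_id.cpow continuousAt_const (by simp)
  rw [Metric.continuousAt_iff] at hc
  obtain ⟨δ, hδ, h⟩ := hc (1 / 2) (by norm_num)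
  refine ⟨min (δ / 2) (1 / 2), by positivity, min_le_right _ _, fun z hz => ?_⟩
  have := h (x := z) (by rw [dist_eq_norm]; exact (hz.trans (min_le_left _ _)).trans_lt (by linarith))
  rw [dist_eq_norm, Complex.one_cpow] at this
  exact this.le

/-- Derivatives of `exp (T h ^ (-a))` at a point where `h` does not vary much on a complex disc. -/
lemma abs_iteratedDeriv_exp_rpow_le {a θ : ℝ} (hθ' : θ ≤ 1 / 2)
    (hθ : ∀ z : ℂ, ‖z - 1‖ ≤ θ → ‖z ^ (-a : ℂ) - 1‖ ≤ 1 / 2)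
    {h : ℝ → ℝ} {hc : ℂ → ℂ} (hd : Differentiable ℂ hc) {x ρ : ℝ}
    (hρ : 0 < ρ) (hx : 0 < h x) (hh : ∀ y : ℝ, |y - x| < ρ → hc y = h y)
    (hball : ∀ z ∈ Metric.ball (x : ℂ) ρ, ‖hc z - h x‖ ≤ θ * h x)
    {T E : ℝ} (hE : ∀ u : ℝ, |u - 1| ≤ 1 / 2 → T * h x ^ (-a) * u ≤ E)
    {g : ℝ → ℝ} (hg : ∀ y : ℝ, |y - x| < ρ → g y = Real.exp (T * h y ^ (-a))) (k : ℕ) :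
    |iteratedDeriv k g x| ≤ (k ! : ℕ) * (2 / ρ) ^ k * Real.exp E := by
  have hx' : (h x : ℂ) ≠ 0 := by exact_mod_cast hx.ne'
  have hnear : ∀ z ∈ Metric.ball (x : ℂ) ρ, ‖hc z / h x - 1‖ ≤ θ := by
    intro z hz
    have e : hc z / h x - 1 = (hc z - h x) / h x := by field_simp
    rw [e, norm_div, Complex.norm_real, Real.norm_of_nonneg hx.le, div_le_iff₀ hx]
    exact hball z hz
  have hslit : ∀ z : ℂ, ‖z - 1‖ ≤ θ → z ∈ Complex.slitPlane := by
    intro z hz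
    left
    have := (Complex.abs_re_le_norm (z - 1)).trans hz
    rw [Complex.sub_re, Complex.one_re] at this
    linarith [(abs_le.1 this).1]
  -- The base is divided by h(x), so that it stays near 1, away from the cut of the principal
  -- branch.
  refine abs_iteratedDeriv_le_of_holomorphic (F := fun z => Complex.exp ((T * h x ^ (-a) : ℝ) *
    (hc z / h x) ^ (-a : ℂ))) hρ ?_ ?_ ?_ k
  · intro z hz
    apply DifferentiableAt.differentiableWithinAt
    refine DifferentiableAt.cexp (DifferentiableAt.const_mul ?_ _)
    exact DifferentiableAt.cpow_const ((hd z).div_const _) (hslit _ (hnear z hz))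
  · intro y hy
    have hm : (y : ℂ) ∈ Metric.ball (x : ℂ) ρ := by
      rw [Metric.mem_ball, dist_eq_norm, ← Complex.ofReal_sub, Complex.norm_real]
      exact hy
    have h1 := hslit _ (hnear y hm)
    rw [hh y hy, ← Complex.ofReal_div] at h1
    have h2 : 0 < h y / h x := by simpa [Complex.mem_slitPlane_iff] using h1
    have h3 : 0 < h y := by
      have := mul_pos h2 hx
      rwa [div_mul_cancel₀ _ hx.ne'] at this
    rw [hh y hy, hg y hy, ← Complex.ofReal_div, ← Complex.ofReal_neg,
      ← Complex.ofReal_cpow h2.le, ← Complex.ofReal_mul, ← Complex.ofReal_exp, mul_assoc,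
      ← Real.mul_rpow hx.le h2.le, mul_div_cancel₀ _ hx.ne']
  · intro z hz
    rw [Complex.norm_exp, Real.exp_le_exp, Complex.re_ofReal_mul]
    refine hE _ ?_
    have := (Complex.abs_re_le_norm _).trans (hθ _ (hnear z hz))
    simpa using this

end Cauchy

/-! ### Smoothness of flat functions -/

section Flat

lemma rpow_exp_le {b c : ℝ} (hb : 0 < b) (hc : 0 < c) (k : ℕ) :
    ∃ C : ℝ, 0 ≤ C ∧ ∀ d : ℝ, 0 < d → d ≤ 1 → (1 / d) ^ k * Real.exp (-c * d ^ (-b)) ≤ C * d ^ 2 := by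
  obtain ⟨n, hn⟩ := exists_nat_ge ((k + 2 : ℝ) / b)
  refine ⟨(n ! : ℕ) / c ^ n, by positivity, fun d h0 h1 => ?_⟩
  have h2 := Real.pow_div_factorial_le_exp (c * d ^ (-b)) (by positivity) n
  rw [neg_mul, Real.exp_neg]
  have h3 : (1 / d) ^ (k + 2) ≤ (d ^ (-b)) ^ n := by
    rw [one_div, inv_pow, ← Real.rpow_natCast d, ← Real.rpow_neg h0.le, ← Real.rpow_mul_natCast h0.le]
    apply Real.rpow_le_rpow_of_exponent_ge h0 h1
    rw [div_le_iff₀ hb] at hn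
    push_cast
    linarith
  rw [mul_pow, div_le_iff₀ (by positivity)] at h2
  have h4 : c ^ n * (1 / d) ^ (k + 2) ≤ Real.exp (c * d ^ (-b)) * (n ! : ℕ) :=
    (mul_le_mul_of_nonneg_left h3 (by positivity)).trans h2
  rw [← div_eq_mul_inv, div_le_iff₀ (Real.exp_pos _)]
  rw [pow_add] at h4
  have h5 : (1 / d) ^ k = (c ^ n * ((1 / d) ^ k * (1 / d) ^ 2)) * d ^ 2 / c ^ n := by
    field_simp
  rw [h5]
  calc _ ≤ (Real.exp (c * d ^ (-b)) * (n ! : ℕ)) * d ^ 2 / c ^ n := by gcongr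
    _ = _ := by ring

/-- A function which is smooth off the zero set of a gauge `d` and flat on it is smooth. -/
lemma contDiff_of_flat {d g : ℝ → ℝ} (hd0 : ∀ x, 0 ≤ d x) (hd1 : ∀ x, d x ≤ 1)
    (hd : ∀ x y, d x = 0 → d y ≤ |y - x|) (hg0 : ∀ x, d x = 0 → g x = 0)
    (hg : ∀ x, 0 < d x → ContDiffAt ℝ ∞ g x) {A b c : ℝ} (hb : 0 < b) (hc : 0 < c)
    (hbd : ∀ x, 0 < d x → ∀ k : ℕ,
      |iteratedDeriv k g x| ≤ (k ! : ℕ) * (A / d x) ^ k * Real.exp (-c * d x ^ (-b))) :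
    ContDiff ℝ ∞ g ∧ ∀ x, d x = 0 → ∀ k, iteratedDeriv k g x = 0 := by
  have hder : ∀ k x, 0 < d x → HasDerivAt (iteratedDeriv k g) (iteratedDeriv (k + 1) g x) x := by
    intro k x hx
    rw [iteratedDeriv_succ]
    refine DifferentiableAt.hasDerivAt ?_
    have := (hg x hx).iteratedFDeriv_right (i := k) (m := 1) (by exact_mod_cast le_top)
    have h2 := this.differentiableAt one_ne_zero
    rw [iteratedDeriv_eq_equiv_comp]
    exact ((ContinuousMultilinearMap.piFieldEquiv ℝ (Fin k) ℝ).symm.differentiable _).comp x h2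
  -- The second power of d makes each extended derivative differentiable on the zero set, with
  -- derivative zero; the induction on the order then closes.
  have hflat : ∀ k : ℕ, ∃ C : ℝ, 0 ≤ C ∧ ∀ y, 0 < d y → |iteratedDeriv k g y| ≤ C * d y ^ 2 := by
    intro k
    obtain ⟨C, hC, h⟩ := rpow_exp_le hb hc k
    refine ⟨(k ! : ℕ) * |A| ^ k * C, by positivity, fun y hy => ?_⟩
    refine (hbd y hy k).trans ?_
    have h1 := h (d y) hy (hd1 y)
    have h2 : (A / d y) ^ k ≤ |A| ^ k * (1 / d y) ^ k := by
      refine (le_abs_self _).trans (le_of_eq ?_)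
      rw [abs_pow, abs_div, abs_of_pos hy, div_pow, div_pow, one_pow]; ring
    calc _ ≤ (k ! : ℕ) * (|A| ^ k * (1 / d y) ^ k) * Real.exp (-c * d y ^ (-b)) := by gcongr
      _ = (k ! : ℕ) * |A| ^ k * ((1 / d y) ^ k * Real.exp (-c * d y ^ (-b))) := by ring
      _ ≤ (k ! : ℕ) * |A| ^ k * (C * d y ^ 2) := by gcongr
      _ = _ := by ring
  have hflat' : ∀ k : ℕ, (∀ x, d x = 0 → iteratedDeriv k g x = 0) →
      ∀ x, d x = 0 → HasDerivAt (iteratedDeriv k g) 0 x := by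
    intro k h0 x hx
    obtain ⟨C, hC, h⟩ := hflat k
    rw [hasDerivAt_iff_isLittleO]
    simp only [smul_zero, sub_zero, h0 x hx]
    have hO : (fun y => iteratedDeriv k g y) =O[𝓝 x] fun y => (y - x) ^ 2 := by
      refine Asymptotics.IsBigO.of_bound C (Filter.Eventually.of_forall fun y => ?_)
      rw [Real.norm_eq_abs, Real.norm_eq_abs, abs_pow]
      rcases (hd0 y).eq_or_lt with hy | hy
      · rw [h0 y hy.symm, abs_zero]; positivity
      · exact (h y hy).trans (by have := hd x y hx; have := hd0 y; gcongr)
    refine hO.trans_isLittleO ?_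
    have := (Asymptotics.isLittleO_pow_id (𝕜 := ℝ) (one_lt_two)).comp_tendsto
      (show Filter.Tendsto (fun y => y - x) (𝓝 x) (𝓝 0) by
        have : Filter.Tendsto (fun y => y - x) (𝓝 x) (𝓝 (x - x)) :=
          (continuous_id.sub continuous_const).tendsto x
        rwa [sub_self] at this)
    exact this
  have hzero : ∀ k x, d x = 0 → iteratedDeriv k g x = 0 := by
    intro k
    induction k with
    | zero => intro x hx; simpa using hg0 x hx
    | succ k ih => intro x hx; rw [iteratedDeriv_succ]; exact (hflat' k ih x hx).deriv
  refine ⟨contDiff_of_differentiable_iteratedDeriv fun k _ x => ?_, fun x hx k => hzero k x hx⟩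
  rcases (hd0 x).eq_or_lt with hx | hx
  · exact (hflat' k (hzero k) x hx.symm).differentiableAt
  · exact (hder k x hx).differentiableAt

end Flat


/-! ### The flat factor and its inverse -/

section FlatFunction

lemma norm_sin_add_sub_sin_le (x : ℝ) {w : ℂ} (hw : ‖w‖ ≤ 1) :
    ‖Complex.sin (x + w) - Complex.sin x‖ ≤ 4 * ‖w‖ := by
  have h1 : ∀ z : ℂ, ‖z‖ = ‖w‖ → ‖Complex.exp z - 1‖ ≤ 2 * ‖w‖ := by
    intro z hz
    rw [← hz] at hw ⊢
    exact Complex.norm_exp_sub_one_le hw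
  have ha := h1 (w * Complex.I) (by simp)
  have hb := h1 (-w * Complex.I) (by simp)
  have hs : ‖Complex.sin w‖ ≤ 2 * ‖w‖ := by
    have e : Complex.sin w = ((Complex.exp (-w * Complex.I) - 1) - (Complex.exp (w * Complex.I) - 1)) *
      Complex.I / 2 := by rw [Complex.sin]; ring
    rw [e, norm_div, norm_mul, Complex.norm_I, Complex.norm_two, mul_one]
    have := norm_sub_le (Complex.exp (-w * Complex.I) - 1) (Complex.exp (w * Complex.I) - 1)
    linarith
  have hc : ‖Complex.cos w - 1‖ ≤ 2 * ‖w‖ := by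
    have e : Complex.cos w - 1 = ((Complex.exp (w * Complex.I) - 1) +
      (Complex.exp (-w * Complex.I) - 1)) / 2 := by rw [Complex.cos]; ring
    rw [e, norm_div, Complex.norm_two]
    have := norm_add_le (Complex.exp (w * Complex.I) - 1) (Complex.exp (-w * Complex.I) - 1)
    linarith
  have e : Complex.sin (x + w) - Complex.sin x =
      (Real.sin x : ℂ) * (Complex.cos w - 1) + (Real.cos x : ℂ) * Complex.sin w := by
    rw [Complex.sin_add, Complex.ofReal_sin, Complex.ofReal_cos]; ring
  rw [e]
  refine (norm_add_le _ _).trans ?_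
  rw [norm_mul, norm_mul, Complex.norm_real, Complex.norm_real]
  have h3 : ‖Real.sin x‖ ≤ 1 := Real.abs_sin_le_one x
  have h4 : ‖Real.cos x‖ ≤ 1 := Real.abs_cos_le_one x
  nlinarith [norm_nonneg (Real.sin x), norm_nonneg (Real.cos x), norm_nonneg w,
    norm_nonneg (Complex.cos w - 1), norm_nonneg (Complex.sin w)]

/-- A `2π`-periodic function which is flat at `2πℤ`. -/
noncomputable def flat (b H x : ℝ) : ℝ :=
  if Real.sin (x / 2) = 0 then 0 else Real.exp (-H * (Real.sin (x / 2) ^ 2) ^ (-(b / 2)))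

lemma dep_pos_iff {x : ℝ} : 0 < dep x ↔ Real.sin (x / 2) ≠ 0 := abs_pos

lemma sq_sin_rpow (b x : ℝ) : (Real.sin (x / 2) ^ 2) ^ (-(b / 2)) = dep x ^ (-b) := by
  rw [dep, ← sq_abs, ← Real.rpow_natCast, ← Real.rpow_mul (abs_nonneg _)]
  congr 1; push_cast; ring

lemma flat_of_dep_eq_zero {b H x : ℝ} (hx : dep x = 0) : flat b H x = 0 :=
  if_pos (abs_eq_zero.1 hx)

lemma flat_of_dep_pos {b H x : ℝ} (hx : 0 < dep x) : flat b H x = Real.exp (-H * dep x ^ (-b)) := by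
  rw [flat, if_neg (dep_pos_iff.1 hx), sq_sin_rpow]

lemma flat_periodic (b H : ℝ) : Function.Periodic (flat b H) (2 * Real.pi) := by
  intro x
  have h := dep_add_two_pi x
  rcases (dep_nonneg x).eq_or_lt with h0 | h0
  · rw [flat_of_dep_eq_zero h0.symm, flat_of_dep_eq_zero (h.trans h0.symm)]
  · rw [flat_of_dep_pos h0, flat_of_dep_pos (by rwa [h]), h]

lemma dep_le_abs_sub {x y : ℝ} (hx : dep x = 0) : dep y ≤ |y - x| := by
  have h1 := dep_add_le x (y - x)
  have h2 := dep_le_half_abs (y - x)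
  rw [add_sub_cancel, hx] at h1
  linarith [abs_nonneg (y - x)]

lemma flat_eventuallyEq (b H : ℝ) {x : ℝ} (hx : 0 < dep x) :
    flat b H =ᶠ[𝓝 x] fun y => Real.exp (-H * (Real.sin (y / 2) ^ 2) ^ (-(b / 2))) := by
  filter_upwards [(isOpen_lt continuous_const continuous_dep).mem_nhds hx] with y hy
  rw [flat, if_neg (dep_pos_iff.1 hy)]

lemma flat_contDiffAt (b H : ℝ) {x : ℝ} (hx : 0 < dep x) : ContDiffAt ℝ ∞ (flat b H) x := by
  refine ContDiffAt.congr_of_eventuallyEq ?_ (flat_eventuallyEq b H hx)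
  have h0 : Real.sin (x / 2) ^ 2 ≠ 0 := pow_ne_zero _ (dep_pos_iff.1 hx)
  have h1 : ContDiffAt ℝ ∞ (fun y : ℝ => Real.sin (y / 2) ^ 2) x := by fun_prop
  exact (contDiffAt_const.mul (h1.rpow_const_of_ne h0)).exp

/-- Cauchy estimates on a disc of radius proportional to d. It matters that A does not depend on H:
the flatness can later be increased without increasing the Gevrey cost. -/
lemma flat_derivative_bounds (b : ℝ) : ∃ A : ℝ, 0 < A ∧ ∀ H : ℝ, 0 < H → ∀ x : ℝ, 0 < dep x →
    ∀ k : ℕ, |iteratedDeriv k (flat b H) x| ≤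
      (k ! : ℕ) * (A / dep x) ^ k * Real.exp (-(H / 2) * dep x ^ (-b)) ∧
    |iteratedDeriv k (fun y => (flat b H y)⁻¹) x| ≤
      (k ! : ℕ) * (A / dep x) ^ k * Real.exp (2 * H * dep x ^ (-b)) := by
  obtain ⟨θ, hθ0, hθ1, hθ⟩ := exists_cpow_near_one (b / 2)
  refine ⟨40 / θ, by positivity, fun H hH x hx k => ?_⟩
  -- On this disc the sine moves by at most θ d/10, hence its square by at most θ d². The square
  -- replaces the absolute value because it extends holomorphically.
  set ρ := θ * dep x / 20 with hρ
  have hρ0 : 0 < ρ := by positivity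
  have e : 2 / ρ = 40 / θ / dep x := by rw [hρ]; field_simp; norm_num
  have hd : Differentiable ℂ (fun z : ℂ => Complex.sin (z / 2) ^ 2) := by fun_prop
  have hsx : 0 < Real.sin (x / 2) ^ 2 := by have := dep_pos_iff.1 hx; positivity
  have hh : ∀ y : ℝ, |y - x| < ρ → (fun z : ℂ => Complex.sin (z / 2) ^ 2) y =
      ((Real.sin (y / 2) ^ 2 : ℝ) : ℂ) := by intro y _; push_cast; rfl
  have hball : ∀ z ∈ Metric.ball (x : ℂ) ρ,
      ‖Complex.sin (z / 2) ^ 2 - ((Real.sin (x / 2) ^ 2 : ℝ) : ℂ)‖ ≤ θ * Real.sin (x / 2) ^ 2 := by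
    intro z hz
    rw [Metric.mem_ball, dist_eq_norm] at hz
    set w := (z - x) / 2 with hw
    have hwn : ‖w‖ ≤ ρ / 2 := by rw [hw, norm_div, Complex.norm_two]; linarith
    have hd1 := dep_le_one x
    have hρ1 : ρ ≤ 1 := by
      rw [hρ]; nlinarith
    have h1 := norm_sin_add_sub_sin_le (x / 2) (w := w) (by linarith)
    have ez : ((x / 2 : ℝ) : ℂ) + w = z / 2 := by rw [hw]; push_cast; ring
    rw [ez] at h1
    set S := Complex.sin (z / 2) - Complex.sin ((x / 2 : ℝ) : ℂ) with hS
    have es : Complex.sin (z / 2) ^ 2 - ((Real.sin (x / 2) ^ 2 : ℝ) : ℂ) =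
        S * (2 * (Real.sin (x / 2) : ℝ) + S) := by
      rw [hS]; push_cast; ring
    rw [es, norm_mul]
    have h2 : ‖(2 * (Real.sin (x / 2) : ℝ) + S : ℂ)‖ ≤ 2 * dep x + ‖S‖ := by
      refine (norm_add_le _ _).trans (le_of_eq ?_)
      rw [norm_mul, Complex.norm_two, Complex.norm_real]; rfl
    have h3 : ‖S‖ ≤ θ * dep x / 10 := by linarith
    have e2 : Real.sin (x / 2) ^ 2 = dep x ^ 2 := by rw [dep, sq_abs]
    rw [e2]
    calc ‖S‖ * ‖(2 * (Real.sin (x / 2) : ℝ) + S : ℂ)‖ ≤ (θ * dep x / 10) * (2 * dep x + θ * dep x / 10) := by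
          gcongr
          linarith
      _ ≤ θ * dep x ^ 2 := by
          have : 0 ≤ θ * dep x ^ 2 := by positivity
          nlinarith
  have hev : ∀ᶠ y in 𝓝 x, 0 < dep y := (isOpen_lt continuous_const continuous_dep).mem_nhds hx
  have hτ : 0 ≤ dep x ^ (-b) := by positivity
  constructor
  · rw [(flat_eventuallyEq b H hx).iteratedDeriv_eq, ← e]
    refine abs_iteratedDeriv_exp_rpow_le (h := fun y => Real.sin (y / 2) ^ 2) hθ1 (by exact_mod_cast hθ) hd hρ0 hsx hh hball (T := -H) ?_ (fun y _ => rfl) k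
    intro u hu
    simp only [sq_sin_rpow]
    have := (abs_le.1 hu).1
    have : 0 ≤ H * dep x ^ (-b) := by positivity
    nlinarith
  · have : (fun y => (flat b H y)⁻¹) =ᶠ[𝓝 x]
        fun y => Real.exp (H * (Real.sin (y / 2) ^ 2) ^ (-(b / 2))) := by
      filter_upwards [flat_eventuallyEq b H hx] with y hy
      rw [hy, ← Real.exp_neg, neg_mul, neg_neg]
    rw [this.iteratedDeriv_eq, ← e]
    refine abs_iteratedDeriv_exp_rpow_le (h := fun y => Real.sin (y / 2) ^ 2) hθ1 (by exact_mod_cast hθ) hd hρ0 hsx hh hball (T := H) ?_ (fun y _ => rfl) k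
    intro u hu
    simp only [sq_sin_rpow]
    have := (abs_le.1 hu).2
    have : 0 ≤ H * dep x ^ (-b) := by positivity
    nlinarith

lemma flat_contDiff {b H : ℝ} (hb : 0 < b) (hH : 0 < H) : ContDiff ℝ ∞ (flat b H) ∧
    ∀ x, dep x = 0 → ∀ k, iteratedDeriv k (flat b H) x = 0 := by
  obtain ⟨A, -, h⟩ := flat_derivative_bounds b
  exact contDiff_of_flat dep_nonneg dep_le_one (fun x y hx => dep_le_abs_sub hx)
    (fun x hx => flat_of_dep_eq_zero hx) (fun x hx => flat_contDiffAt b H hx) hb (half_pos hH)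
    (fun x hx k => (h H hH x hx k).1)

/-- Jet bounds of the flat function and of its inverse. -/
lemma flat_jet_bounds {s σ : ℝ} (hσ : 0 < σ) (hs : 1 ≤ s - σ) : ∃ C : ℝ, 0 ≤ C ∧
    ∀ H : ℝ, 0 < H → ∀ x : ℝ, 0 < dep x → ∀ t,
      jetNorm s t (jet (flat (1 / σ) H) x) ≤ 2 * Real.exp ((C - H / 2) * dep x ^ (-(1 / σ))) ∧
      InvBd s t (jet (flat (1 / σ) H) x) (2 * Real.exp ((C + 2 * H) * dep x ^ (-(1 / σ)))) := by
  obtain ⟨A, hA, h⟩ := flat_derivative_bounds (1 / σ)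
  refine ⟨σ * (2 * A) ^ (1 / σ), by positivity, fun H hH x hx t => ?_⟩
  have key : ∀ (g : ℝ → ℝ) (E : ℝ), (∀ k : ℕ, |iteratedDeriv k g x| ≤
      (k ! : ℕ) * (A / dep x) ^ k * Real.exp (E * dep x ^ (-(1 / σ)))) →
      jetNorm s t (jet g x) ≤
        2 * Real.exp ((σ * (2 * A) ^ (1 / σ) + E) * dep x ^ (-(1 / σ))) := by
    intro g E hg
    refine (jetNorm_jet_le_of_bound (B := Real.exp (E * dep x ^ (-(1 / σ)))) (A := A / dep x) hσ
      (by positivity) t fun k => ?_).trans (le_of_eq ?_)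
    · refine (hg k).trans ?_
      -- Away from the critical point the flat factor is analytic, so one factorial suffices; the
      -- class s - σ ≥ 1 covers it.
      have h1 : (1 : ℝ) ≤ (k ! : ℕ) := by exact_mod_cast k.factorial_pos
      have h2 : ((k ! : ℕ) : ℝ) ≤ ((k ! : ℕ) : ℝ) ^ (s - σ) := by
        conv_lhs => rw [← Real.rpow_one ((k ! : ℕ) : ℝ)]
        exact Real.rpow_le_rpow_of_exponent_le h1 hs
      calc _ = Real.exp (E * dep x ^ (-(1 / σ))) * (A / dep x) ^ k * ((k ! : ℕ) : ℝ) := by ring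
        _ ≤ _ := by gcongr
    · have e1 : (2 * (A / dep x)) ^ (1 / σ) = (2 * A) ^ (1 / σ) * dep x ^ (-(1 / σ)) := by
        rw [← mul_div_assoc, Real.div_rpow (by positivity) hx.le, Real.rpow_neg hx.le]; rfl
      rw [e1, add_mul, Real.exp_add, ← mul_assoc σ]; ring
  refine ⟨?_, ?_⟩
  · rw [sub_eq_add_neg]
    refine key _ _ fun k => ?_
    have := (h H hH x hx k).1
    rwa [neg_mul] at this ⊢
  · refine ⟨jet (fun y => (flat (1 / σ) H y)⁻¹) x, ?_, key _ _ fun k => (h H hH x hx k).2⟩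
    have h0 : flat (1 / σ) H x ≠ 0 := by rw [flat_of_dep_pos hx]; positivity
    have hc := flat_contDiffAt (1 / σ) H hx
    rw [← jet_mul (h := fun y => (flat (1 / σ) H y)⁻¹) hc (hc.inv h0)]
    have : (fun y => flat (1 / σ) H y * (flat (1 / σ) H y)⁻¹) =ᶠ[𝓝 x] fun _ => 1 := by
      filter_upwards [(isOpen_lt continuous_const continuous_dep).mem_nhds hx] with y hy
      exact mul_inv_cancel₀ (by rw [flat_of_dep_pos hy]; positivity)
    rw [jet_congr this, jet_const, map_one]

end FlatFunction

/-! ### Gevrey bump and step functions -/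

section Cutoff

/-- A bump function supported in `[0, 1]`. -/
noncomputable def bump (p t : ℝ) : ℝ :=
  if 0 < t * (1 - t) then Real.exp (-1 * (t * (1 - t)) ^ (-p)) else 0

lemma bump_nonneg (p t : ℝ) : 0 ≤ bump p t := by
  unfold bump; split_ifs
  · positivity
  · exact le_rfl

lemma bump_eventuallyEq (p : ℝ) {t : ℝ} (ht : 0 < t * (1 - t)) :
    bump p =ᶠ[𝓝 t] fun y => Real.exp (-1 * (y * (1 - y)) ^ (-p)) := by
  have : ∀ᶠ y in 𝓝 t, 0 < y * (1 - y) :=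
    (isOpen_lt continuous_const (by fun_prop)).mem_nhds ht
  filter_upwards [this] with y hy
  rw [bump, if_pos hy]

lemma bump_derivative_bounds (p : ℝ) : ∃ A : ℝ, 0 < A ∧ ∀ x : ℝ, 0 < x * (1 - x) →
    ∀ k : ℕ, |iteratedDeriv k (bump p) x| ≤
      (k ! : ℕ) * (A / (x * (1 - x))) ^ k * Real.exp (-(1 / 2) * (x * (1 - x)) ^ (-p)) := by
  obtain ⟨θ, hθ0, hθ1, hθ⟩ := exists_cpow_near_one p
  refine ⟨4 / θ, by positivity, fun x hx k => ?_⟩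
  set ρ := θ * (x * (1 - x)) / 2 with hρ
  have hρ0 : 0 < ρ := by positivity
  have e : 2 / ρ = 4 / θ / (x * (1 - x)) := by rw [hρ]; field_simp; norm_num
  have hx01 : 0 < x ∧ x < 1 := by
    constructor <;> by_contra! h <;> nlinarith
  rw [(bump_eventuallyEq p hx).iteratedDeriv_eq, ← e]
  refine abs_iteratedDeriv_exp_rpow_le (h := fun y => y * (1 - y)) (hc := fun z : ℂ => z * (1 - z))
    hθ1 hθ (by fun_prop) hρ0 hx (fun y _ => by push_cast; rfl) ?_ (T := -1) ?_ (fun y _ => rfl) k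
  · intro z hz
    rw [Metric.mem_ball, dist_eq_norm] at hz
    have e1 : z * (1 - z) - ((x * (1 - x) : ℝ) : ℂ) = (z - x) * ((1 - 2 * x : ℝ) - (z - x)) := by
      push_cast; ring
    rw [e1, norm_mul]
    have h1 : ‖((1 - 2 * x : ℝ) : ℂ) - (z - x)‖ ≤ 1 + ‖z - x‖ := by
      refine (norm_sub_le _ _).trans ?_
      rw [Complex.norm_real, Real.norm_eq_abs]
      have : |1 - 2 * x| ≤ 1 := abs_le.2 ⟨by linarith, by linarith⟩
      linarith
    have h2 : ρ ≤ 1 := by rw [hρ]; nlinarith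
    have h3 : 0 ≤ ‖z - x‖ := norm_nonneg _
    have e2 : θ * (x * (1 - x)) = ρ * 2 := by rw [hρ]; ring
    rw [e2]
    exact mul_le_mul hz.le (by linarith) (norm_nonneg _) hρ0.le
  · intro u hu
    have := (abs_le.1 hu).1
    have : 0 ≤ (x * (1 - x)) ^ (-p) := by positivity
    nlinarith

lemma bump_contDiff {p : ℝ} (hp : 0 < p) : ContDiff ℝ ∞ (bump p) ∧
    ∀ x, x * (1 - x) ≤ 0 → ∀ k, iteratedDeriv k (bump p) x = 0 := by
  obtain ⟨A, -, h⟩ := bump_derivative_bounds p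
  have hmax : ∀ x : ℝ, 0 < max 0 (x * (1 - x)) → 0 < x * (1 - x) := by
    intro x hx; simpa using hx
  have hmax' : ∀ x : ℝ, max 0 (x * (1 - x)) = 0 → x * (1 - x) ≤ 0 := by
    intro x hx; simpa using hx
  suffices hs : ContDiff ℝ ∞ (bump p) ∧ ∀ x : ℝ, max 0 (x * (1 - x)) = 0 →
      ∀ k, iteratedDeriv k (bump p) x = 0 from ⟨hs.1, fun x hx => hs.2 x (max_eq_left hx)⟩
  refine contDiff_of_flat (d := fun x => max 0 (x * (1 - x))) (g := bump p)
    (A := A) (b := p) (c := 1 / 2) (fun x => le_max_left _ _) ?_ ?_ ?_ ?_ hp (by norm_num) ?_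
  · intro x; exact max_le (by norm_num) (by nlinarith [sq_nonneg (x - 1 / 2)])
  · intro x y hx
    have hx' := hmax' x hx
    refine max_le (abs_nonneg _) ?_
    by_cases hy : 0 < y * (1 - y)
    · have hy01 : 0 < y ∧ y < 1 := by
        constructor <;> by_contra! h <;> nlinarith
      rcases le_or_gt x 0 with h0 | h0
      · exact le_trans (by nlinarith) (le_abs_self _)
      · have : 1 ≤ x := by by_contra! h; nlinarith
        exact le_trans (by nlinarith) (neg_le_abs _)
    · exact (not_lt.1 hy).trans (abs_nonneg _)
  · intro x hx; rw [bump, if_neg (not_lt.2 (hmax' x hx))]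
  · intro x hx
    have hx' := hmax x hx
    refine ContDiffAt.congr_of_eventuallyEq ?_ (bump_eventuallyEq p hx')
    have h1 : ContDiffAt ℝ ∞ (fun y : ℝ => y * (1 - y)) x := by fun_prop
    exact (contDiffAt_const.mul (h1.rpow_const_of_ne hx'.ne')).exp
  · intro x hx k
    have hx' := hmax x hx
    simp only [max_eq_right hx'.le]
    exact h x hx' k

/-- The exponential factor beats d^(-k), where d = x(1-x), at the price of (k!)^(1/p). This follows
from y^k ≤ k! exp(y), with y a multiple of d^(-p), raised to the power 1/p. -/
lemma bump_gevrey {p : ℝ} (hp : 0 < p) : ∃ A : ℝ, 0 < A ∧ ∀ (k : ℕ) (x : ℝ),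
    |iteratedDeriv k (bump p) x| ≤ A ^ k * ((k ! : ℕ) : ℝ) ^ (1 + 1 / p) := by
  obtain ⟨A, hA, h⟩ := bump_derivative_bounds p
  refine ⟨A * (2 / p) ^ (1 / p), by positivity, fun k x => ?_⟩
  have hk : 0 < ((k ! : ℕ) : ℝ) := by positivity
  by_cases hx : 0 < x * (1 - x)
  swap
  · rw [(bump_contDiff hp).2 x (not_lt.1 hx), abs_zero]; positivity
  refine (h x hx k).trans ?_
  set d := x * (1 - x) with hd
  set y := d ^ (-p) with hy
  have hy0 : 0 < y := by positivity
  have h1 := Real.pow_div_factorial_le_exp (p / 2 * y) (by positivity) k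
  rw [div_le_iff₀ hk] at h1
  have h2 := Real.rpow_le_rpow (by positivity) h1 (show 0 ≤ 1 / p by positivity)
  have e1 : ((p / 2 * y) ^ k) ^ (1 / p) = ((p / 2) ^ (1 / p)) ^ k * (1 / d) ^ k := by
    rw [← Real.rpow_natCast (p / 2 * y), ← Real.rpow_mul (by positivity), mul_comm (k : ℝ),
      Real.rpow_mul (by positivity), Real.rpow_natCast, ← mul_pow, Real.mul_rpow (by positivity) hy0.le, hy, ← Real.rpow_mul hx.le,
      neg_mul, mul_one_div_cancel hp.ne', Real.rpow_neg_one, one_div]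
    rw [one_div]
  have e2 : (Real.exp (p / 2 * y) * (k ! : ℕ)) ^ (1 / p) =
      Real.exp (1 / 2 * y) * ((k ! : ℕ) : ℝ) ^ (1 / p) := by
    rw [Real.mul_rpow (Real.exp_pos _).le hk.le, ← Real.exp_mul]
    congr 2; field_simp
  rw [e1, e2] at h2
  have e3 : (2 / p) ^ (1 / p) * (p / 2) ^ (1 / p) = 1 := by
    rw [← Real.mul_rpow (by positivity) (by positivity)]
    have : 2 / p * (p / 2) = 1 := by field_simp
    rw [this, Real.one_rpow]
  have e4 : Real.exp (-(1 / 2) * y) * Real.exp (1 / 2 * y) = 1 := by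
    rw [← Real.exp_add]; simp
  have h3 := mul_le_mul_of_nonneg_left h2 (show 0 ≤ ((2 / p) ^ (1 / p)) ^ k * Real.exp (-(1 / 2) * y) by positivity)
  have e5 : ((2 / p) ^ (1 / p)) ^ k * Real.exp (-(1 / 2) * y) * (((p / 2) ^ (1 / p)) ^ k * (1 / d) ^ k) =
      (1 / d) ^ k * Real.exp (-(1 / 2) * y) := by
    calc _ = ((2 / p) ^ (1 / p) * (p / 2) ^ (1 / p)) ^ k * ((1 / d) ^ k * Real.exp (-(1 / 2) * y)) := by
          rw [mul_pow]; ring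
      _ = _ := by rw [e3, one_pow, one_mul]
  have e6 : ((2 / p) ^ (1 / p)) ^ k * Real.exp (-(1 / 2) * y) *
      (Real.exp (1 / 2 * y) * ((k ! : ℕ) : ℝ) ^ (1 / p)) =
      ((2 / p) ^ (1 / p)) ^ k * ((k ! : ℕ) : ℝ) ^ (1 / p) := by
    linear_combination ((2 / p) ^ (1 / p)) ^ k * ((k ! : ℕ) : ℝ) ^ (1 / p) * e4
  rw [e5, e6] at h3
  rw [Real.rpow_add hk, Real.rpow_one, mul_pow]
  calc (k ! : ℕ) * (A / d) ^ k * Real.exp (-(1 / 2) * y) =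
      (k ! : ℕ) * A ^ k * ((1 / d) ^ k * Real.exp (-(1 / 2) * y)) := by
        rw [div_pow, div_pow, one_pow]; ring
    _ ≤ (k ! : ℕ) * A ^ k * (((2 / p) ^ (1 / p)) ^ k * ((k ! : ℕ) : ℝ) ^ (1 / p)) := by gcongr
    _ = _ := by ring

/-- A smooth step from `0` to `1` in a Gevrey class. -/
lemma exists_step {p : ℝ} (hp : 0 < p) : ∃ (S : ℝ → ℝ) (A B : ℝ), 0 < A ∧ 0 < B ∧
    ContDiff ℝ ∞ S ∧ (∀ x, x ≤ 0 → S x = 0) ∧ (∀ x, 1 ≤ x → S x = 1) ∧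
    ∀ (k : ℕ) (x : ℝ), |iteratedDeriv k S x| ≤ B * A ^ k * ((k ! : ℕ) : ℝ) ^ (1 + 1 / p) := by
  obtain ⟨A, hA, hb⟩ := bump_gevrey hp
  have hcd := (bump_contDiff hp).1
  have hc : Continuous (bump p) := hcd.continuous
  have hint : ∀ a b, IntervalIntegrable (bump p) MeasureTheory.volume a b :=
    fun a b => hc.intervalIntegrable a b
  have hsupp : ∀ x, x ≤ 0 ∨ 1 ≤ x → bump p x = 0 := by
    intro x hx
    rw [bump, if_neg]
    rcases hx with h | h <;> nlinarith
  set I := ∫ t in (0 : ℝ)..1, bump p t with hI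
  have hI0 : 0 < I := by
    refine intervalIntegral.intervalIntegral_pos_of_pos_on (hint 0 1) ?_ one_pos
    intro x hx
    have : 0 < x * (1 - x) := by have := hx.1; have := hx.2; nlinarith
    rw [bump, if_pos this]; positivity
  set S : ℝ → ℝ := fun x => (∫ t in (0 : ℝ)..x, bump p t) / I with hS
  have hder : ∀ x, HasDerivAt S (bump p x / I) x := fun x =>
    (intervalIntegral.integral_hasDerivAt_right (hint 0 x)
      (hc.stronglyMeasurableAtFilter _ _) hc.continuousAt).div_const I
  have hdS : deriv S = fun x => bump p x / I := funext fun x => (hder x).deriv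
  have hS0 : ∀ x, x ≤ 0 → S x = 0 := by
    intro x hx
    have : ∫ t in (0 : ℝ)..x, bump p t = 0 := by
      rw [intervalIntegral.integral_zero_ae]
      refine Filter.Eventually.of_forall fun t ht => hsupp t (Or.inl ?_)
      rw [Set.uIoc_of_ge hx] at ht; exact ht.2
    simp [hS, this]
  have hS1 : ∀ x, 1 ≤ x → S x = 1 := by
    intro x hx
    have h1 : ∫ t in (1 : ℝ)..x, bump p t = 0 := by
      rw [intervalIntegral.integral_zero_ae]
      refine Filter.Eventually.of_forall fun t ht => hsupp t (Or.inr ?_)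
      rw [Set.uIoc_of_le hx] at ht; exact ht.1.le
    have h2 := intervalIntegral.integral_add_adjacent_intervals (hint 0 1) (hint 1 x)
    rw [h1, add_zero] at h2
    simp only [hS, ← h2]
    exact div_self hI0.ne'
  have hmono : ∀ x, |S x| ≤ 1 := by
    have hm : Monotone S := monotone_of_deriv_nonneg (fun x => (hder x).differentiableAt)
      (fun x => by rw [hdS]; exact div_nonneg (bump_nonneg _ _) hI0.le)
    intro x
    have h0 : 0 ≤ S x := by
      have := hm (min_le_left x 0); rwa [hS0 _ (min_le_right x 0)] at this
    have h1 : S x ≤ 1 := by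
      have := hm (le_max_left x 1); rwa [hS1 _ (le_max_right x 1)] at this
    rwa [abs_of_nonneg h0]
  -- The normalized primitive of the bump has one derivative more than the bump; the maximum with 1
  -- lets A^k be replaced by the next power.
  refine ⟨S, max A 1, max 1 (1 / I), by positivity, by positivity, ?_, hS0, hS1, ?_⟩
  · rw [contDiff_infty_iff_deriv, hdS]
    exact ⟨fun x => (hder x).differentiableAt, hcd.div_const I⟩
  · intro k x
    rcases k with _ | k
    · simp only [iteratedDeriv_zero, pow_zero, mul_one, Nat.factorial_zero, Nat.cast_one, Real.one_rpow]
      exact (hmono x).trans (le_max_left _ _)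
    · rw [iteratedDeriv_succ', hdS]
      have e : iteratedDeriv k (fun x => bump p x / I) x = 1 / I * iteratedDeriv k (bump p) x := by
        have : (fun x => bump p x / I) = fun x => 1 / I * bump p x := by ext; ring
        rw [this, iteratedDeriv_const_mul_field]
      rw [e, abs_mul, abs_of_pos (by positivity : 0 < 1 / I), mul_assoc]
      refine mul_le_mul (le_max_right _ _) ((hb k x).trans ?_) (abs_nonneg _) (by positivity)
      have h1 : A ^ k ≤ (max A 1) ^ (k + 1) :=
        (pow_le_pow_left₀ hA.le (le_max_left _ _) k).trans
          (pow_le_pow_right₀ (le_max_right _ _) k.le_succ)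
      have h2 : ((k ! : ℕ) : ℝ) ≤ (((k + 1)! : ℕ) : ℝ) := by
        exact_mod_cast Nat.factorial_le k.le_succ
      gcongr
end Cutoff


/-! ### Periodic cutoffs at a given scale -/

section Periodization

/-- The `2π`-periodic extension of a function supported near `0`. -/
noncomputable def periodize (ψ : ℝ → ℝ) (x : ℝ) : ℝ := ψ (x - round (x / (2 * Real.pi)) * (2 * Real.pi))

lemma abs_sub_round_le (x : ℝ) :
    |x - round (x / (2 * Real.pi)) * (2 * Real.pi)| ≤ Real.pi := by
  have h := abs_sub_round (x / (2 * Real.pi))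
  have e : x - round (x / (2 * Real.pi)) * (2 * Real.pi) =
      (x / (2 * Real.pi) - round (x / (2 * Real.pi))) * (2 * Real.pi) := by
    have := Real.pi_pos; field_simp
  rw [e, abs_mul, abs_of_pos Real.two_pi_pos]
  nlinarith [Real.pi_pos]

lemma periodize_periodic (ψ : ℝ → ℝ) : Function.Periodic (periodize ψ) (2 * Real.pi) := by
  intro x
  have e : (x + 2 * Real.pi) / (2 * Real.pi) = x / (2 * Real.pi) + 1 := by
    have := Real.pi_pos; field_simp
  unfold periodize
  rw [e, round_add_one]
  congr 1; push_cast; ring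

/-- The nearest multiple of 2π jumps only about π away from the support, where both sides vanish. -/
lemma periodize_eventuallyEq {ψ : ℝ → ℝ} (hψ : ∀ y, 1 ≤ |y| → ψ y = 0) (x : ℝ) :
    periodize ψ =ᶠ[𝓝 x] fun y => ψ (y + -(round (x / (2 * Real.pi)) * (2 * Real.pi))) := by
  have h1 : ∀ᶠ y in 𝓝 x, |y - x| < 1 := (isOpen_lt (by fun_prop) continuous_const).mem_nhds (by simp)
  filter_upwards [h1] with y hy
  unfold periodize
  rw [sub_eq_add_neg]
  set k := round (x / (2 * Real.pi)) with hk
  set l := round (y / (2 * Real.pi)) with hl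
  by_cases hkl : l = k
  · rw [hkl]
  have hpi := Real.pi_gt_three
  have hx := abs_sub_round_le x
  have hy' := abs_sub_round_le y
  rw [← hk] at hx
  rw [← hl] at hy'
  have hd : 2 * Real.pi ≤ |(l : ℝ) * (2 * Real.pi) - k * (2 * Real.pi)| := by
    rw [← sub_mul, abs_mul, abs_of_pos Real.two_pi_pos]
    have : (1 : ℝ) ≤ |(l : ℝ) - k| := by
      rw [← Int.cast_sub, ← Int.cast_abs]; exact_mod_cast Int.one_le_abs (sub_ne_zero.2 hkl)
    nlinarith
  have e1 : (l : ℝ) * (2 * Real.pi) - k * (2 * Real.pi) =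
      (y + -(k * (2 * Real.pi))) - (y - l * (2 * Real.pi)) := by ring
  have e2 : (l : ℝ) * (2 * Real.pi) - k * (2 * Real.pi) =
      (x - (k * (2 * Real.pi))) + (y - x) - (y + -(l * (2 * Real.pi))) := by ring
  have a1 := abs_sub (y + -(k * (2 * Real.pi))) (y - l * (2 * Real.pi))
  rw [← e1] at a1
  have a2 := abs_sub ((x - (k * (2 * Real.pi))) + (y - x)) (y + -(l * (2 * Real.pi)))
  rw [← e2] at a2
  have a3 := abs_add_le (x - (k * (2 * Real.pi))) (y - x)
  rw [hψ _ (by linarith), hψ _ (by linarith)]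

lemma iteratedDeriv_affine {S : ℝ → ℝ} (hS : ContDiff ℝ ∞ S) (u c : ℝ) (k : ℕ) (y : ℝ) :
    iteratedDeriv k (fun y => S (u + c * y)) y = c ^ k * iteratedDeriv k S (u + c * y) := by
  have h : ContDiff ℝ k (fun z => S (u + z)) :=
    (hS.comp (contDiff_const.add contDiff_id)).of_le (by exact_mod_cast le_top)
  have := congrFun (iteratedDeriv_comp_const_mul h c) y
  rw [this, iteratedDeriv_comp_const_add]

/-- Cutoffs localizing near the critical point, with Gevrey bounds. -/
lemma exists_cutoff {s σ p : ℝ} (hσ : 0 < σ) (hp : 0 < p) (hs : s - σ = 1 + 1 / p) :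
    ∃ C : ℝ, 0 ≤ C ∧ ∀ r : ℝ, 0 < r → r ≤ 1 → ∃ χ : ℝ → ℝ, ContDiff ℝ ∞ χ ∧
      Function.Periodic χ (2 * Real.pi) ∧ (∀ x, r / 2 < dep x → χ x = 0) ∧
      (∀ x, dep x ≤ r / 8 → χ x = 1) ∧
      ∀ t x, jetNorm s t (jet χ x) ≤ Real.exp (C * r ^ (-(1 / σ))) := by
  obtain ⟨S, A, B₀, hA, hB₀, hS, hS0, hS1, hb₀⟩ := exists_step hp
  obtain ⟨B, hB, hb⟩ : ∃ B : ℝ, 1 ≤ B ∧ ∀ (k : ℕ) (x : ℝ),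
      |iteratedDeriv k S x| ≤ B * A ^ k * ((k ! : ℕ) : ℝ) ^ (1 + 1 / p) := by
    refine ⟨max B₀ 1, le_max_right _ _, fun k x => (hb₀ k x).trans ?_⟩
    gcongr; exact le_max_left _ _
  have hs1 : 1 ≤ s := by
    have : 0 < 1 / p := by positivity
    linarith
  set C' := σ * (4 * A) ^ (1 / σ) with hC'
  have hC'0 : 0 ≤ C' := by positivity
  refine ⟨4 * B ^ 2 + 2 * C', by positivity, fun r hr hr1 => ?_⟩
  -- Equal to 1 for |y| ≤ r/2 and to 0 for |y| ≥ r. In terms of d, which lies between |y|/π and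
  -- |y|/2, these radii become r/8 and r/2.
  set ψ : ℝ → ℝ := fun y => S (2 + 2 / r * y) * S (2 + -(2 / r) * y) with hψ
  have hcd : ∀ c : ℝ, ContDiff ℝ ∞ (fun y => S (2 + c * y)) := fun c => by
    exact hS.comp (contDiff_const.add (contDiff_const.mul contDiff_id))
  have hψs : ContDiff ℝ ∞ ψ := (hcd _).mul (hcd _)
  have hψ0 : ∀ y, r ≤ |y| → ψ y = 0 := by
    intro y hy
    have e : 2 / r * r = 2 := by field_simp
    rcases le_abs.1 hy with h | h
    · have := mul_le_mul_of_nonneg_left h (show 0 ≤ 2 / r by positivity)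
      simp only [hψ]; rw [hS0 (2 + -(2 / r) * y) (by linarith), mul_zero]
    · have := mul_le_mul_of_nonneg_left h (show 0 ≤ 2 / r by positivity)
      simp only [hψ]; rw [hS0 (2 + 2 / r * y) (by linarith), zero_mul]
  have hψ1 : ∀ y, |y| ≤ r / 2 → ψ y = 1 := by
    intro y hy
    have e : 2 / r * (r / 2) = 1 := by field_simp
    have h1 := mul_le_mul_of_nonneg_left (abs_le.1 hy).1 (show 0 ≤ 2 / r by positivity)
    have h2 := mul_le_mul_of_nonneg_left (abs_le.1 hy).2 (show 0 ≤ 2 / r by positivity)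
    simp only [hψ]
    rw [hS1 _ (by linarith), hS1 _ (by linarith), one_mul]
  have hψz : ∀ y, 1 ≤ |y| → ψ y = 0 := fun y hy => hψ0 y (hr1.trans hy)
  have hev := periodize_eventuallyEq hψz
  have hτ : 1 ≤ r ^ (-(1 / σ)) := by
    rw [Real.rpow_neg hr.le]
    exact (one_le_inv₀ (by positivity)).2 (Real.rpow_le_one hr.le hr1 (by positivity))
  have hstep : ∀ (c : ℝ), |c| = 2 / r → ∀ t y, jetNorm s t (jet (fun y => S (2 + c * y)) y) ≤
      2 * B * Real.exp (C' * r ^ (-(1 / σ))) := by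
    intro c hc t y
    refine (jetNorm_jet_le_of_bound (B := B) (A := 2 / r * A) hσ (by positivity) t fun k => ?_).trans
      (le_of_eq ?_)
    · rw [iteratedDeriv_affine hS, abs_mul, abs_pow, hc, hs]
      refine (mul_le_mul_of_nonneg_left (hb k _) (by positivity)).trans (le_of_eq ?_)
      rw [mul_pow]; ring
    · have : (2 * (2 / r * A)) ^ (1 / σ) = (4 * A) ^ (1 / σ) * r ^ (-(1 / σ)) := by
        rw [Real.rpow_neg hr.le, ← div_eq_mul_inv, ← Real.div_rpow (by positivity) hr.le]
        congr 1; ring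
      rw [this, ← mul_assoc σ]; ring
  refine ⟨periodize ψ, ?_, periodize_periodic ψ, ?_, ?_, ?_⟩
  · rw [contDiff_iff_contDiffAt]
    intro x
    refine ContDiffAt.congr_of_eventuallyEq ?_ (hev x)
    exact (hψs.comp (contDiff_id.add contDiff_const)).contDiffAt
  · intro x hx
    refine hψ0 _ ?_
    have h1 := dep_le_half_abs (x - round (x / (2 * Real.pi)) * (2 * Real.pi))
    have h2 := dep_add_two_pi_int x (-round (x / (2 * Real.pi)))
    rw [Int.cast_neg, neg_mul, ← sub_eq_add_neg] at h2
    rw [h2] at h1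
    linarith
  · intro x hx
    refine hψ1 _ ?_
    have h1 := abs_div_pi_le_dep (abs_sub_round_le x)
    have h2 := dep_add_two_pi_int x (-round (x / (2 * Real.pi)))
    rw [Int.cast_neg, neg_mul, ← sub_eq_add_neg] at h2
    rw [h2, div_le_iff₀ Real.pi_pos] at h1
    have := mul_le_mul hx Real.pi_le_four Real.pi_pos.le (by positivity)
    linarith
  · intro t x
    rw [jet_congr (hev x), jet_comp_add, jet_mul (hcd _).contDiffAt (hcd _).contDiffAt]
    have hc2 : |2 / r| = 2 / r := abs_of_pos (by positivity)
    refine (jetNorm_mul_le hs1 (hstep _ hc2 t _) (hstep _ (by rw [abs_neg, hc2]) t _)).trans ?_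
    set τ := r ^ (-(1 / σ)) with hτd
    -- Constant prefactors are moved into the exponent, as r ≤ 1 makes τ at least 1.
    have h1 : 4 * B ^ 2 ≤ Real.exp (4 * B ^ 2 * τ) := by
      have h2 : 4 * B ^ 2 ≤ 4 * B ^ 2 * τ := le_mul_of_one_le_right (by positivity) hτ
      have := Real.add_one_le_exp (4 * B ^ 2 * τ)
      linarith
    calc 2 * B * Real.exp (C' * τ) * (2 * B * Real.exp (C' * τ)) =
        4 * B ^ 2 * Real.exp (2 * C' * τ) := by
          rw [show 2 * C' * τ = C' * τ + C' * τ by ring, Real.exp_add]; ring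
      _ ≤ Real.exp (4 * B ^ 2 * τ) * Real.exp (2 * C' * τ) := by gcongr
      _ = _ := by rw [← Real.exp_add]; ring_nf

end Periodization

/-! ### Lipschitz calculus for power series -/

section Near

variable {s : ℝ} {t : ℕ}

/-- Two power series of norm at most `M`, at distance at most `L * e`. -/
structure Near (s : ℝ) (t : ℕ) (M L e : ℝ) (a a' : PowerSeries ℝ) : Prop where
  left : jetNorm s t a ≤ M
  right : jetNorm s t a' ≤ M
  sub : jetNorm s t (a - a') ≤ L * e

lemma Near.mono {M L M' L' e : ℝ} {a a' : PowerSeries ℝ} (h : Near s t M L e a a') (he : 0 ≤ e)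
    (hM : M ≤ M') (hL : L ≤ L') : Near s t M' L' e a a' :=
  ⟨h.left.trans hM, h.right.trans hM, h.sub.trans (mul_le_mul_of_nonneg_right hL he)⟩

lemma Near.mul (hs : 1 ≤ s) {M L M' L' e : ℝ} {a a' b b' : PowerSeries ℝ} (h : Near s t M L e a a')
    (h' : Near s t M' L' e b b') : Near s t (M * M') (L * M' + M * L') e (a * b) (a' * b') := by
  refine ⟨jetNorm_mul_le hs h.left h'.left, jetNorm_mul_le hs h.right h'.right, ?_⟩
  have e1 : a * b - a' * b' = (a - a') * b + a' * (b - b') := by ring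
  rw [e1]
  refine (jetNorm_add _ _).trans ?_
  have h1 := jetNorm_mul_le hs h.sub h'.left
  have h2 := jetNorm_mul_le hs h.right h'.sub
  linarith

lemma Near.add {M L M' L' e : ℝ} {a a' b b' : PowerSeries ℝ} (h : Near s t M L e a a')
    (h' : Near s t M' L' e b b') : Near s t (M + M') (L + L') e (a + b) (a' + b') := by
  refine ⟨(jetNorm_add _ _).trans (add_le_add h.left h'.left),
    (jetNorm_add _ _).trans (add_le_add h.right h'.right), ?_⟩
  rw [add_sub_add_comm, add_mul]
  exact (jetNorm_add _ _).trans (add_le_add h.sub h'.sub)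

lemma Near.neg {M L e : ℝ} {a a' : PowerSeries ℝ} (h : Near s t M L e a a') :
    Near s t M L e (-a) (-a') := by
  refine ⟨by rw [jetNorm_neg]; exact h.left, by rw [jetNorm_neg]; exact h.right, ?_⟩
  rw [← neg_sub_neg, jetNorm_sub_comm] at *
  simpa using h.sub

lemma Near.sub_sub {M L M' L' e : ℝ} {a a' b b' : PowerSeries ℝ} (h : Near s t M L e a a')
    (h' : Near s t M' L' e b b') : Near s t (M + M') (L + L') e (a - b) (a' - b') := by
  rw [sub_eq_add_neg, sub_eq_add_neg]; exact h.add h'.neg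

lemma Near.one (e : ℝ) : Near s t 1 0 e 1 1 := by
  refine ⟨jetNorm_one.le, jetNorm_one.le, ?_⟩
  rw [sub_self, jetNorm_zero, zero_mul]

/-- `U` is the square root of `1 + P ^ 2` and `I` its inverse. -/
structure HalfPow (P U I : PowerSeries ℝ) : Prop where
  sq : U * U = 1 + P * P
  inv : U * I = 1
  pos : 0 < PowerSeries.constantCoeff U

lemma jetNorm_mul_self_le (hs : 1 ≤ s) {P : PowerSeries ℝ} (hP : jetNorm s t P ≤ 1 / 4) :
    jetNorm s t (P * P) ≤ 1 / 16 :=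
  (jetNorm_mul_le hs hP hP).trans (by norm_num)

lemma HalfPow.sub_one_le (hs : 1 ≤ s) {P U I : PowerSeries ℝ} (h : HalfPow P U I)
    (hP : jetNorm s t P ≤ 1 / 4) : jetNorm s t (U - 1) ≤ 1 / 16 := by
  have h1 := jetNorm_mul_self_le hs hP
  exact (jetNorm_sqrt_sub_one hs h.sq h.pos (h1.trans (by norm_num))).trans h1

lemma HalfPow.inv_le (hs : 1 ≤ s) {P U I : PowerSeries ℝ} (h : HalfPow P U I)
    (hP : jetNorm s t P ≤ 1 / 4) : jetNorm s t I ≤ 2 := by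
  obtain ⟨y, hy, hB⟩ := InvBd.of_near_one hs ((h.sub_one_le hs hP).trans (by norm_num : (1 : ℝ) / 16 ≤ 1 / 2))
  have : I = y := by
    rw [add_sub_cancel] at hy
    linear_combination y * h.inv - I * hy
  rwa [this]

/-- Since U'² - U² = P'² - P², the difference of the inverses is controlled once (U + U')/2 is
invertible, and this is near 1. -/
lemma HalfPow.near (hs : 1 ≤ s) {P U I P' U' I' : PowerSeries ℝ} {e : ℝ} (h : HalfPow P U I)
    (h' : HalfPow P' U' I') (hP : Near s t (1 / 4) 1 e P P') : Near s t 2 2 e I I' := by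
  refine ⟨h.inv_le hs hP.left, h'.inv_le hs hP.right, ?_⟩
  have h1 : InvBd s t (1 + ((U - 1) + (U' - 1)) * PowerSeries.C (1 / 2)) 2 := by
    refine InvBd.of_near_one hs ?_
    have h2 := h.sub_one_le hs hP.left
    have h3 := h'.sub_one_le hs hP.right
    have h4 := jetNorm_mul_le (t := t) hs ((jetNorm_add (s := s) (U - 1) (U' - 1)).trans
      (add_le_add h2 h3)) (jetNorm_C (s := s) (t := t) (1 / 2)).le
    refine h4.trans ?_
    norm_num [abs_of_pos]
  obtain ⟨y, hy, hy2⟩ := h1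
  have hhalf : (PowerSeries.C (1 / 2) : PowerSeries ℝ) * 2 = 1 := by
    have : (2 : PowerSeries ℝ) = PowerSeries.C 2 := (map_ofNat PowerSeries.C 2).symm
    rw [this, ← map_mul]; norm_num
  have e1 : I - I' = I * I' * (y * PowerSeries.C (1 / 2)) * ((P' * P') - P * P) := by
    have e2 : (U + U') * (y * PowerSeries.C (1 / 2)) = 1 := by
      linear_combination hy + y * hhalf
    have e3 : (P' * P') - P * P = (U' - U) * (U + U') := by
      linear_combination h.sq - h'.sq
    rw [e3]
    have e4 : I - I' = I * I' * (U' - U) := by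
      linear_combination I' * h.inv - I * h'.inv
    rw [e4]
    linear_combination -I * I' * (U' - U) * e2
  have h5 := (hP.mul hs hP).sub
  rw [jetNorm_sub_comm] at h5
  rw [e1]
  have h6 := jetNorm_mul_le hs (jetNorm_mul_le hs (h.inv_le hs hP.left) (h'.inv_le hs hP.right))
    (jetNorm_mul_le hs hy2 (jetNorm_C (s := s) (t := t) (1 / 2)).le)
  refine (jetNorm_mul_le hs h6 h5).trans (le_of_eq ?_)
  rw [abs_of_pos (by norm_num)]; ring

lemma near_inv_one_add_sq (hs : 1 ≤ s) {f g f' g' : PowerSeries ℝ} {e : ℝ}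
    (hg : (1 + f * f) * g = 1) (hg' : (1 + f' * f') * g' = 1)
    (hf : Near s t (1 / 2) 1 e f f') : Near s t 2 4 e g g' := by
  have hle : ∀ {f g : PowerSeries ℝ}, (1 + f * f) * g = 1 → jetNorm s t f ≤ 1 / 2 →
      jetNorm s t g ≤ 2 := by
    intro f g hg hf
    obtain ⟨y, hy, hB⟩ := InvBd.of_near_one hs ((jetNorm_mul_le hs hf hf).trans
      (by norm_num : (1 : ℝ) / 2 * (1 / 2) ≤ 1 / 2))
    have : g = y := by linear_combination y * hg - g * hy
    rwa [this]
  have h1 := hle hg hf.left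
  have h2 := hle hg' hf.right
  refine ⟨h1, h2, ?_⟩
  have e1 : g - g' = g * g' * (f' * f' - f * f) := by
    linear_combination g' * hg - g * hg'
  have h3 := (hf.mul hs hf).sub
  rw [jetNorm_sub_comm] at h3
  rw [e1]
  refine (jetNorm_mul_le hs (jetNorm_mul_le hs h1 h2) h3).trans (le_of_eq ?_)
  ring

end Near

/-! ### The rotation adapted to two slopes -/

section Rotation

/-- The cosine of the rotation adapted to the slopes `v`, `w`. -/
noncomputable def rotC (v w f : ℝ) : ℝ :=
  (2 * f * (1 + f * f)⁻¹ * (1 + w * v) - (1 - f * f) * (1 + f * f)⁻¹ * (w - v)) *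
    ((√(1 + v * v))⁻¹ * (√(1 + w * w))⁻¹)

/-- The sine of the rotation adapted to the slopes `v`, `w`. -/
noncomputable def rotS (v w f : ℝ) : ℝ :=
  (2 * f * (1 + f * f)⁻¹ * (w - v) + (1 - f * f) * (1 + f * f)⁻¹ * (1 + w * v)) *
    ((√(1 + v * v))⁻¹ * (√(1 + w * w))⁻¹)

/-- Generic form of `rotC` in a ring. -/
def rotCForm {R : Type*} [CommRing R] (v w f g I J : R) : R :=
  (2 * f * g * (1 + w * v) - (1 - f * f) * g * (w - v)) * (I * J)

/-- Generic form of `rotS` in a ring. -/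
def rotSForm {R : Type*} [CommRing R] (v w f g I J : R) : R :=
  (2 * f * g * (w - v) + (1 - f * f) * g * (1 + w * v)) * (I * J)

lemma rotForm_unit {R : Type*} [CommRing R] {v w f g U I V J : R} (hg : (1 + f * f) * g = 1)
    (hU : U * U = 1 + v * v) (hI : U * I = 1) (hV : V * V = 1 + w * w) (hJ : V * J = 1) :
    rotCForm v w f g I J * rotCForm v w f g I J + rotSForm v w f g I J * rotSForm v w f g I J = 1 := by
  have hI2 : (1 + v * v) * (I * I) = 1 := by rw [← hU]; linear_combination (U * I + 1) * hI
  have hJ2 : (1 + w * w) * (J * J) = 1 := by rw [← hV]; linear_combination (V * J + 1) * hJ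
  have e : rotCForm v w f g I J * rotCForm v w f g I J + rotSForm v w f g I J * rotSForm v w f g I J =
      ((1 + f * f) * g) * ((1 + f * f) * g) * ((1 + v * v) * (I * I)) * ((1 + w * w) * (J * J)) := by
    unfold rotCForm rotSForm; ring
  rw [e, hg, hI2, hJ2]; ring

/-- In complex notation the rotation is (2f + i(1 - f²))/(1 + f²) times the unit vector of (1 +
iw)(1 - iv). The pivot is the real part of this rotation times the conjugate of (1 + iw)(1 - iv), so
only 2f/(1 + f²) and the moduli remain. The rational parametrization of the circle avoids angles and
makes the formula valid for jets. -/
lemma kap_rotForm {R : Type*} [CommRing R] {v w f g U I V J : R}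
    (hU : U * U = 1 + v * v) (hI : U * I = 1) (hV : V * V = 1 + w * w) (hJ : V * J = 1) :
    kap (rotCForm v w f g I J) (rotSForm v w f g I J) w v = 2 * f * g * (U * V) := by
  have e : kap (rotCForm v w f g I J) (rotSForm v w f g I J) w v =
      2 * f * g * ((1 + v * v) * I * ((1 + w * w) * J)) := by
    unfold kap rotCForm rotSForm; ring
  have h1 : (1 + v * v) * I = U := by rw [← hU]; linear_combination U * hI
  have h2 : (1 + w * w) * J = V := by rw [← hV]; linear_combination V * hJ
  rw [e, h1, h2]

variable {s : ℝ} {t : ℕ}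

lemma near_rotForm (hs : 1 ≤ s) {v w f g U I V J v' w' f' g' U' I' V' J' : PowerSeries ℝ} {e : ℝ}
    (he : 0 ≤ e)
    (hg : (1 + f * f) * g = 1) (hg' : (1 + f' * f') * g' = 1) (hU : HalfPow v U I)
    (hU' : HalfPow v' U' I') (hV : HalfPow w V J) (hV' : HalfPow w' V' J')
    (hv : Near s t (1 / 4) 1 e v v') (hw : Near s t (1 / 4) 1 e w w')
    (hf : Near s t (1 / 2) 1 e f f') :
    Near s t 40 300 e (rotCForm v w f g I J) (rotCForm v' w' f' g' I' J') ∧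
    Near s t 40 300 e (rotSForm v w f g I J) (rotSForm v' w' f' g' I' J') := by
  have nI := (hU.near hs hU' hv).mul hs (hV.near hs hV' hw)
  have ng := near_inv_one_add_sq hs hg hg' hf
  have n1 : Near s t 2 1 e (1 + w * v) (1 + w' * v') :=
    ((Near.one e).add (hw.mul hs hv)).mono he (by norm_num) (by norm_num)
  have n2 : Near s t 1 2 e (w - v) (w' - v') :=
    (hw.sub_sub hv).mono he (by norm_num) (by norm_num)
  have n3 : Near s t 2 8 e (2 * f * g) (2 * f' * g') := by
    rw [two_mul, two_mul]
    exact ((hf.add hf).mul hs ng).mono he (by norm_num) (by norm_num)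
  have n4 : Near s t 4 10 e ((1 - f * f) * g) ((1 - f' * f') * g') :=
    (((Near.one e).sub_sub (hf.mul hs hf)).mul hs ng).mono he (by norm_num) (by norm_num)
  refine ⟨?_, ?_⟩
  · exact (((n3.mul hs n1).sub_sub (n4.mul hs n2)).mul hs nI).mono he (by norm_num) (by norm_num)
  · exact (((n3.mul hs n2).add (n4.mul hs n1)).mul hs nI).mono he (by norm_num) (by norm_num)

/-- The jets of the adapted rotation. -/
lemma jet_rot {v w f : ℝ → ℝ} {x : ℝ} (hv : ContDiffAt ℝ ∞ v x) (hw : ContDiffAt ℝ ∞ w x)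
    (hf : ContDiffAt ℝ ∞ f x) : ∃ g U I V J : PowerSeries ℝ,
    (1 + jet f x * jet f x) * g = 1 ∧ HalfPow (jet v x) U I ∧ HalfPow (jet w x) V J ∧
    jet (fun y => rotC (v y) (w y) (f y)) x = rotCForm (jet v x) (jet w x) (jet f x) g I J ∧
    jet (fun y => rotS (v y) (w y) (f y)) x = rotSForm (jet v x) (jet w x) (jet f x) g I J := by
  have h1 : ContDiffAt ℝ ∞ (fun _ : ℝ => (1 : ℝ)) x := contDiffAt_const
  have h2 : ContDiffAt ℝ ∞ (fun _ : ℝ => (2 : ℝ)) x := contDiffAt_const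
  have one_pos' : ∀ z : ℝ, 0 < 1 + z * z := fun z => by nlinarith [mul_self_nonneg z]
  have hff := hf.mul hf
  have hden : ContDiffAt ℝ ∞ (fun y => 1 + f y * f y) x := h1.add hff
  have hg : ContDiffAt ℝ ∞ (fun y => (1 + f y * f y)⁻¹) x := hden.inv (one_pos' _).ne'
  have jone : jet (fun _ : ℝ => (1 : ℝ)) x = 1 := by rw [jet_const, map_one]
  have jtwo : jet (fun _ : ℝ => (2 : ℝ)) x = 2 := by
    rw [jet_const]; exact map_ofNat PowerSeries.C 2
  have jinv : ∀ {h k : ℝ → ℝ}, ContDiffAt ℝ ∞ h x → ContDiffAt ℝ ∞ k x → (∀ y, h y * k y = 1) →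
      jet h x * jet k x = 1 := by
    intro h k hh hk e
    rw [← jet_mul hh hk, ← jone]; congr 1; ext y; exact e y
  have half : ∀ {u : ℝ → ℝ}, ContDiffAt ℝ ∞ u x →
      ContDiffAt ℝ ∞ (fun y => (√(1 + u y * u y))⁻¹) x ∧
      HalfPow (jet u x) (jet (fun y => √(1 + u y * u y)) x) (jet (fun y => (√(1 + u y * u y))⁻¹) x) := by
    intro u hu
    have hs : ContDiffAt ℝ ∞ (fun y => √(1 + u y * u y)) x :=
      (h1.add (hu.mul hu)).sqrt (one_pos' _).ne'
    have hi : ContDiffAt ℝ ∞ (fun y => (√(1 + u y * u y))⁻¹) x :=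
      hs.inv (Real.sqrt_pos.2 (one_pos' _)).ne'
    refine ⟨hi, ?_, ?_, ?_⟩
    · rw [← jet_mul hs hs, ← jet_mul hu hu, ← jone, ← jet_add h1 (hu.mul hu)]
      congr 1; ext y; exact Real.mul_self_sqrt (one_pos' _).le
    · exact jinv hs hi fun y => mul_inv_cancel₀ (Real.sqrt_pos.2 (one_pos' _)).ne'
    · rw [constantCoeff_jet]; exact Real.sqrt_pos.2 (one_pos' _)
  obtain ⟨hI, hI'⟩ := half hv
  obtain ⟨hJ, hJ'⟩ := half hw
  refine ⟨jet (fun y => (1 + f y * f y)⁻¹) x, _, _, _, _, ?_, hI', hJ', ?_, ?_⟩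
  · rw [← jone, ← jet_mul hf hf, ← jet_add h1 hff]
    rw [jone]
    exact jinv hden hg fun y => mul_inv_cancel₀ (one_pos' _).ne'
  · have a1 := (h2.mul hf).mul hg
    have a2 := h1.add (hw.mul hv)
    have a3 := (h1.sub hff).mul hg
    have a4 := hw.sub hv
    have a5 := hI.mul hJ
    unfold rotCForm
    rw [← jone, ← jtwo, ← jet_mul hf hf, ← jet_mul h2 hf, ← jet_mul (h2.mul hf) hg,
      ← jet_mul hw hv, ← jet_add h1 (hw.mul hv), ← jet_mul a1 a2, ← jet_sub h1 hff,
      ← jet_mul (h1.sub hff) hg, ← jet_sub hw hv, ← jet_mul a3 a4, ← jet_sub (a1.mul a2) (a3.mul a4),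
      ← jet_mul hI hJ, ← jet_mul ((a1.mul a2).sub (a3.mul a4)) a5]
    rfl
  · have a1 := (h2.mul hf).mul hg
    have a2 := h1.add (hw.mul hv)
    have a3 := (h1.sub hff).mul hg
    have a4 := hw.sub hv
    have a5 := hI.mul hJ
    unfold rotSForm
    rw [← jone, ← jtwo, ← jet_mul hf hf, ← jet_mul h2 hf, ← jet_mul (h2.mul hf) hg,
      ← jet_mul hw hv, ← jet_add h1 (hw.mul hv), ← jet_sub h1 hff,
      ← jet_mul (h1.sub hff) hg, ← jet_mul a3 a2, ← jet_sub hw hv, ← jet_mul a1 a4, ← jet_add (a1.mul a4) (a3.mul a2),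
      ← jet_mul hI hJ, ← jet_mul ((a1.mul a4).add (a3.mul a2)) a5]
    rfl

lemma rot_contDiffAt {v w f : ℝ → ℝ} {x : ℝ} (hv : ContDiffAt ℝ ∞ v x) (hw : ContDiffAt ℝ ∞ w x)
    (hf : ContDiffAt ℝ ∞ f x) : ContDiffAt ℝ ∞ (fun y => rotC (v y) (w y) (f y)) x ∧
      ContDiffAt ℝ ∞ (fun y => rotS (v y) (w y) (f y)) x := by
  have one_pos' : ∀ z : ℝ, 0 < 1 + z * z := fun z => by nlinarith [mul_self_nonneg z]
  have hg : ContDiffAt ℝ ∞ (fun y => (1 + f y * f y)⁻¹) x :=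
    (contDiffAt_const.add (hf.mul hf)).inv (one_pos' _).ne'
  have half : ∀ {u : ℝ → ℝ}, ContDiffAt ℝ ∞ u x →
      ContDiffAt ℝ ∞ (fun y => (√(1 + u y * u y))⁻¹) x := fun {u} hu =>
    ((contDiffAt_const.add (hu.mul hu)).sqrt (one_pos' _).ne').inv (Real.sqrt_pos.2 (one_pos' _)).ne'
  have a1 := (contDiffAt_const (c := (2 : ℝ)).mul hf).mul hg
  have a2 := (contDiffAt_const (c := (1 : ℝ))).add (hw.mul hv)
  have a3 := ((contDiffAt_const (c := (1 : ℝ))).sub (hf.mul hf)).mul hg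
  have a5 := (half hv).mul (half hw)
  exact ⟨((a1.mul a2).sub (a3.mul (hw.sub hv))).mul a5, ((a1.mul (hw.sub hv)).add (a3.mul a2)).mul a5⟩

lemma real_half (v : ℝ) : √(1 + v * v) * √(1 + v * v) = 1 + v * v ∧
    √(1 + v * v) * (√(1 + v * v))⁻¹ = 1 := by
  have : 0 < 1 + v * v := by nlinarith [mul_self_nonneg v]
  exact ⟨Real.mul_self_sqrt this.le, mul_inv_cancel₀ (Real.sqrt_pos.2 this).ne'⟩

lemma rot_unit (v w f : ℝ) : rotC v w f * rotC v w f + rotS v w f * rotS v w f = 1 := by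
  have : 0 < 1 + f * f := by nlinarith [mul_self_nonneg f]
  exact rotForm_unit (mul_inv_cancel₀ this.ne') (real_half v).1 (real_half v).2 (real_half w).1
    (real_half w).2

lemma kap_rot_zero (v w : ℝ) : kap (rotC v w 0) (rotS v w 0) w v = 0 := by
  have := kap_rotForm (v := v) (w := w) (f := 0) (g := (1 + (0 : ℝ) * 0)⁻¹) (real_half v).1
    (real_half v).2 (real_half w).1 (real_half w).2
  exact this.trans (by ring)

/-- Jet estimates for the adapted rotation. -/
lemma jet_rot_bounds (hs : 1 ≤ s) {v w f : ℝ → ℝ} {x : ℝ} (hv : ContDiffAt ℝ ∞ v x)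
    (hw : ContDiffAt ℝ ∞ w x) (hf : ContDiffAt ℝ ∞ f x) (nv : jetNorm s t (jet v x) ≤ 1 / 4)
    (nw : jetNorm s t (jet w x) ≤ 1 / 4) (nf : jetNorm s t (jet f x) ≤ 1 / 2) :
    jetNorm s t (jet (fun y => rotC (v y) (w y) (f y)) x) ≤ 40 ∧
    jetNorm s t (jet (fun y => rotS (v y) (w y) (f y)) x) ≤ 40 ∧
    ∀ E, InvBd s t (jet f x) E →
      InvBd s t (kap (jet (fun y => rotC (v y) (w y) (f y)) x)
        (jet (fun y => rotS (v y) (w y) (f y)) x) (jet w x) (jet v x)) (4 * E) := by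
  obtain ⟨g, U, I, V, J, hg, hU, hV, e1, e2⟩ := jet_rot hv hw hf
  have self : ∀ {M : ℝ} {a : PowerSeries ℝ}, jetNorm s t a ≤ M → Near s t M 1 0 a a := fun h =>
    ⟨h, h, by rw [sub_self, jetNorm_zero, mul_zero]⟩
  have h := near_rotForm hs le_rfl hg hg hU hU hV hV (self nv) (self nw) (self nf)
  rw [e1, e2]
  refine ⟨h.1.left, h.2.left, fun E hE => ?_⟩
  rw [kap_rotForm hU.sq hU.inv hV.sq hV.inv]
  have i2 : InvBd s t (2 : PowerSeries ℝ) (1 / 2) := by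
    refine ⟨PowerSeries.C (1 / 2), ?_, by rw [jetNorm_C, abs_of_pos (by norm_num)]⟩
    rw [show (2 : PowerSeries ℝ) = PowerSeries.C 2 from (map_ofNat PowerSeries.C 2).symm, ← map_mul]
    norm_num
  have ig : InvBd s t g 2 := by
    refine ⟨1 + jet f x * jet f x, by rw [mul_comm]; exact hg, ?_⟩
    have := jetNorm_add (s := s) (t := t) 1 (jet f x * jet f x)
    have := jetNorm_mul_le hs nf nf
    rw [jetNorm_one] at *
    linarith
  have iU : InvBd s t U 2 := ⟨I, hU.inv, hU.inv_le hs nv⟩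
  have iV : InvBd s t V 2 := ⟨J, hV.inv, hV.inv_le hs nw⟩
  -- The factor 4 is 1/2 · 2 · 2 · 2, for the inverses of 2, g, U and V. It is cancelled by the
  -- quarter in the bound for the inverse of f.
  exact (((i2.mul hs hE).mul hs ig).mul hs (iU.mul hs iV)).mono (by linarith)

lemma jet_rot_unit {v w f : ℝ → ℝ} {x : ℝ} (hv : ContDiffAt ℝ ∞ v x)
    (hw : ContDiffAt ℝ ∞ w x) (hf : ContDiffAt ℝ ∞ f x) :
    jet (fun y => rotC (v y) (w y) (f y)) x * jet (fun y => rotC (v y) (w y) (f y)) x +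
      jet (fun y => rotS (v y) (w y) (f y)) x * jet (fun y => rotS (v y) (w y) (f y)) x = 1 := by
  obtain ⟨g, U, I, V, J, hg, hU, hV, e1, e2⟩ := jet_rot hv hw hf
  rw [e1, e2]
  exact rotForm_unit hg hU.sq hU.inv hV.sq hV.inv

/-- The adapted rotation is Lipschitz in its parameters. -/
lemma jet_rot_sub_le (hs : 1 ≤ s) {v w f v' w' f' : ℝ → ℝ} {x e : ℝ} (hv : ContDiffAt ℝ ∞ v x)
    (hw : ContDiffAt ℝ ∞ w x) (hf : ContDiffAt ℝ ∞ f x) (hv' : ContDiffAt ℝ ∞ v' x)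
    (hw' : ContDiffAt ℝ ∞ w' x) (hf' : ContDiffAt ℝ ∞ f' x) (nv : jetNorm s t (jet v x) ≤ 1 / 4)
    (nw : jetNorm s t (jet w x) ≤ 1 / 4) (nf : jetNorm s t (jet f x) ≤ 1 / 2)
    (nv' : jetNorm s t (jet v' x) ≤ 1 / 4)
    (nw' : jetNorm s t (jet w' x) ≤ 1 / 4) (nf' : jetNorm s t (jet f' x) ≤ 1 / 2)
    (dv : jetNorm s t (jet v x - jet v' x) ≤ e) (dw : jetNorm s t (jet w x - jet w' x) ≤ e)
    (df : jetNorm s t (jet f x - jet f' x) ≤ e) :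
    jetNorm s t (jet (fun y => rotC (v y) (w y) (f y)) x -
      jet (fun y => rotC (v' y) (w' y) (f' y)) x) ≤ 300 * e ∧
    jetNorm s t (jet (fun y => rotS (v y) (w y) (f y)) x -
      jet (fun y => rotS (v' y) (w' y) (f' y)) x) ≤ 300 * e := by
  obtain ⟨g, U, I, V, J, hg, hU, hV, e1, e2⟩ := jet_rot hv hw hf
  obtain ⟨g', U', I', V', J', hg', hU', hV', e1', e2'⟩ := jet_rot hv' hw' hf'
  have he : 0 ≤ e := (jetNorm_nonneg _).trans dv
  have mk : ∀ {M : ℝ} {a a' : PowerSeries ℝ}, jetNorm s t a ≤ M → jetNorm s t a' ≤ M →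
      jetNorm s t (a - a') ≤ e → Near s t M 1 e a a' := fun h h' h'' =>
    ⟨h, h', by rwa [one_mul]⟩
  have h := near_rotForm hs he hg hg' hU hU' hV hV' (mk nv nv' dv) (mk nw nw' dw) (mk nf nf' df)
  rw [e1, e2, e1', e2']
  exact ⟨h.1.sub, h.2.sub⟩

end Rotation

/-! ### Orbit products and their Taylor series -/

section OrbitSegments

/-- The entrywise Taylor series of a matrix function. -/
noncomputable def jetMat (A : ℝ → Matrix (Fin 2) (Fin 2) ℝ) (x : ℝ) :
    Matrix (Fin 2) (Fin 2) (PowerSeries ℝ) := Matrix.of fun i j => jet (fun y => A y i j) x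

lemma jetMat_mul {A B : ℝ → Matrix (Fin 2) (Fin 2) ℝ} {x : ℝ}
    (hA : ∀ i j, ContDiffAt ℝ ∞ (fun y => A y i j) x)
    (hB : ∀ i j, ContDiffAt ℝ ∞ (fun y => B y i j) x) :
    (∀ i j, ContDiffAt ℝ ∞ (fun y => (A y * B y) i j) x) ∧
      jetMat (fun y => A y * B y) x = jetMat A x * jetMat B x := by
  have e : ∀ i j, (fun y => (A y * B y) i j) = fun y => A y i 0 * B y 0 j + A y i 1 * B y 1 j := by
    intro i j; ext y; rw [Matrix.mul_apply, Fin.sum_univ_two]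
  refine ⟨fun i j => ?_, ?_⟩
  · rw [e]; exact ((hA _ _).mul (hB _ _)).add ((hA _ _).mul (hB _ _))
  · ext1 i j
    rw [Matrix.mul_apply, Fin.sum_univ_two]
    simp only [jetMat, Matrix.of_apply]
    rw [e, jet_add ((hA _ _).mul (hB _ _)) ((hA _ _).mul (hB _ _)), jet_mul (hA _ _) (hB _ _),
      jet_mul (hA _ _) (hB _ _)]

/-- The product along a segment of the orbit of `x` under the rotation by `γ`. -/
noncomputable def orbitSeg (l γ : ℝ) (co si : ℝ → ℝ) (a : ℤ) (n : ℕ) (x : ℝ) :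
    Matrix (Fin 2) (Fin 2) ℝ :=
  seg l l⁻¹ (fun m => co (x + m * γ)) (fun m => si (x + m * γ)) a n

lemma jetMat_orbitSeg {l γ : ℝ} {co si : ℝ → ℝ} (hc : ContDiff ℝ ∞ co) (hs : ContDiff ℝ ∞ si)
    (a : ℤ) (n : ℕ) (x : ℝ) :
    (∀ i j, ContDiffAt ℝ ∞ (fun y => orbitSeg l γ co si a n y i j) x) ∧
      jetMat (orbitSeg l γ co si a n) x =
        seg (PowerSeries.C l) (PowerSeries.C l⁻¹) (fun m => jet co (x + m * γ))
          (fun m => jet si (x + m * γ)) a n := by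
  have hdiag : (∀ i j, ContDiffAt ℝ ∞ (fun _ : ℝ => (!![l, 0; 0, l⁻¹] : Matrix (Fin 2) (Fin 2) ℝ) i j) x) ∧
      jetMat (fun _ => !![l, 0; 0, l⁻¹]) x = !![PowerSeries.C l, 0; 0, PowerSeries.C l⁻¹] := by
    refine ⟨fun i j => contDiffAt_const, ?_⟩
    ext1 i j
    fin_cases i <;> fin_cases j <;> simp [jetMat, jet_const]
  induction n with
  | zero => exact hdiag
  | succ n ih =>
    have hcc : ContDiffAt ℝ ∞ (fun y => co (y + (a + n : ℤ) * γ)) x :=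
      (hc.comp (contDiff_id.add contDiff_const)).contDiffAt
    have hss : ContDiffAt ℝ ∞ (fun y => si (y + (a + n : ℤ) * γ)) x :=
      (hs.comp (contDiff_id.add contDiff_const)).contDiffAt
    have hrot : (∀ i j, ContDiffAt ℝ ∞ (fun y =>
          rot (co (y + (a + n : ℤ) * γ)) (si (y + (a + n : ℤ) * γ)) i j) x) ∧
        jetMat (fun y => rot (co (y + (a + n : ℤ) * γ)) (si (y + (a + n : ℤ) * γ))) x =
          rot (jet co (x + (a + n : ℤ) * γ)) (jet si (x + (a + n : ℤ) * γ)) := by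
      constructor
      · intro i j
        fin_cases i <;> fin_cases j <;> simp only [rot]
        exacts [hcc, hss.neg, hss, hcc]
      · rw [← jet_comp_add, ← jet_comp_add]
        ext1 i j
        fin_cases i <;> fin_cases j
        · rfl
        · exact jet_neg
        · rfl
        · rfl
    have h1 := jetMat_mul hdiag.1 hrot.1
    have h2 := jetMat_mul h1.1 ih.1
    refine ⟨h2.1, ?_⟩
    rw [h1.2, hdiag.2, hrot.2, ih.2] at h2
    exact h2.2

/-- Slope of the image of the first basis vector, for a real matrix. -/
noncomputable def realSlope (M : Matrix (Fin 2) (Fin 2) ℝ) : ℝ := M 1 0 * (M 0 0)⁻¹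

/-- Slope of the image of the first basis vector under the transpose, for a real matrix. -/
noncomputable def realCoslope (M : Matrix (Fin 2) (Fin 2) ℝ) : ℝ := M 0 1 * (M 0 0)⁻¹

lemma jet_realSlope {A : ℝ → Matrix (Fin 2) (Fin 2) ℝ} {x : ℝ}
    (hA : ∀ i j, ContDiffAt ℝ ∞ (fun y => A y i j) x) (h0 : A x 0 0 ≠ 0) :
    (ContDiffAt ℝ ∞ (fun y => realSlope (A y)) x ∧
      jet (fun y => realSlope (A y)) x = slope (jetMat A x)) ∧
    (ContDiffAt ℝ ∞ (fun y => realCoslope (A y)) x ∧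
      jet (fun y => realCoslope (A y)) x = coslope (jetMat A x)) := by
  have hi : ContDiffAt ℝ ∞ (fun y => (A y 0 0)⁻¹) x := (hA 0 0).inv h0
  refine ⟨⟨(hA 1 0).mul hi, ?_⟩, (hA 0 1).mul hi, ?_⟩
  · unfold realSlope; rw [jet_mul (hA 1 0) hi, jet_inv (hA 0 0) h0]; rfl
  · unfold realCoslope; rw [jet_mul (hA 0 1) hi, jet_inv (hA 0 0) h0]; rfl

lemma seg_shift {R : Type*} [CommRing R] (l l' : R) {c σ c' σ' : ℤ → R} (m : ℤ)
    (hc : ∀ k, c' k = c (k + m)) (hσ : ∀ k, σ' k = σ (k + m)) (a : ℤ) (n : ℕ) :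
    seg l l' c' σ' a n = seg l l' c σ (a + m) n := by
  induction n with
  | zero => rfl
  | succ n ih =>
    rw [seg, seg, ih, hc, hσ]
    have : a + (n : ℤ) + m = a + m + n := by ring
    rw [this]

end OrbitSegments

/-! ### Gluing along a cutoff -/

section Glue

/-- Gluing a function `us`, defined near the support of the cutoff `χ`, into `u`. -/
lemma glue {u us χ : ℝ → ℝ} {r : ℝ} (hr : 0 < r) (hu : ContDiff ℝ ∞ u) (hχ : ContDiff ℝ ∞ χ)
    (hoff : ∀ x, r / 2 < dep x → χ x = 0) (hon : ∀ x, dep x ≤ r / 8 → χ x = 1)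
    (hus : ∀ x, dep x ≤ r → ContDiffAt ℝ ∞ us x) :
    ContDiff ℝ ∞ (fun x => u x + χ x * (us x - u x)) ∧
    (∀ x, r / 2 < dep x → (fun x => u x + χ x * (us x - u x)) =ᶠ[𝓝 x] u) ∧
    (∀ x, dep x < r / 8 → (fun x => u x + χ x * (us x - u x)) =ᶠ[𝓝 x] us) ∧
    (∀ x, dep x ≤ r → jet (fun x => u x + χ x * (us x - u x)) x =
      jet u x + jet χ x * (jet us x - jet u x)) := by
  have h1 : ∀ x, r / 2 < dep x → (fun x => u x + χ x * (us x - u x)) =ᶠ[𝓝 x] u := by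
    intro x hx
    filter_upwards [(isOpen_lt continuous_const continuous_dep).mem_nhds hx] with y hy
    rw [hoff y hy]; ring
  refine ⟨?_, h1, ?_, ?_⟩
  · rw [contDiff_iff_contDiffAt]
    intro x
    rcases lt_or_ge (r / 2) (dep x) with h | h
    · exact hu.contDiffAt.congr_of_eventuallyEq (h1 x h)
    · exact hu.contDiffAt.add (hχ.contDiffAt.mul ((hus x (by linarith)).sub hu.contDiffAt))
  · intro x hx
    filter_upwards [(isOpen_lt continuous_dep continuous_const).mem_nhds hx] with y hy
    rw [hon y (le_of_lt hy)]; ring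
  · intro x hx
    have h2 := (hus x hx).sub hu.contDiffAt
    rw [jet_add hu.contDiffAt (hχ.contDiffAt.mul h2), jet_mul hχ.contDiffAt h2,
      jet_sub (hus x hx) hu.contDiffAt]

end Glue

/-! ### The multiscale frame -/

/-- The data and the numerical estimates of the multiscale construction. -/
structure Frame where
  K : SegConst
  s : ℝ
  γ : ℝ
  b : ℝ
  c : ℝ
  L₁ : ℝ
  C₃ : ℝ
  e₀ : ℝ
  f : ℝ → ℝ
  r : ℕ → ℝ
  χ : ℕ → ℝ → ℝ
  N : ℕ → ℕ
  η : ℕ → ℝ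
  one_le_s : 1 ≤ s
  b_pos : 0 < b
  c_pos : 0 < c
  sep : ∀ m : ℤ, m ≠ 0 → c ≤ |(m : ℝ)| * dep (m * γ)
  f_smooth : ContDiff ℝ ∞ f
  f_periodic : Function.Periodic f (2 * Real.pi)
  f_le : ∀ x t, jetNorm s t (jet f x) ≤ 1 / 4
  f_inv : ∀ x t, 0 < dep x → InvBd s t (jet f x) (Real.exp (L₁ * dep x ^ (-b)) / 4)
  B_eq : K.B = 40
  r_pos : ∀ n, 0 < r n
  r_succ : ∀ n, r (n + 1) = r n / 16
  τ₀_eq : K.τ₀ = r 1 ^ (-b)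
  -- At distance at least c/(4(i+1)) the depth is of order i^b; as b < β it is dominated by i^β for
  -- large i, and by τ₀ for the remaining ones.
  good_crit : ∀ i : ℕ, (4 * ((i : ℝ) + 1) / c) ^ b ≤ K.τ₀ ∨ (4 * ((i : ℝ) + 1) / c) ^ b ≤ (i : ℝ) ^ K.β
  χ_smooth : ∀ n, ContDiff ℝ ∞ (χ n)
  χ_periodic : ∀ n, Function.Periodic (χ n) (2 * Real.pi)
  χ_off : ∀ n x, r n / 2 < dep x → χ n x = 0
  χ_on : ∀ n x, dep x ≤ r n / 8 → χ n x = 1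
  χ_le : ∀ n t x, jetNorm s t (jet (χ n) x) ≤ Real.exp (C₃ * r n ^ (-b))
  C₃_nonneg : 0 ≤ C₃
  -- Around a close visit, the N_n steps on either side form good segments outside the ball: the
  -- visit at time m is controlled by its distances to both ends, not only to the visit at x.
  ref : ∀ n x, dep x ≤ r n → ∀ (m : ℤ) (i j : ℕ), i + 1 + j = N n → |m| = j + 1 →
    c / (4 * (i + 1)) ≤ dep (x + m * γ) ∧ c / (4 * (j + 1)) ≤ dep (x + m * γ) ∧ r n ≤ dep (x + m * γ)
  -- Reference products of length N_n still resolve visits two scales deeper. This is what allows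
  -- the interpolation between the references of two consecutive scales.
  deep : ∀ n, r (n + 2) ^ (-b) ≤ (N n : ℝ) ^ K.β
  hL : ∀ τ : ℝ, 1 ≤ τ → 2 * Real.exp (L₁ * τ) ≤ Real.exp (K.L * τ)
  hdeep : ∀ (k : ℕ) (τ : ℝ), 1 ≤ τ → τ ≤ (k : ℝ) ^ K.β →
    48 * K.B * (Real.exp (L₁ * τ) * Real.exp (C₃ * τ)) ≤ K.lam ^ k
  inv_lam_le : K.lam⁻¹ ≤ e₀
  e₀_le : e₀ ≤ 1 / 4
  hshallow : ∀ τ : ℝ, 1 ≤ τ → τ ≤ K.τ₀ → 16 * K.B * e₀ * Real.exp (L₁ * τ) ≤ 1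
  η_zero : Real.exp (C₃ * r 0 ^ (-b)) * K.lam⁻¹ ≤ η 0
  η_succ : ∀ n, Real.exp (C₃ * r (n + 1) ^ (-b)) * (2 * K.lam⁻¹ ^ min (N n) (N (n + 1))) ≤ η (n + 1)
  η_sum : ∀ n, ∑ i ∈ Finset.range n, η i ≤ e₀
  C₂ : ℝ
  Φ_le : ∀ n, K.Φ n ≤ C₂ * n
  N_le : ∀ n, N n * (4 * r n) ≤ c
  κ₀ : ℝ
  -- A window of length N_n meets a ball of radius comparable to r_n with probability bounded below,
  -- uniformly in n. The drop of the Lyapunov exponent comes from here.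
  le_N : ∀ n, κ₀ ≤ N n * r n
  κ₀_pos : 0 < κ₀
  ζ : ℕ → ℝ
  ζ_le : ∀ n, ζ n ≤ 1 / 4
  ζ_tendsto : Filter.Tendsto ζ Filter.atTop (𝓝 0)
  -- The size of the part of f removed in the perturbed cocycles.
  f_mul_χ_le : ∀ n x t, jetNorm s t (jet f x * jet (χ n) x) ≤ ζ n

namespace Frame

variable (F : Frame)

/-- Smooth slope functions with small jets. -/
structure Adm (v w : ℝ → ℝ) : Prop where
  sv : ContDiff ℝ ∞ v
  sw : ContDiff ℝ ∞ w
  nv : ∀ x t, jetNorm F.s t (jet v x) ≤ F.e₀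
  nw : ∀ x t, jetNorm F.s t (jet w x) ≤ F.e₀

/-- The cosine of the rotation with slopes `v`, `w`. -/
noncomputable def co (v w : ℝ → ℝ) (y : ℝ) : ℝ := rotC (v y) (w y) (F.f y)

/-- The sine of the rotation with slopes `v`, `w`. -/
noncomputable def si (v w : ℝ → ℝ) (y : ℝ) : ℝ := rotS (v y) (w y) (F.f y)

/-- The depth of the visit at `x`. -/
noncomputable def tau (x : ℝ) : ℝ := dep x ^ (-F.b)

variable {F} {v w : ℝ → ℝ}

lemma Adm.smooth (h : F.Adm v w) : ContDiff ℝ ∞ (F.co v w) ∧ ContDiff ℝ ∞ (F.si v w) :=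
  ⟨contDiff_iff_contDiffAt.2 fun _ =>
    (rot_contDiffAt h.sv.contDiffAt h.sw.contDiffAt F.f_smooth.contDiffAt).1,
  contDiff_iff_contDiffAt.2 fun _ =>
    (rot_contDiffAt h.sv.contDiffAt h.sw.contDiffAt F.f_smooth.contDiffAt).2⟩

lemma Adm.bounds (h : F.Adm v w) (x : ℝ) (t : ℕ) :
    jetNorm F.s t (jet (F.co v w) x) ≤ 40 ∧ jetNorm F.s t (jet (F.si v w) x) ≤ 40 ∧
    ∀ E, InvBd F.s t (jet F.f x) E →
      InvBd F.s t (kap (jet (F.co v w) x) (jet (F.si v w) x) (jet w x) (jet v x)) (4 * E) :=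
  jet_rot_bounds F.one_le_s h.sv.contDiffAt h.sw.contDiffAt F.f_smooth.contDiffAt
    ((h.nv x t).trans F.e₀_le) ((h.nw x t).trans F.e₀_le) ((F.f_le x t).trans (by norm_num))

lemma dep_le_of_tau_le {x y : ℝ} (hy : 0 < dep y) (h : F.tau y ≤ F.tau x) :
    dep x ≤ dep y := by
  by_contra! hlt
  exact absurd h (not_le.2 (Real.rpow_lt_rpow_of_neg hy hlt (by have := F.b_pos; linarith)))

lemma one_le_tau {x : ℝ} (hx : 0 < dep x) : 1 ≤ F.tau x :=
  Real.one_le_rpow_of_pos_of_le_one_of_nonpos hx (dep_le_one x) (by have := F.b_pos; linarith)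

lemma tau_crit {x : ℝ} {i : ℕ} (h : F.c / (4 * (i + 1)) ≤ dep x) :
    F.tau x ≤ F.K.τ₀ ∨ F.tau x ≤ (i : ℝ) ^ F.K.β := by
  have hc := F.c_pos
  have h0 : 0 < F.c / (4 * ((i : ℝ) + 1)) := by positivity
  have h1 : F.tau x ≤ (4 * ((i : ℝ) + 1) / F.c) ^ F.b := by
    have h2 := Real.rpow_le_rpow_of_nonpos h0 h (z := -F.b) (by have := F.b_pos; linarith)
    rwa [Real.rpow_neg h0.le, ← Real.inv_rpow h0.le, inv_div] at h2
  exact (F.good_crit i).imp h1.trans h1.trans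

lemma dep_int_sub (F : Frame) (x : ℝ) (m m' : ℤ) :
    dep ((m - m' : ℤ) * F.γ) ≤ dep (x + m * F.γ) + dep (x + m' * F.γ) := by
  have e : ((m - m' : ℤ) : ℝ) * F.γ = (x + m * F.γ) - (x + m' * F.γ) := by push_cast; ring
  rw [e]; exact dep_sub_le _ _

/-- The segment data along the orbit of `x`, for visits at distance at least `ρ`. -/
noncomputable def data (h : F.Adm v w) {ρ : ℝ} (hρ : 0 < ρ) (x : ℝ) (t : ℕ) :
    SegData F.K F.s t where
  hs := F.one_le_s
  c m := jet (F.co v w) (x + m * F.γ)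
  σ m := jet (F.si v w) (x + m * F.γ)
  unit m := jet_rot_unit h.sv.contDiffAt h.sw.contDiffAt F.f_smooth.contDiffAt
  c_le m := by rw [F.B_eq]; exact (h.bounds _ t).1
  σ_le m := by rw [F.B_eq]; exact (h.bounds _ t).2.1
  τ m := F.tau (x + m * F.γ)
  D := {m | ρ ≤ dep (x + m * F.γ)}
  one_le_τ m hm := one_le_tau (hρ.trans_le hm)
  sep m hm m' hm' k hk hτ := by
    -- The deeper visit is the closer one, so the sum of the two distances is at most twice the
    -- distance of the shallower visit; the separation of the orbit bounds this sum from below.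
    have h1 := dep_le_of_tau_le (hρ.trans_le hm') hτ
    refine tau_crit ?_
    have h2 : m - m' ≠ 0 := by intro h; rw [h] at hk; simp at hk; omega
    have h3 := F.sep _ h2
    have h4 : |((m - m' : ℤ) : ℝ)| = k + 1 := by rw [← Int.cast_abs, hk]; push_cast; ring
    have h5 := dep_int_sub F x m m'
    have h6 := dep_nonneg (x + m' * F.γ)
    rw [h4] at h3
    rw [div_le_iff₀ (by positivity)]
    have : (0 : ℝ) ≤ k := by positivity
    nlinarith

/-- Estimates on all good segments at scale `ρ`. -/
def AllOK (h : F.Adm v w) {ρ : ℝ} (hρ : 0 < ρ) : Prop :=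
  ∀ x t a n, Good (fun m : ℤ => F.tau (x + m * F.γ)) F.K.τ₀ F.K.β a n →
    InSet {m : ℤ | ρ ≤ dep (x + m * F.γ)} a n → (data h hρ x t).OK a n

/-- Reference segments are good. -/
lemma ref_good (F : Frame) {n : ℕ} {x : ℝ} {m : ℤ} (hm : dep (x + m * F.γ) ≤ F.r n) :
    (Good (fun m : ℤ => F.tau (x + m * F.γ)) F.K.τ₀ F.K.β (m - F.N n) (F.N n) ∧
      InSet {m : ℤ | F.r n ≤ dep (x + m * F.γ)} (m - F.N n) (F.N n)) ∧
    (Good (fun m : ℤ => F.tau (x + m * F.γ)) F.K.τ₀ F.K.β (m + 1) (F.N n) ∧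
      InSet {m : ℤ | F.r n ≤ dep (x + m * F.γ)} (m + 1) (F.N n)) := by
  have hr := F.ref n _ hm
  have e : ∀ k : ℤ, x + m * F.γ + k * F.γ = x + (m + k : ℤ) * F.γ := by
    intro k; push_cast; ring
  have comb : ∀ {y : ℝ} {i j : ℕ}, F.c / (4 * (i + 1)) ≤ dep y → F.c / (4 * (j + 1)) ≤ dep y →
      F.tau y ≤ F.K.τ₀ ∨ (F.tau y ≤ (i : ℝ) ^ F.K.β ∧ F.tau y ≤ (j : ℝ) ^ F.K.β) := by
    intro y i j h1 h2
    rcases tau_crit h1 with h3 | h3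
    · exact Or.inl h3
    · exact (tau_crit h2).imp id fun h4 => ⟨h3, h4⟩
  have left : ∀ i j : ℕ, i + 1 + j = F.N n → m - F.N n + i = m + (-(j + 1) : ℤ) := by
    intro i j h; rw [← h]; push_cast; ring
  refine ⟨⟨?_, ?_⟩, ?_, ?_⟩
  · intro i j hij
    obtain ⟨h1, h2, -⟩ := hr (-(j + 1)) i j hij (by rw [abs_neg, abs_of_nonneg (by positivity)])
    rw [e] at h1 h2
    simp only [left i j hij]
    exact comb h1 h2
  · intro i hi
    obtain ⟨j, hj⟩ : ∃ j, i + 1 + j = F.N n := ⟨F.N n - (i + 1), by omega⟩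
    obtain ⟨-, -, h3⟩ := hr (-(j + 1)) i j hj (by rw [abs_neg, abs_of_nonneg (by positivity)])
    rw [e] at h3
    rw [left i j hj]
    exact h3
  · intro i j hij
    obtain ⟨h1, h2, -⟩ := hr (1 + i) j i (by omega) (by rw [abs_of_nonneg (by positivity)]; ring)
    rw [e, ← add_assoc] at h1 h2
    exact comb h2 h1
  · intro i hi
    obtain ⟨j, hj⟩ : ∃ j, i + 1 + j = F.N n := ⟨F.N n - (i + 1), by omega⟩
    obtain ⟨-, -, h3⟩ := hr (1 + i) j i (by omega) (by rw [abs_of_nonneg (by positivity)]; ring)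
    rw [e, ← add_assoc] at h3
    exact h3

/-- The slope of the reference product ending at `x`. -/
noncomputable def refV (F : Frame) (v w : ℝ → ℝ) (n : ℕ) (x : ℝ) : ℝ :=
  realSlope (orbitSeg F.K.lam F.γ (F.co v w) (F.si v w) (0 - F.N n) (F.N n) x)

/-- The coslope of the reference product starting after `x`. -/
noncomputable def refW (F : Frame) (v w : ℝ → ℝ) (n : ℕ) (x : ℝ) : ℝ :=
  realCoslope (orbitSeg F.K.lam F.γ (F.co v w) (F.si v w) (0 + 1) (F.N n) x)

/-- Reference slopes are functions of the point at which they are evaluated, whereas the segment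
estimates live on the orbit of a fixed x; this translates between the two. -/
lemma mat_data_shift (h : F.Adm v w) {ρ : ℝ} (hρ : 0 < ρ) (x : ℝ) (t : ℕ) (m a : ℤ) (n : ℕ) :
    (data h hρ (x + m * F.γ) t).mat a n = (data h hρ x t).mat (a + m) n := by
  refine seg_shift _ _ m (fun k => ?_) (fun k => ?_) a n <;>
  · simp only [data]
    congr 1; push_cast; ring

lemma ok_entry_ne_zero {K : SegConst} {s : ℝ} {t : ℕ} {S : SegData K s t} {a : ℤ} {n : ℕ}
    (h : S.OK a n) : PowerSeries.constantCoeff (S.mat a n 0 0) ≠ 0 := by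
  obtain ⟨p, q, v, w, h1, -⟩ := h.1
  rw [h1.h00]
  intro h0
  have := congrArg PowerSeries.constantCoeff h1.hpq
  simp [h0] at this

lemma jetMat_eq_mat (h : F.Adm v w) {ρ : ℝ} (hρ : 0 < ρ) (x : ℝ) (t : ℕ) (a : ℤ) (n : ℕ) :
    jetMat (orbitSeg F.K.lam F.γ (F.co v w) (F.si v w) a n) x = (data h hρ x t).mat a n :=
  (jetMat_orbitSeg h.smooth.1 h.smooth.2 a n x).2

/-- The jets of the reference slopes. -/
lemma jet_ref (h : F.Adm v w) {ρ : ℝ} (hρ : 0 < ρ) (hOK : AllOK h hρ) {n : ℕ} (hn : ρ ≤ F.r n)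
    {x : ℝ} (t : ℕ) {m : ℤ} (hm : dep (x + m * F.γ) ≤ F.r n) :
    (ContDiffAt ℝ ∞ (F.refV v w n) (x + m * F.γ) ∧ jet (F.refV v w n) (x + m * F.γ) =
      slope ((data h hρ x t).mat (m - F.N n) (F.N n))) ∧
    (ContDiffAt ℝ ∞ (F.refW v w n) (x + m * F.γ) ∧ jet (F.refW v w n) (x + m * F.γ) =
      coslope ((data h hρ x t).mat (m + 1) (F.N n))) := by
  obtain ⟨⟨g1, i1⟩, g2, i2⟩ := F.ref_good hm
  have o1 := hOK x t _ _ g1 fun k hk => hn.trans (i1 k hk)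
  have o2 := hOK x t _ _ g2 fun k hk => hn.trans (i2 k hk)
  -- The slope is a quotient; its denominator is nonzero because the factorization exhibits an
  -- inverse of the upper left entry as a power series.
  have key : ∀ (a : ℤ), (data h hρ x t).OK (a + m) (F.N n) →
      orbitSeg F.K.lam F.γ (F.co v w) (F.si v w) a (F.N n) (x + m * F.γ) 0 0 ≠ 0 := by
    intro a ha
    have h1 := ok_entry_ne_zero ha
    rw [← mat_data_shift, ← jetMat_eq_mat] at h1
    simpa [jetMat, constantCoeff_jet] using h1
  have e1 : 0 - (F.N n : ℤ) + m = m - F.N n := by ring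
  have e2 : 0 + 1 + m = m + 1 := by ring
  constructor
  · have := (jet_realSlope (jetMat_orbitSeg h.smooth.1 h.smooth.2 _ _ _).1
      (key (0 - F.N n) (by rw [e1]; exact o1))).1
    rw [jetMat_eq_mat h hρ _ t, mat_data_shift, e1] at this
    exact this
  · have := (jet_realSlope (jetMat_orbitSeg h.smooth.1 h.smooth.2 _ _ _).1
      (key (0 + 1) (by rw [e2]; exact o2))).2
    rw [jetMat_eq_mat h hρ _ t, mat_data_shift, e2] at this
    exact this

/-- All good segments at scale `ρ` form a family. -/
lemma family (h : F.Adm v w) {ρ : ℝ} (hρ : 0 < ρ) (hOK : AllOK h hρ) (x : ℝ) (t : ℕ) :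
    (data h hρ x t).Family fun a n => Good (data h hρ x t).τ F.K.τ₀ F.K.β a n ∧
      InSet (data h hρ x t).D a n := by
  rintro a n ⟨g, i⟩
  refine ⟨hOK x t a n g i, g, i, ?_⟩
  rintro k j rfl hd
  exact ⟨⟨SegData.good_left i g hd, SegData.inSet_left i (by omega)⟩,
    SegData.good_right i g hd, SegData.inSet_right i⟩

/-- Two pairs of slope functions agreeing outside a neighbourhood of the critical point. -/
def Agree (v w v' w' : ℝ → ℝ) (ρ : ℝ) : Prop :=
  ∀ x, ρ ≤ dep x → v =ᶠ[𝓝 x] v' ∧ w =ᶠ[𝓝 x] w'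

lemma Agree.jet_eq {v' w' : ℝ → ℝ} {ρ : ℝ} (h : Agree v w v' w' ρ) {x : ℝ} (hx : ρ ≤ dep x) :
    jet (F.co v w) x = jet (F.co v' w') x ∧ jet (F.si v w) x = jet (F.si v' w') x := by
  obtain ⟨h1, h2⟩ := h x hx
  constructor <;>
  · apply jet_congr
    filter_upwards [h1, h2] with y e1 e2
    simp only [co, si, e1, e2]

lemma Agree.mat_eq {v' w' : ℝ → ℝ} {ρ ρ₁ ρ₂ : ℝ} (hA : Agree v w v' w' ρ) (h : F.Adm v w)
    (h' : F.Adm v' w') (hρ₁ : 0 < ρ₁) (hρ₂ : 0 < ρ₂) {x : ℝ} {t : ℕ} {a : ℤ} {n : ℕ}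
    (hi : InSet {m : ℤ | ρ ≤ dep (x + m * F.γ)} a n) :
    (data h hρ₁ x t).mat a n = (data h' hρ₂ x t).mat a n :=
  seg_congr fun i hi' => hA.jet_eq (hi i hi')

lemma Agree.mono {v' w' : ℝ → ℝ} {ρ ρ' : ℝ} (hA : Agree v w v' w' ρ) (h : ρ ≤ ρ') :
    Agree v w v' w' ρ' := fun x hx => hA x (h.trans hx)

lemma Agree.trans {v' w' v'' w'' : ℝ → ℝ} {ρ : ℝ} (h : Agree v w v' w' ρ)
    (h' : Agree v' w' v'' w'' ρ) : Agree v w v'' w'' ρ := fun x hx =>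
  ⟨(h x hx).1.trans (h' x hx).1, (h x hx).2.trans (h' x hx).2⟩

lemma Agree.symm {v' w' : ℝ → ℝ} {ρ : ℝ} (h : Agree v w v' w' ρ) : Agree v' w' v w ρ := fun x hx =>
  ⟨(h x hx).1.symm, (h x hx).2.symm⟩

/-- The estimates transfer between data which agree at the relevant scale. -/
lemma Agree.ok {v' w' : ℝ → ℝ} {ρ ρ₁ ρ₂ : ℝ} (hA : Agree v w v' w' ρ) (h : F.Adm v w)
    (h' : F.Adm v' w') (hρ₁ : 0 < ρ₁) (hρ₂ : 0 < ρ₂) {x : ℝ} {t : ℕ} {a : ℤ} {n : ℕ}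
    (hi : InSet {m : ℤ | ρ ≤ dep (x + m * F.γ)} a n) (hok : (data h hρ₁ x t).OK a n) :
    (data h' hρ₂ x t).OK a n := by
  obtain ⟨h1, h2⟩ := hok
  rw [hA.mat_eq h h' hρ₁ hρ₂ hi] at h1
  refine ⟨h1, fun i j hij hd => ?_⟩
  subst hij
  have h3 := h2 i j rfl hd
  have e := hA.jet_eq (F := F) (hi i (by omega))
  unfold SegData.pivot at h3 ⊢
  rw [hA.mat_eq h h' hρ₁ hρ₂ (SegData.inSet_left hi (by omega)),
    hA.mat_eq h h' hρ₁ hρ₂ (SegData.inSet_right hi)] at h3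
  simp only [data] at h3 ⊢
  rw [← e.1, ← e.2]
  exact h3

end Frame

/-! ### Successive approximation of the slope functions -/

namespace Frame

variable {F : Frame} {v w : ℝ → ℝ}

lemma r_succ_lt (F : Frame) (n : ℕ) : F.r (n + 1) < F.r n := by
  rw [F.r_succ]; have := F.r_pos n; linarith

lemma r_anti (F : Frame) : Antitone F.r := antitone_nat_of_succ_le fun n => (F.r_succ_lt n).le

lemma ok_nil {K : SegConst} {s : ℝ} {t : ℕ} {S : SegData K s t} (a : ℤ)
    (hg : Good S.τ K.τ₀ K.β a 0) : S.OK a 0 :=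
  SegData.ok_of_split hg (fun i hi => absurd hi (by omega)) fun i j h => absurd h (by omega)

lemma kap_inv (h : F.Adm v w) {x : ℝ} (hx : 0 < dep x) (t : ℕ) :
    InvBd F.s t (kap (jet (F.co v w) x) (jet (F.si v w) x) (jet w x) (jet v x))
      (Real.exp (F.L₁ * F.tau x)) :=
  ((h.bounds x t).2.2 _ (F.f_inv x t hx)).mono (by unfold tau; linarith)

/-- Segments with only shallow visits. -/
lemma allOK_shallow (h : F.Adm v w) {ρ : ℝ} (hρ : 0 < ρ) (h1 : F.r 1 ≤ ρ) : AllOK h hρ := by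
  intro x t a n hg hD
  -- With all depths at most τ₀ there are no reference segments to use: every visit counts as new
  -- and is treated by the shallow case.
  refine SegData.ok_extend (S := data h hρ x t) (D₀ := ∅) (Set.empty_subset _) (by simp) ?_
    (V := fun m => jet v (x + m * F.γ)) (W := fun m => jet w (x + m * F.γ)) F.C₃_nonneg
    (fun m hm => kap_inv h (hρ.trans_le hm) t) (fun m => (h.nw _ t).trans (by linarith [F.e₀_le]))
    F.hL F.hdeep F.inv_lam_le F.hshallow ?_ a n hg hD
  · intro a n hg hi
    rcases Nat.eq_zero_or_pos n with rfl | hn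
    · exact ok_nil a hg
    · exact absurd (hi 0 hn) (by simp)
  · intro m hm _
    refine Or.inl ⟨?_, h.nv _ t, h.nw _ t⟩
    rw [F.τ₀_eq]
    exact Real.rpow_le_rpow_of_nonpos (F.r_pos 1) (h1.trans hm) (by linarith [F.b_pos])

lemma jet_ref_of_agree (h : F.Adm v w) {ρ : ℝ} (hρ : 0 < ρ) (hOK : AllOK h hρ) {n : ℕ}
    (hn : ρ ≤ F.r n) {v' w' : ℝ → ℝ} (h' : F.Adm v' w') (hA : Agree v w v' w' (F.r n)) {ρ' : ℝ}
    (hρ' : 0 < ρ') {x : ℝ} (t : ℕ) {m : ℤ} (hm : dep (x + m * F.γ) ≤ F.r n) :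
    jet (F.refV v w n) (x + m * F.γ) = slope ((data h' hρ' x t).mat (m - F.N n) (F.N n)) ∧
    jet (F.refW v w n) (x + m * F.γ) = coslope ((data h' hρ' x t).mat (m + 1) (F.N n)) := by
  obtain ⟨h1, h2⟩ := jet_ref h hρ hOK hn t hm
  obtain ⟨g1, g2⟩ := F.ref_good hm
  rw [h1.2, h2.2, hA.mat_eq h h' hρ hρ' g1.2, hA.mat_eq h h' hρ hρ' g2.2]
  exact ⟨rfl, rfl⟩

/-- The successive approximations of the slope functions. -/
noncomputable def VW (F : Frame) : ℕ → (ℝ → ℝ) × (ℝ → ℝ)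
  | 0 => (fun _ => 0, fun _ => 0)
  | n + 1 => (fun x => (VW F n).1 x + F.χ n x * (F.refV (VW F n).1 (VW F n).2 n x - (VW F n).1 x),
      fun x => (VW F n).2 x + F.χ n x * (F.refW (VW F n).1 (VW F n).2 n x - (VW F n).2 x))

/-- The `n`-th slope function. -/
noncomputable def V (F : Frame) (n : ℕ) : ℝ → ℝ := (F.VW n).1

/-- The `n`-th coslope function. -/
noncomputable def W (F : Frame) (n : ℕ) : ℝ → ℝ := (F.VW n).2

/-- The estimates available at the `n`-th step. -/
structure Stage (F : Frame) (n : ℕ) : Prop where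
  adm : F.Adm (F.V n) (F.W n)
  nV : ∀ x t, jetNorm F.s t (jet (F.V n) x) ≤ ∑ i ∈ Finset.range n, F.η i
  nW : ∀ x t, jetNorm F.s t (jet (F.W n) x) ≤ ∑ i ∈ Finset.range n, F.η i
  ok : AllOK adm (F.r_pos n)

lemma stage_zero (F : Frame) : F.Stage 0 := by
  have h0 : ∀ x, jet (F.V 0) x = 0 := fun x => by
    change jet (fun _ => 0) x = 0
    rw [jet_const, map_zero]
  have h0' : ∀ x, jet (F.W 0) x = 0 := h0
  have he : 0 ≤ F.e₀ := SegData.inv_lam_nonneg.trans F.inv_lam_le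
  have hA : F.Adm (F.V 0) (F.W 0) := by
    refine ⟨contDiff_const, contDiff_const, fun x t => ?_, fun x t => ?_⟩
    · rw [h0, jetNorm_zero]; exact he
    · rw [h0', jetNorm_zero]; exact he
  exact ⟨hA, fun x t => by rw [h0, jetNorm_zero]; simp, fun x t => by rw [h0', jetNorm_zero]; simp,
    allOK_shallow hA _ (F.r_succ_lt 0).le⟩

lemma Stage.ref {n : ℕ} (h : F.Stage n) {x : ℝ} (hx : dep x ≤ F.r n) :
    ContDiffAt ℝ ∞ (F.refV (F.V n) (F.W n) n) x ∧ ContDiffAt ℝ ∞ (F.refW (F.V n) (F.W n) n) x := by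
  have := jet_ref h.adm (F.r_pos n) h.ok le_rfl (x := x) 0 (m := 0) (by simpa using hx)
  simp only [Int.cast_zero, zero_mul, add_zero] at this
  exact ⟨this.1.1, this.2.1⟩

/-- Local description of the next slope functions. -/
lemma Stage.glue {n : ℕ} (h : F.Stage n) :
    (ContDiff ℝ ∞ (F.V (n + 1)) ∧ ContDiff ℝ ∞ (F.W (n + 1))) ∧
    (∀ x, F.r n / 2 < dep x → F.V (n + 1) =ᶠ[𝓝 x] F.V n ∧ F.W (n + 1) =ᶠ[𝓝 x] F.W n) ∧
    (∀ x, dep x < F.r n / 8 → F.V (n + 1) =ᶠ[𝓝 x] F.refV (F.V n) (F.W n) n ∧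
      F.W (n + 1) =ᶠ[𝓝 x] F.refW (F.V n) (F.W n) n) ∧
    (∀ x, dep x ≤ F.r n →
      jet (F.V (n + 1)) x = jet (F.V n) x +
        jet (F.χ n) x * (jet (F.refV (F.V n) (F.W n) n) x - jet (F.V n) x) ∧
      jet (F.W (n + 1)) x = jet (F.W n) x +
        jet (F.χ n) x * (jet (F.refW (F.V n) (F.W n) n) x - jet (F.W n) x)) := by
  obtain ⟨a1, a2, a3, a4⟩ := GevreyLE.glue (F.r_pos n) h.adm.sv (F.χ_smooth n) (F.χ_off n) (F.χ_on n)
    fun x hx => (h.ref hx).1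
  obtain ⟨b1, b2, b3, b4⟩ := GevreyLE.glue (F.r_pos n) h.adm.sw (F.χ_smooth n) (F.χ_off n) (F.χ_on n)
    fun x hx => (h.ref hx).2
  exact ⟨⟨a1, b1⟩, fun x hx => ⟨a2 x hx, b2 x hx⟩, fun x hx => ⟨a3 x hx, b3 x hx⟩,
    fun x hx => ⟨a4 x hx, b4 x hx⟩⟩

lemma Stage.agree {n : ℕ} (h : F.Stage n) :
    Agree (F.V (n + 1)) (F.W (n + 1)) (F.V n) (F.W n) (F.r n) := fun x hx =>
  h.glue.2.1 x (by have := F.r_pos n; linarith)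

/-- Size of an increment from the size of the correction on the support of the cutoff. -/
lemma Stage.increment {n : ℕ} (h : F.Stage n) {d : ℝ} (hd0 : 0 ≤ d)
    (hη : Real.exp (F.C₃ * F.r n ^ (-F.b)) * d ≤ F.η n)
    (hd : ∀ x t, dep x ≤ F.r n / 2 →
      jetNorm F.s t (jet (F.refV (F.V n) (F.W n) n) x - jet (F.V n) x) ≤ d ∧
      jetNorm F.s t (jet (F.refW (F.V n) (F.W n) n) x - jet (F.W n) x) ≤ d) (x : ℝ) (t : ℕ) :
    jetNorm F.s t (jet (F.V (n + 1)) x - jet (F.V n) x) ≤ F.η n ∧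
    jetNorm F.s t (jet (F.W (n + 1)) x - jet (F.W n) x) ≤ F.η n := by
  rcases lt_or_ge (F.r n / 2) (dep x) with hx | hx
  · obtain ⟨e1, e2⟩ := h.glue.2.1 x hx
    rw [jet_congr e1, jet_congr e2, sub_self, sub_self, jetNorm_zero]
    have := (mul_nonneg (Real.exp_pos _).le hd0).trans hη
    exact ⟨this, this⟩
  · obtain ⟨e1, e2⟩ := h.glue.2.2.2 x (by have := F.r_pos n; linarith)
    rw [e1, e2, add_sub_cancel_left, add_sub_cancel_left]
    exact ⟨(jetNorm_mul_le F.one_le_s (F.χ_le n t x) (hd x t hx).1).trans hη,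
      (jetNorm_mul_le F.one_le_s (F.χ_le n t x) (hd x t hx).2).trans hη⟩

/-- Admissibility of the next slope functions. -/
lemma Stage.adm_succ {n : ℕ} (h : F.Stage n)
    (hinc : ∀ x t, jetNorm F.s t (jet (F.V (n + 1)) x - jet (F.V n) x) ≤ F.η n ∧
      jetNorm F.s t (jet (F.W (n + 1)) x - jet (F.W n) x) ≤ F.η n) :
    F.Adm (F.V (n + 1)) (F.W (n + 1)) ∧
    (∀ x t, jetNorm F.s t (jet (F.V (n + 1)) x) ≤ ∑ i ∈ Finset.range (n + 1), F.η i) ∧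
    (∀ x t, jetNorm F.s t (jet (F.W (n + 1)) x) ≤ ∑ i ∈ Finset.range (n + 1), F.η i) := by
  have h1 : ∀ x t, jetNorm F.s t (jet (F.V (n + 1)) x) ≤ ∑ i ∈ Finset.range (n + 1), F.η i := by
    intro x t
    rw [Finset.sum_range_succ, ← add_sub_cancel (jet (F.V n) x) (jet (F.V (n + 1)) x)]
    exact (jetNorm_add _ _).trans (add_le_add (h.nV x t) (hinc x t).1)
  have h2 : ∀ x t, jetNorm F.s t (jet (F.W (n + 1)) x) ≤ ∑ i ∈ Finset.range (n + 1), F.η i := by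
    intro x t
    rw [Finset.sum_range_succ, ← add_sub_cancel (jet (F.W n) x) (jet (F.W (n + 1)) x)]
    exact (jetNorm_add _ _).trans (add_le_add (h.nW x t) (hinc x t).2)
  exact ⟨⟨h.glue.1.1, h.glue.1.2, fun x t => (h1 x t).trans (F.η_sum _),
    fun x t => (h2 x t).trans (F.η_sum _)⟩, h1, h2⟩

lemma ref_slope_le (h : F.Adm v w) {ρ : ℝ} (hρ : 0 < ρ) (hOK : AllOK h hρ) {n : ℕ} (hn : ρ ≤ F.r n)
    {x : ℝ} (t : ℕ) (hx : dep x ≤ F.r n) :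
    jetNorm F.s t (jet (F.refV v w n) x) ≤ F.K.lam⁻¹ ∧
    jetNorm F.s t (jet (F.refW v w n) x) ≤ F.K.lam⁻¹ := by
  have hx' : dep (x + (0 : ℤ) * F.γ) ≤ F.r n := by simpa using hx
  have h1 := jet_ref h hρ hOK hn (x := x) t hx'
  obtain ⟨g1, g2⟩ := F.ref_good hx'
  have o1 := (hOK x t _ _ g1.1 fun k hk => hn.trans (g1.2 k hk)).slope_le
  have o2 := (hOK x t _ _ g2.1 fun k hk => hn.trans (g2.2 k hk)).coslope_le
  rw [← h1.1.2] at o1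
  rw [← h1.2.2] at o2
  have := SegData.inv_lam_nonneg (K := F.K)
  simp only [Int.cast_zero, zero_mul, add_zero] at o1 o2
  exact ⟨o1.trans (by linarith), o2.trans (by linarith)⟩

lemma increment_zero (F : Frame) (x : ℝ) (t : ℕ) :
    jetNorm F.s t (jet (F.V 1) x - jet (F.V 0) x) ≤ F.η 0 ∧
    jetNorm F.s t (jet (F.W 1) x - jet (F.W 0) x) ≤ F.η 0 := by
  have h := F.stage_zero
  refine h.increment SegData.inv_lam_nonneg F.η_zero (fun x t hx => ?_) x t
  have h0 : jet (F.V 0) x = 0 := by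
    change jet (fun _ => 0) x = 0
    rw [jet_const, map_zero]
  have h0' : jet (F.W 0) x = 0 := h0
  rw [h0, h0', sub_zero, sub_zero]
  exact ref_slope_le h.adm (F.r_pos 0) h.ok le_rfl t (by have := F.r_pos 0; linarith)

lemma stage_one (F : Frame) : F.Stage 1 := by
  obtain ⟨h1, h2, h3⟩ := F.stage_zero.adm_succ F.increment_zero
  exact ⟨h1, h2, h3, allOK_shallow h1 _ le_rfl⟩

/-- On the support of the new cutoff the current slope is already the reference slope of length N_n,
because r_{n+1}/2 < r_n/8. The correction is therefore a difference of two reference slopes with a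
common end, exponentially small in the shorter length, and beats the cost of the cutoff. -/
lemma Stage.increment_succ {n : ℕ} (h : F.Stage n) (h' : F.Stage (n + 1)) (x : ℝ) (t : ℕ) :
    jetNorm F.s t (jet (F.V (n + 2)) x - jet (F.V (n + 1)) x) ≤ F.η (n + 1) ∧
    jetNorm F.s t (jet (F.W (n + 2)) x - jet (F.W (n + 1)) x) ≤ F.η (n + 1) := by
  refine h'.increment (mul_nonneg two_pos.le (pow_nonneg SegData.inv_lam_nonneg _)) (F.η_succ n)
    (fun x t hx => ?_) x t
  have hr := F.r_pos n
  have hr1 := F.r_succ n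
  obtain ⟨e1, e2⟩ := h.glue.2.2.1 x (by linarith)
  rw [jet_congr e1, jet_congr e2]
  have hx0 : dep (x + (0 : ℤ) * F.γ) ≤ F.r n := by simp; linarith
  have hx1 : dep (x + (0 : ℤ) * F.γ) ≤ F.r (n + 1) := by simp; linarith
  have a1 := jet_ref_of_agree h.adm (F.r_pos n) h.ok le_rfl h'.adm h.agree.symm (F.r_pos (n + 1)) t hx0
  have a2 := jet_ref h'.adm (F.r_pos (n + 1)) h'.ok le_rfl t hx1
  have fam := family h'.adm (F.r_pos (n + 1)) h'.ok x t
  obtain ⟨g1, g2⟩ := F.ref_good hx0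
  obtain ⟨g1', g2'⟩ := F.ref_good hx1
  have c1 := fam.compare_le (k := min (F.N n) (F.N (n + 1))) (by ring)
    ⟨g1.1, fun k hk => (F.r_succ_lt n).le.trans (g1.2 k hk)⟩ g1' (min_le_left _ _) (min_le_right _ _)
  have c2 := fam.compare_coslope_le (k := min (F.N n) (F.N (n + 1)))
    ⟨g2.1, fun k hk => (F.r_succ_lt n).le.trans (g2.2 k hk)⟩ g2' (min_le_left _ _) (min_le_right _ _)
  rw [← a1.1, ← a2.1.2] at c1
  rw [← a1.2, ← a2.2.2] at c2
  simp only [Int.cast_zero, zero_mul, add_zero] at c1 c2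
  exact ⟨c1, c2⟩

/-- The new visits lie between r_{n+2} and r_{n+1}. There the new slope interpolates, with weight
χ_{n+1}, between the references of lengths N_n and N_{n+1}, both computed from orbit pieces on which
nothing changes any more. Two preceding stages are therefore needed. -/
lemma Stage.succ {n : ℕ} (h : F.Stage n) (h' : F.Stage (n + 1)) : F.Stage (n + 2) := by
  obtain ⟨hA, hV, hW⟩ := h'.adm_succ (h.increment_succ h')
  refine ⟨hA, hV, hW, ?_⟩
  have hr := F.r_pos n
  have hr1 := F.r_succ n
  have hr2 := F.r_succ (n + 1)
  have hb := F.b_pos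
  intro x t a l hg hD
  refine SegData.ok_extend (S := data hA (F.r_pos (n + 2)) x t)
    (D₀ := {m : ℤ | F.r (n + 1) ≤ dep (x + m * F.γ)})
    (fun m hm => (F.r_succ_lt (n + 1)).le.trans hm) ?_ ?_
    (V := fun m => jet (F.V (n + 2)) (x + m * F.γ)) (W := fun m => jet (F.W (n + 2)) (x + m * F.γ))
    F.C₃_nonneg (fun m hm => kap_inv hA ((F.r_pos (n + 2)).trans_le hm) t)
    (fun m => (hA.nw _ t).trans (by linarith [F.e₀_le]))
    F.hL F.hdeep F.inv_lam_le F.hshallow ?_ a l hg hD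
  · intro m hm m' hm' hτ
    exact le_trans hm (dep_le_of_tau_le ((F.r_pos (n + 2)).trans_le hm') hτ)
  · intro a l hg hi
    exact h'.agree.symm.ok h'.adm hA (F.r_pos (n + 1)) _ hi (h'.ok x t a l hg hi)
  · intro m hm hm0
    have hd1 : F.r (n + 2) ≤ dep (x + m * F.γ) := hm
    have hd2 : dep (x + m * F.γ) < F.r (n + 1) := not_le.1 hm0
    have hpos : 0 < dep (x + m * F.γ) := (F.r_pos _).trans_le hd1
    have hτ : F.tau (x + m * F.γ) ≤ F.r (n + 2) ^ (-F.b) :=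
      Real.rpow_le_rpow_of_nonpos (F.r_pos _) hd1 (by linarith)
    have hx0 : dep (x + m * F.γ) ≤ F.r n := by linarith
    obtain ⟨e1, e2⟩ := h.glue.2.2.1 (x + m * F.γ) (by linarith)
    have ag : Agree (F.V n) (F.W n) (F.V (n + 2)) (F.W (n + 2)) (F.r n) :=
      h.agree.symm.trans (h'.agree.symm.mono (F.r_succ_lt n).le)
    -- Each reference slope was defined with older slope functions; agreement outside the relevant
    -- ball makes it a slope of the new cocycle.
    have a1 := jet_ref_of_agree h.adm (F.r_pos n) h.ok le_rfl hA ag (F.r_pos (n + 2)) (x := x) t hx0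
    have a2 := jet_ref_of_agree h'.adm (F.r_pos (n + 1)) h'.ok le_rfl hA h'.agree.symm
      (F.r_pos (n + 2)) (x := x) t hd2.le
    obtain ⟨f1, f2⟩ := h'.glue.2.2.2 (x + m * F.γ) hd2.le
    rw [jet_congr e1, a1.1, a2.1] at f1
    rw [jet_congr e2, a1.2, a2.2] at f2
    obtain ⟨g1, g2⟩ := F.ref_good hx0
    obtain ⟨g1', g2'⟩ := F.ref_good hd2.le
    refine Or.inr ⟨?_, jet (F.χ (n + 1)) (x + m * F.γ), F.N n, F.N (n + 1), ?_, hτ.trans (F.deep n),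
      ?_, ⟨g1.1, fun k hk => (F.r_succ_lt n).le.trans (g1.2 k hk), g2.1,
        fun k hk => (F.r_succ_lt n).le.trans (g2.2 k hk)⟩, ⟨g1'.1, g1'.2, g2'.1, g2'.2⟩, ?_, ?_⟩
    · rw [F.τ₀_eq]
      exact Real.rpow_lt_rpow_of_neg hpos (hd2.trans_le (F.r_anti (by omega))) (by linarith)
    · refine (F.χ_le _ _ _).trans (Real.exp_le_exp.2 (mul_le_mul_of_nonneg_left ?_ F.C₃_nonneg))
      exact Real.rpow_le_rpow_of_nonpos hpos hd2.le (by linarith)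
    · refine (hτ.trans ?_).trans (F.deep (n + 1))
      exact Real.rpow_le_rpow_of_nonpos (F.r_pos _) (F.r_anti (by omega)) (by linarith)
    · rw [f1]; ring
    · rw [f2]; ring

lemma stage (F : Frame) (n : ℕ) : F.Stage n := by
  have : F.Stage n ∧ F.Stage (n + 1) := by
    induction n with
    | zero => exact ⟨F.stage_zero, F.stage_one⟩
    | succ n ih => exact ⟨ih.2, ih.1.succ ih.2⟩
  exact this.1

lemma increment (F : Frame) (n : ℕ) (x : ℝ) (t : ℕ) :
    jetNorm F.s t (jet (F.V (n + 1)) x - jet (F.V n) x) ≤ F.η n ∧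
    jetNorm F.s t (jet (F.W (n + 1)) x - jet (F.W n) x) ≤ F.η n := by
  cases n with
  | zero => exact F.increment_zero x t
  | succ n => exact (F.stage n).increment_succ (F.stage (n + 1)) x t

end Frame

/-! ### Convergence of smooth functions in jet norm -/

section Series

variable {s : ℝ}

lemma abs_le_jetNorm (s : ℝ) (t : ℕ) (g : ℝ → ℝ) (x : ℝ) : |g x| ≤ jetNorm s t (jet g x) := by
  rw [← constantCoeff_jet g x]; exact abs_coeff_zero_le _

/-- Series of smooth functions with summable jet norms. -/
lemma tsum_jet {g : ℕ → ℝ → ℝ} (hg : ∀ n, ContDiff ℝ ∞ (g n)) {η : ℕ → ℝ} (hη : Summable η)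
    (hb : ∀ n x t, jetNorm s t (jet (g n) x) ≤ η n) :
    ContDiff ℝ ∞ (fun x => ∑' n, g n x) ∧
    ∀ x t, jetNorm s t (jet (fun x => ∑' n, g n x) x) ≤ ∑' n, η n := by
  have hv : ∀ k : ℕ, (k : ℕ∞) ≤ ⊤ → Summable fun n => ((k ! : ℕ) : ℝ) ^ s * η n :=
    fun k _ => hη.mul_left _
  -- The bound is uniform in the truncation order, so it may be applied with t equal to the order of
  -- the derivative.
  have hbd : ∀ (k n : ℕ) (x : ℝ), |iteratedDeriv k (g n) x| ≤ ((k ! : ℕ) : ℝ) ^ s * η n := by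
    intro k n x
    refine (abs_iteratedDeriv_le_jetNorm s k (g n) x).trans ?_
    exact mul_le_mul_of_nonneg_left (hb n x k) (Real.rpow_nonneg (by positivity) _)
  have hf : ∀ (k n : ℕ) (x : ℝ), (k : ℕ∞) ≤ ⊤ →
      ‖iteratedFDeriv ℝ k (g n) x‖ ≤ ((k ! : ℕ) : ℝ) ^ s * η n := by
    intro k n x _
    rw [norm_iteratedFDeriv_eq_norm_iteratedDeriv]
    exact hbd k n x
  have hg' : ∀ n, ContDiff ℝ ((⊤ : ℕ∞) : WithTop ℕ∞) (g n) := hg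
  refine ⟨contDiff_tsum hg' hv hf, fun x t => ?_⟩
  have hder : ∀ k, iteratedDeriv k (fun x => ∑' n, g n x) x = ∑' n, iteratedDeriv k (g n) x := by
    intro k
    rw [iteratedDeriv_eq_equiv_comp, Function.comp_apply,
      iteratedFDeriv_tsum_apply hg' hv hf le_top x]
    simp only [iteratedDeriv_eq_equiv_comp, Function.comp_apply]
    exact (ContinuousMultilinearMap.piFieldEquiv ℝ (Fin k) ℝ).symm.toContinuousLinearEquiv.map_tsum
  have hsum : ∀ k, Summable fun n => |iteratedDeriv k (g n) x| := fun k =>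
    Summable.of_nonneg_of_le (fun n => abs_nonneg _) (fun n => hbd k n x) (hv k le_top)
  rw [jetNorm_jet]
  calc ∑ k ∈ Finset.range (t + 1), |iteratedDeriv k (fun x => ∑' n, g n x) x| * ((k ! : ℕ) : ℝ) ^ (-s)
      ≤ ∑ k ∈ Finset.range (t + 1), ∑' n, |iteratedDeriv k (g n) x| * ((k ! : ℕ) : ℝ) ^ (-s) := by
        refine Finset.sum_le_sum fun k _ => ?_
        rw [hder, tsum_mul_right]
        refine mul_le_mul_of_nonneg_right ?_ (Real.rpow_nonneg (by positivity) _)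
        have := norm_tsum_le_tsum_norm (f := fun n => iteratedDeriv k (g n) x) (hsum k)
        exact this
    _ = ∑' n, ∑ k ∈ Finset.range (t + 1), |iteratedDeriv k (g n) x| * ((k ! : ℕ) : ℝ) ^ (-s) :=
        (Summable.tsum_finsetSum fun k _ => (hsum k).mul_right _).symm
    _ ≤ ∑' n, η n := by
        refine Summable.tsum_le_tsum (fun n => ?_) (summable_sum fun k _ => (hsum k).mul_right _) hη
        have := hb n x t
        rwa [jetNorm_jet] at this

/-- Limit of a sequence of smooth functions with summable increments. -/
lemma exists_limit {u : ℕ → ℝ → ℝ} (hu : ∀ n, ContDiff ℝ ∞ (u n)) {η : ℕ → ℝ} (hη : Summable η)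
    (hb : ∀ n x t, jetNorm s t (jet (u (n + 1)) x - jet (u n) x) ≤ η n) :
    ∃ U : ℝ → ℝ, ContDiff ℝ ∞ U ∧ (∀ x, Filter.Tendsto (fun n => u n x) Filter.atTop (𝓝 (U x))) ∧
      ∀ n x t, jetNorm s t (jet U x - jet (u n) x) ≤ ∑' i, η (i + n) := by
  set g : ℕ → ℝ → ℝ := fun n x => u (n + 1) x - u n x with hg
  have hgs : ∀ n, ContDiff ℝ ∞ (g n) := fun n => (hu (n + 1)).sub (hu n)
  have hgb : ∀ n x t, jetNorm s t (jet (g n) x) ≤ η n := by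
    intro n x t
    simp only [hg]
    rw [jet_sub (hu _).contDiffAt (hu _).contDiffAt]; exact hb n x t
  have hsum : ∀ x, Summable fun n => g n x := fun x =>
    Summable.of_norm_bounded hη fun n => (abs_le_jetNorm s 0 (g n) x).trans (hgb n x 0)
  have htail : ∀ n x, u 0 x + ∑' i, g i x = u n x + ∑' i, g (i + n) x := by
    intro n x
    rw [← (hsum x).sum_add_tsum_nat_add n]
    have : ∑ i ∈ Finset.range n, g i x = u n x - u 0 x := Finset.sum_range_sub (fun n => u n x) n
    rw [this]; ring
  refine ⟨fun x => u 0 x + ∑' i, g i x, (hu 0).add (tsum_jet hgs hη hgb).1, fun x => ?_, fun n x t => ?_⟩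
  · have h1 := (hsum x).hasSum.tendsto_sum_nat
    have : ∀ n, ∑ i ∈ Finset.range n, g i x = u n x - u 0 x := fun n =>
      Finset.sum_range_sub (fun n => u n x) n
    simp only [this] at h1
    have h2 := h1.const_add (u 0 x)
    simpa using h2
  · have h1 := tsum_jet (s := s) (g := fun i => g (i + n)) (fun i => hgs _)
      ((summable_nat_add_iff n).2 hη) (fun i => hgb _)
    have e : (fun x => u 0 x + ∑' i, g i x) = fun x => u n x + ∑' i, g (i + n) x := funext (htail n)
    rw [e, jet_add (hu n).contDiffAt h1.1.contDiffAt, add_sub_cancel_left]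
    exact h1.2 x t

end Series

/-! ### The limit cocycle -/

namespace Frame

variable {F : Frame}

lemma η_nonneg (F : Frame) (n : ℕ) : 0 ≤ F.η n := (jetNorm_nonneg _).trans (F.increment n 0 0).1

lemma η_summable (F : Frame) : Summable F.η := summable_of_sum_range_le F.η_nonneg F.η_sum

/-- The remainder after `n` steps. -/
noncomputable def rem (F : Frame) (n : ℕ) : ℝ := ∑' i, F.η (i + n)

lemma rem_tendsto (F : Frame) : Filter.Tendsto F.rem Filter.atTop (𝓝 0) := tendsto_sum_nat_add F.η

lemma co_periodic {v w : ℝ → ℝ} (hv : Function.Periodic v (2 * Real.pi))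
    (hw : Function.Periodic w (2 * Real.pi)) :
    Function.Periodic (F.co v w) (2 * Real.pi) ∧ Function.Periodic (F.si v w) (2 * Real.pi) :=
  ⟨fun x => by simp only [co, hv x, hw x, F.f_periodic x],
    fun x => by simp only [si, hv x, hw x, F.f_periodic x]⟩

lemma orbitSeg_periodic {l γ : ℝ} {co si : ℝ → ℝ} (hc : Function.Periodic co (2 * Real.pi))
    (hs : Function.Periodic si (2 * Real.pi)) (a : ℤ) (n : ℕ) :
    Function.Periodic (orbitSeg l γ co si a n) (2 * Real.pi) := by
  intro x
  refine seg_congr fun i _ => ?_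
  rw [show x + 2 * Real.pi + ((a + i : ℤ) : ℝ) * γ = (x + ((a + i : ℤ) : ℝ) * γ) + 2 * Real.pi by ring,
    hc, hs]
  exact ⟨rfl, rfl⟩

lemma VW_periodic (F : Frame) (n : ℕ) :
    Function.Periodic (F.V n) (2 * Real.pi) ∧ Function.Periodic (F.W n) (2 * Real.pi) := by
  induction n with
  | zero => exact ⟨fun _ => rfl, fun _ => rfl⟩
  | succ n ih =>
    obtain ⟨hc, hs⟩ := co_periodic (F := F) ih.1 ih.2
    constructor
    · intro x
      change F.V n _ + F.χ n _ * (F.refV (F.V n) (F.W n) n _ - F.V n _) = _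
      rw [ih.1, F.χ_periodic n x, refV, orbitSeg_periodic hc hs]
      rfl
    · intro x
      change F.W n _ + F.χ n _ * (F.refW (F.V n) (F.W n) n _ - F.W n _) = _
      rw [ih.2, F.χ_periodic n x, refW, orbitSeg_periodic hc hs]
      rfl

/-- The limiting slope functions. -/
structure Limit (F : Frame) (v w : ℝ → ℝ) : Prop where
  adm : F.Adm v w
  periodic : Function.Periodic v (2 * Real.pi) ∧ Function.Periodic w (2 * Real.pi)
  near : ∀ n x t, jetNorm F.s t (jet v x - jet (F.V n) x) ≤ F.rem n ∧
    jetNorm F.s t (jet w x - jet (F.W n) x) ≤ F.rem n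
  ok : ∀ n, AllOK adm (F.r_pos n)

/-- Later cutoffs are supported in smaller balls, so away from the critical point the construction
stops after finitely many steps. The limit thus inherits the estimates of every stage exactly. -/
lemma stationary {F : Frame} {x : ℝ} {n : ℕ} (hx : F.r n / 2 < dep x) (k : ℕ) :
    F.V (n + k) x = F.V n x ∧ F.W (n + k) x = F.W n x := by
  induction k with
  | zero => exact ⟨rfl, rfl⟩
  | succ k ih =>
    have h := (F.stage (n + k)).glue.2.1 x (by have := F.r_anti (show n ≤ n + k by omega); linarith)
    exact ⟨h.1.self_of_nhds.trans ih.1, h.2.self_of_nhds.trans ih.2⟩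

lemma exists_limit (F : Frame) : ∃ v w, F.Limit v w := by
  obtain ⟨v, sv, tv, nv⟩ := GevreyLE.exists_limit (s := F.s) (fun n => (F.stage n).adm.sv) F.η_summable
    fun n x t => (F.increment n x t).1
  obtain ⟨w, sw, tw, nw⟩ := GevreyLE.exists_limit (s := F.s) (fun n => (F.stage n).adm.sw) F.η_summable
    fun n x t => (F.increment n x t).2
  have bound : ∀ {u : ℝ → ℝ} {x : ℝ} {t : ℕ} {U : ℕ → ℝ → ℝ},
      (∀ n, jetNorm F.s t (jet (U n) x) ≤ F.e₀) →
      (∀ n, jetNorm F.s t (jet u x - jet (U n) x) ≤ F.rem n) → jetNorm F.s t (jet u x) ≤ F.e₀ := by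
    intro u x t U h1 h2
    have h3 : ∀ n, jetNorm F.s t (jet u x) ≤ F.rem n + F.e₀ := by
      intro n
      have := jetNorm_add (s := F.s) (t := t) (jet u x - jet (U n) x) (jet (U n) x)
      rw [sub_add_cancel] at this
      linarith [h1 n, h2 n]
    have h4 := F.rem_tendsto.add_const F.e₀
    rw [zero_add] at h4
    exact ge_of_tendsto' h4 h3
  have adm : F.Adm v w := ⟨sv, sw, fun x t => bound (fun n => (F.stage n).adm.nv x t) fun n => nv n x t,
    fun x t => bound (fun n => (F.stage n).adm.nw x t) fun n => nw n x t⟩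
  have agree : ∀ n, Agree (F.V n) (F.W n) v w (F.r n) := by
    intro n x hx
    have hx' : F.r n / 2 < dep x := by have := F.r_pos n; linarith
    have hev : ∀ᶠ y in 𝓝 x, F.r n / 2 < dep y :=
      (isOpen_lt continuous_const continuous_dep).mem_nhds hx'
    constructor
    · filter_upwards [hev] with y hy
      refine tendsto_nhds_unique (tendsto_const_nhds.congr fun k => ?_)
        ((Filter.tendsto_add_atTop_iff_nat n).2 (tv y))
      rw [add_comm k n]; exact (stationary hy k).1.symm
    · filter_upwards [hev] with y hy
      refine tendsto_nhds_unique (tendsto_const_nhds.congr fun k => ?_)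
        ((Filter.tendsto_add_atTop_iff_nat n).2 (tw y))
      rw [add_comm k n]; exact (stationary hy k).2.symm
  refine ⟨v, w, adm, ⟨fun x => ?_, fun x => ?_⟩, fun n x t => ⟨nv n x t, nw n x t⟩, ?_⟩
  · refine tendsto_nhds_unique (tv _) ((tv x).congr fun n => ?_)
    exact ((F.VW_periodic n).1 x).symm
  · refine tendsto_nhds_unique (tw _) ((tw x).congr fun n => ?_)
    exact ((F.VW_periodic n).2 x).symm
  · intro n x t a l hg hi
    exact (agree n).ok (F.stage n).adm adm (F.r_pos n) _ hi ((F.stage n).ok x t a l hg hi)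

end Frame

/-! ### Operator norms of two by two matrices -/

section MatrixNorm

/-- The Euclidean operator norm of a matrix. -/
noncomputable def matNorm (M : Matrix (Fin 2) (Fin 2) ℝ) : ℝ :=
  ‖Matrix.toEuclideanCLM (n := Fin 2) (𝕜 := ℝ) M‖

lemma matNorm_nonneg (M : Matrix (Fin 2) (Fin 2) ℝ) : 0 ≤ matNorm M := norm_nonneg _

lemma matNorm_mul_le (M N : Matrix (Fin 2) (Fin 2) ℝ) : matNorm (M * N) ≤ matNorm M * matNorm N := by
  unfold matNorm; rw [map_mul]; exact norm_mul_le _ _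

lemma continuous_matNorm : Continuous matNorm := by
  unfold matNorm
  let g : Matrix (Fin 2) (Fin 2) ℝ →ₗ[ℝ] (EuclideanSpace ℝ (Fin 2) →L[ℝ] EuclideanSpace ℝ (Fin 2)) :=
    { toFun := Matrix.toEuclideanCLM (n := Fin 2) (𝕜 := ℝ)
      map_add' := map_add _
      map_smul' := map_smul _ }
  exact (LinearMap.continuous_of_finiteDimensional g).norm

lemma toEuclideanCLM_apply_two (M : Matrix (Fin 2) (Fin 2) ℝ) (v : EuclideanSpace ℝ (Fin 2)) (i : Fin 2) :
    (Matrix.toEuclideanCLM (n := Fin 2) (𝕜 := ℝ) M v) i = M i 0 * v 0 + M i 1 * v 1 := by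
  rw [Matrix.ofLp_toEuclideanCLM, Matrix.mulVec, dotProduct, Fin.sum_univ_two]

lemma matNorm_apply_le (M : Matrix (Fin 2) (Fin 2) ℝ) (j : Fin 2) :
    M 0 j ^ 2 + M 1 j ^ 2 ≤ matNorm M ^ 2 := by
  have h := (Matrix.toEuclideanCLM (n := Fin 2) (𝕜 := ℝ) M).le_opNorm (EuclideanSpace.single j 1)
  rw [PiLp.norm_single, norm_one, mul_one] at h
  have h2 := pow_le_pow_left₀ (norm_nonneg _) h 2
  rw [EuclideanSpace.norm_sq_eq, Fin.sum_univ_two] at h2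
  have e : ∀ i, (Matrix.toEuclideanCLM (n := Fin 2) (𝕜 := ℝ) M (EuclideanSpace.single j 1)) i = M i j := by
    intro i
    rw [toEuclideanCLM_apply_two]
    fin_cases j <;> simp
  rw [e, e, Real.norm_eq_abs, Real.norm_eq_abs, sq_abs, sq_abs] at h2
  exact h2

lemma abs_entry_le (M : Matrix (Fin 2) (Fin 2) ℝ) (i j : Fin 2) : |M i j| ≤ matNorm M := by
  refine abs_le_of_sq_le_sq ?_ (matNorm_nonneg M)
  have := matNorm_apply_le M j
  fin_cases i
  · simp only [Fin.zero_eta]; nlinarith [sq_nonneg (M 1 j)]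
  · simp only [Fin.mk_one]; nlinarith [sq_nonneg (M 0 j)]

/-- Hadamard's inequality: the squared determinant is at most the product of the squared column
lengths, each at most the squared norm. -/
lemma one_le_matNorm {M : Matrix (Fin 2) (Fin 2) ℝ} (h : M.det = 1) : 1 ≤ matNorm M := by
  have h0 := matNorm_apply_le M 0
  have h1 := matNorm_apply_le M 1
  rw [Matrix.det_fin_two] at h
  have h2 : (M 0 0 * M 1 1 - M 0 1 * M 1 0) ^ 2 ≤
      (M 0 0 ^ 2 + M 1 0 ^ 2) * (M 0 1 ^ 2 + M 1 1 ^ 2) := by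
    nlinarith [sq_nonneg (M 0 0 * M 0 1 + M 1 0 * M 1 1)]
  rw [h] at h2
  by_contra! hlt
  have hn := matNorm_nonneg M
  have h3 : matNorm M ^ 2 < 1 := by nlinarith
  have h4 : (M 0 0 ^ 2 + M 1 0 ^ 2) * (M 0 1 ^ 2 + M 1 1 ^ 2) ≤ matNorm M ^ 2 * matNorm M ^ 2 :=
    mul_le_mul h0 h1 (by positivity) (by positivity)
  nlinarith

lemma matNorm_le_sum (M : Matrix (Fin 2) (Fin 2) ℝ) {a : ℝ} (ha : ∀ i j, |M i j| ≤ a) :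
    matNorm M ≤ 4 * a := by
  have ha0 : 0 ≤ a := (abs_nonneg _).trans (ha 0 0)
  refine ContinuousLinearMap.opNorm_le_bound _ (by positivity) fun v => ?_
  have hv : ∀ i, |v i| ≤ ‖v‖ := fun i => PiLp.norm_apply_le v i
  have hb : ∀ i, |(Matrix.toEuclideanCLM (n := Fin 2) (𝕜 := ℝ) M v) i| ≤ 2 * a * ‖v‖ := by
    intro i
    rw [toEuclideanCLM_apply_two]
    refine (abs_add_le _ _).trans ?_
    rw [abs_mul, abs_mul]
    have h1 := mul_le_mul (ha i 0) (hv 0) (abs_nonneg _) ha0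
    have h2 := mul_le_mul (ha i 1) (hv 1) (abs_nonneg _) ha0
    linarith
  have h2 : ‖Matrix.toEuclideanCLM (n := Fin 2) (𝕜 := ℝ) M v‖ ^ 2 ≤ (4 * a * ‖v‖) ^ 2 := by
    rw [EuclideanSpace.norm_sq_eq, Fin.sum_univ_two, Real.norm_eq_abs, Real.norm_eq_abs]
    have h3 := pow_le_pow_left₀ (abs_nonneg _) (hb 0) 2
    have h4 := pow_le_pow_left₀ (abs_nonneg _) (hb 1) 2
    nlinarith [sq_nonneg (a * ‖v‖)]
  exact abs_le_of_sq_le_sq' h2 (by positivity) |>.2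

lemma opNorm_eq (B : SL2) : opNorm B = matNorm B := rfl

end MatrixNorm

/-! ### Gevrey cocycles built from rotations -/

section Cocycle

/-- The polynomial weight in the Gevrey norm is absorbed by K^k with K = 4, which is why all
cocycles live in this one step of the inductive limit. -/
lemma succ_sq_le_four_pow (k : ℕ) : (1 + (k : ℝ)) ^ 2 ≤ 4 ^ k := by
  have h : (1 + (k : ℝ)) ≤ 2 ^ k := by
    have := one_add_mul_le_pow (show (-2 : ℝ) ≤ 1 by norm_num) k
    rw [mul_one] at this
    exact this.trans (by norm_num)
  calc (1 + (k : ℝ)) ^ 2 ≤ (2 ^ k) ^ 2 := pow_le_pow_left₀ (by positivity) h 2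
    _ = 4 ^ k := by rw [← pow_mul, mul_comm, pow_mul]; norm_num

/-- A uniform bound of the jet norms bounds the Gevrey norm. -/
lemma gevreyNorm_le {s B : ℝ} {g : ℝ → ℝ} (hb : ∀ x t, jetNorm s t (jet g x) ≤ B) :
    gevreyNorm s 4 g ≤ ENNReal.ofReal (4 * Real.pi ^ 2 / 3) * ENNReal.ofReal B := by
  unfold gevreyNorm
  refine mul_le_mul_right (iSup_le fun k => ?_) _
  rw [ENNReal.mul_iSup]
  refine iSup_le fun x => ?_
  rw [Real.enorm_eq_ofReal_abs, ← ENNReal.ofReal_mul (by positivity)]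
  refine ENNReal.ofReal_le_ofReal ?_
  have h1 := abs_iteratedDeriv_le_jetNorm s k g x
  have h2 := hb x k
  have h3 := succ_sq_le_four_pow k
  have hk : 0 < ((k ! : ℕ) : ℝ) ^ s := Real.rpow_pos_of_pos (by positivity) _
  have hB : 0 ≤ B := (jetNorm_nonneg _).trans h2
  rw [div_mul_eq_mul_div, div_le_iff₀ (by positivity)]
  calc (1 + (k : ℝ)) ^ 2 * |iteratedDeriv k g x| ≤ 4 ^ k * (((k ! : ℕ) : ℝ) ^ s * B) := by
        gcongr
        exact h1.trans (mul_le_mul_of_nonneg_left h2 hk.le)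
    _ = _ := by ring

lemma matGevreyNorm_le {s B : ℝ} {G : ℝ → Matrix (Fin 2) (Fin 2) ℝ}
    (hb : ∀ i j x t, jetNorm s t (jet (fun x => G x i j) x) ≤ B) :
    matGevreyNorm s 4 G ≤ ENNReal.ofReal (4 * Real.pi ^ 2 / 3) * ENNReal.ofReal B :=
  iSup_le fun i => iSup_le fun j => gevreyNorm_le (hb i j)

/-- Rotations in a Gevrey class. -/
structure RotFun (s : ℝ) (co si : ℝ → ℝ) : Prop where
  smooth : ContDiff ℝ ∞ co ∧ ContDiff ℝ ∞ si
  periodic : Function.Periodic co (2 * Real.pi) ∧ Function.Periodic si (2 * Real.pi)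
  unit : ∀ x, co x * co x + si x * si x = 1
  bound : ∃ B, ∀ x t, jetNorm s t (jet co x) ≤ B ∧ jetNorm s t (jet si x) ≤ B

variable {s l : ℝ} {co si : ℝ → ℝ}

lemma diag_mul_rot (l c σ : ℝ) : (!![l, 0; 0, l⁻¹] : Matrix (Fin 2) (Fin 2) ℝ) * rot c σ =
    !![l * c, l * (-σ); l⁻¹ * σ, l⁻¹ * c] := by
  ext i j; fin_cases i <;> fin_cases j <;> simp [rot, Matrix.mul_apply, Fin.sum_univ_two]

lemma jet_const_mul {g : ℝ → ℝ} {x : ℝ} (hg : ContDiffAt ℝ ∞ g x) (a : ℝ) :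
    jet (fun y => a * g y) x = PowerSeries.C a * jet g x := by
  rw [jet_mul contDiffAt_const hg, jet_const]

lemma jetNorm_const_mul_le (hs : 1 ≤ s) {g : ℝ → ℝ} {x a e : ℝ} {t : ℕ} (hg : ContDiffAt ℝ ∞ g x)
    (ha : |a| ≤ l) (hb : jetNorm s t (jet g x) ≤ e) :
    jetNorm s t (jet (fun y => a * g y) x) ≤ l * e := by
  rw [jet_const_mul hg]
  exact jetNorm_mul_le hs (by rwa [jetNorm_C]) hb

/-- Entries of `diag(l, l⁻¹) (c, -σ; σ, c)`. -/
lemma jetNorm_entry_le (hs : 1 ≤ s) (hl : 1 ≤ l) (hc : ContDiff ℝ ∞ co) (hsi : ContDiff ℝ ∞ si)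
    {B : ℝ} (hb : ∀ x t, jetNorm s t (jet co x) ≤ B ∧ jetNorm s t (jet si x) ≤ B) (i j : Fin 2) :
    ContDiff ℝ ∞ (fun x => (!![l * co x, l * (-si x); l⁻¹ * si x, l⁻¹ * co x] :
      Matrix (Fin 2) (Fin 2) ℝ) i j) ∧
    ∀ x t, jetNorm s t (jet (fun x => (!![l * co x, l * (-si x); l⁻¹ * si x, l⁻¹ * co x] :
      Matrix (Fin 2) (Fin 2) ℝ) i j) x) ≤ l * B := by
  have h1 : |l| ≤ l := by rw [abs_of_pos (by linarith)]
  have h2 : |l⁻¹| ≤ l := by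
    rw [abs_of_pos (by positivity)]
    exact (inv_le_one_of_one_le₀ hl).trans hl
  have hn : ∀ x t, jetNorm s t (jet (fun y => -si y) x) ≤ B := fun x t => by
    rw [jet_neg, jetNorm_neg]; exact (hb x t).2
  fin_cases i <;> fin_cases j
  · exact ⟨contDiff_const.mul hc, fun x t => jetNorm_const_mul_le hs hc.contDiffAt h1 (hb x t).1⟩
  · exact ⟨contDiff_const.mul hsi.neg, fun x t => jetNorm_const_mul_le hs hsi.neg.contDiffAt h1 (hn x t)⟩
  · exact ⟨contDiff_const.mul hsi, fun x t => jetNorm_const_mul_le hs hsi.contDiffAt h2 (hb x t).2⟩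
  · exact ⟨contDiff_const.mul hc, fun x t => jetNorm_const_mul_le hs hc.contDiffAt h2 (hb x t).1⟩

/-- The cocycle `diag(l, l⁻¹) R` of a Gevrey rotation. -/
noncomputable def RotFun.cocycle (h : RotFun s co si) (hs : 1 ≤ s) (hl : 1 ≤ l) : GevreyCocycle s where
  toFun x := ⟨!![l, 0; 0, l⁻¹] * rot (co x) (si x), by
    rw [Matrix.det_mul, rot, Matrix.det_fin_two_of, Matrix.det_fin_two_of]
    have h1 : l * l⁻¹ = 1 := mul_inv_cancel₀ (by linarith)
    linear_combination (co x * co x + si x * si x) * h1 + h.unit x⟩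
  periodic' x := by
    apply Subtype.ext
    simp only [h.periodic.1 x, h.periodic.2 x]
  smooth' i j := by
    obtain ⟨B, hB⟩ := h.bound
    simp only [diag_mul_rot]
    exact (jetNorm_entry_le hs hl h.smooth.1 h.smooth.2 hB i j).1
  gevrey' := by
    obtain ⟨B, hB⟩ := h.bound
    refine ⟨4, by norm_num, ?_⟩
    simp only [diag_mul_rot]
    exact (matGevreyNorm_le fun i j =>
      (jetNorm_entry_le hs hl h.smooth.1 h.smooth.2 hB i j).2).trans_lt
        (ENNReal.mul_lt_top ENNReal.ofReal_lt_top ENNReal.ofReal_lt_top)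

lemma RotFun.coe_cocycle (h : RotFun s co si) (hs : 1 ≤ s) (hl : 1 ≤ l) (x : ℝ) :
    ((h.cocycle hs hl).toFun x : Matrix (Fin 2) (Fin 2) ℝ) = !![l, 0; 0, l⁻¹] * rot (co x) (si x) := rfl

lemma RotFun.inStep (h : RotFun s co si) (hs : 1 ≤ s) (hl : 1 ≤ l) : (h.cocycle hs hl).InStep 4 := by
  obtain ⟨B, hB⟩ := h.bound
  unfold GevreyCocycle.InStep
  simp only [h.coe_cocycle, diag_mul_rot]
  exact (matGevreyNorm_le fun i j =>
    (jetNorm_entry_le hs hl h.smooth.1 h.smooth.2 hB i j).2).trans_lt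
      (ENNReal.mul_lt_top ENNReal.ofReal_lt_top ENNReal.ofReal_lt_top)

lemma RotFun.hasDiagRotForm (h : RotFun s co si) (hs : 1 ≤ s) (hl : 1 ≤ l) :
    HasDiagRotForm l (h.cocycle hs hl) := by
  intro x
  have hu := h.unit x
  -- The angle, absent from the rational parametrization, is recovered as an argument.
  set z : ℂ := ⟨co x, si x⟩ with hz
  have hn : ‖z‖ = 1 := by
    have : ‖z‖ ^ 2 = 1 := by rw [← Complex.normSq_eq_norm_sq, Complex.normSq_apply]; exact hu
    have h0 := norm_nonneg z
    nlinarith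
  refine ⟨z.arg, ?_⟩
  have h1 := Complex.norm_mul_cos_arg z
  have h2 := Complex.norm_mul_sin_arg z
  rw [hn, one_mul] at h1 h2
  rw [h.coe_cocycle, h1, h2]
  rfl

lemma RotFun.dist_le (h : RotFun s co si) {co' si' : ℝ → ℝ} (h' : RotFun s co' si') (hs : 1 ≤ s)
    (hl : 1 ≤ l) {e : ℝ} (he : ∀ x t, jetNorm s t (jet co x - jet co' x) ≤ e ∧
      jetNorm s t (jet si x - jet si' x) ≤ e) :
    gevreyDist 4 (h.cocycle hs hl) (h'.cocycle hs hl) ≤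
      ENNReal.ofReal (4 * Real.pi ^ 2 / 3) * ENNReal.ofReal (l * e) := by
  refine matGevreyNorm_le fun i j => ?_
  have hd : ∀ x t, jetNorm s t (jet (fun y => co y - co' y) x) ≤ e ∧
      jetNorm s t (jet (fun y => si y - si' y) x) ≤ e := by
    intro x t
    rw [jet_sub h.smooth.1.contDiffAt h'.smooth.1.contDiffAt,
      jet_sub h.smooth.2.contDiffAt h'.smooth.2.contDiffAt]
    exact he x t
  have key := (jetNorm_entry_le hs hl (h.smooth.1.sub h'.smooth.1) (h.smooth.2.sub h'.smooth.2) hd i j).2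
  convert key using 5
  funext y
  rw [Matrix.sub_apply, h.coe_cocycle, h'.coe_cocycle, diag_mul_rot, diag_mul_rot]
  fin_cases i <;> fin_cases j <;> simp <;> ring

/-- Iterates as segment products. -/
lemma RotFun.iterate_mul_diag (h : RotFun s co si) (hs : 1 ≤ s) (hl : 1 ≤ l) (α x : ℝ) (a : ℤ) (n : ℕ) :
    (iterate α (h.cocycle hs hl).toFun n (x + a * (2 * Real.pi * α)) : Matrix (Fin 2) (Fin 2) ℝ) *
      !![l, 0; 0, l⁻¹] = orbitSeg l (2 * Real.pi * α) co si a n x := by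
  induction n with
  | zero => simp [iterate, orbitSeg, seg]
  | succ n ih =>
    have e : x + a * (2 * Real.pi * α) + n * (2 * Real.pi * α) =
        x + ((a + n : ℤ) : ℝ) * (2 * Real.pi * α) := by push_cast; ring
    rw [iterate, Matrix.SpecialLinearGroup.coe_mul, h.coe_cocycle, Matrix.mul_assoc, ih, e]
    rfl

lemma iterate_add (α : ℝ) (A : ℝ → SL2) (m n : ℕ) (x : ℝ) :
    iterate α A (m + n) x = iterate α A n (x + m * (2 * Real.pi * α)) * iterate α A m x := by
  induction n with
  | zero => simp [iterate]
  | succ n ih =>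
    have e : x + ((m + n : ℕ) : ℝ) * (2 * Real.pi * α) =
        x + m * (2 * Real.pi * α) + n * (2 * Real.pi * α) := by push_cast; ring
    rw [← add_assoc, iterate, ih, iterate, e]
    exact (mul_assoc _ _ _).symm

end Cocycle

/-! ### Lyapunov exponents and visiting times -/

section Lyapunov

open MeasureTheory

variable {s : ℝ} (α : ℝ) (A : GevreyCocycle s)

lemma continuous_iterate (n : ℕ) :
    Continuous fun x => (iterate α A.toFun n x : Matrix (Fin 2) (Fin 2) ℝ) := by
  have h : Continuous fun x => (A.toFun x : Matrix (Fin 2) (Fin 2) ℝ) :=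
    continuous_matrix fun i j => (A.smooth' i j).continuous
  induction n with
  | zero => exact continuous_const
  | succ n ih =>
    have e : (fun x => (iterate α A.toFun (n + 1) x : Matrix (Fin 2) (Fin 2) ℝ)) = fun x =>
        (A.toFun (x + n * (2 * Real.pi * α)) : Matrix (Fin 2) (Fin 2) ℝ) *
          (iterate α A.toFun n x : Matrix (Fin 2) (Fin 2) ℝ) := by
      funext x; rw [iterate, Matrix.SpecialLinearGroup.coe_mul]
    rw [e]
    exact (h.comp (continuous_id.add continuous_const)).matrix_mul ih

lemma one_le_opNorm (B : SL2) : 1 ≤ opNorm B := one_le_matNorm B.2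

lemma log_opNorm_nonneg (B : SL2) : 0 ≤ Real.log (opNorm B) := Real.log_nonneg (one_le_opNorm B)

lemma log_opNorm_mul_le (B B' : SL2) :
    Real.log (opNorm (B * B')) ≤ Real.log (opNorm B) + Real.log (opNorm B') := by
  have h1 := one_le_opNorm B
  have h2 := one_le_opNorm B'
  have h3 := one_le_opNorm (B * B')
  rw [← Real.log_mul (by linarith) (by linarith)]
  refine Real.log_le_log (by linarith) ?_
  rw [opNorm_eq, Matrix.SpecialLinearGroup.coe_mul]
  exact matNorm_mul_le _ _

lemma continuous_log_opNorm (n : ℕ) :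
    Continuous fun x => Real.log (opNorm (iterate α A.toFun n x)) :=
  (continuous_matNorm.comp (continuous_iterate α A n)).log fun _ =>
    (zero_lt_one.trans_le (one_le_opNorm _)).ne'

variable {α A}

lemma le_lyapunov {c : ℝ} (h : ∀ n : ℕ, c * ((n + 1) * (2 * Real.pi)) ≤
    ∫ x in (0 : ℝ)..(2 * Real.pi), Real.log (opNorm (iterate α A.toFun (n + 1) x))) :
    c ≤ lyapunov α A := by
  refine le_ciInf fun n => ?_
  have hn : (0 : ℝ) < n + 1 := by positivity
  have hp := Real.pi_pos
  rw [one_div_mul_eq_div, one_div_mul_eq_div, div_div, le_div_iff₀ (by positivity)]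
  linarith [h n]

lemma lyapunov_le {c : ℝ} (n : ℕ) (h : ∫ x in (0 : ℝ)..(2 * Real.pi),
    Real.log (opNorm (iterate α A.toFun (n + 1) x)) ≤ c * ((n + 1) * (2 * Real.pi))) :
    lyapunov α A ≤ c := by
  have hp := Real.pi_pos
  refine (ciInf_le ⟨0, ?_⟩ n).trans ?_
  · rintro _ ⟨m, rfl⟩
    have := intervalIntegral.integral_nonneg (μ := volume) (by positivity : (0 : ℝ) ≤ 2 * Real.pi)
      fun x _ => log_opNorm_nonneg (iterate α A.toFun (m + 1) x)
    positivity
  · have hn : (0 : ℝ) < n + 1 := by positivity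
    rw [one_div_mul_eq_div, one_div_mul_eq_div, div_div, div_le_iff₀ (by positivity)]
    linarith

/-- The indicator function of the visits at distance at most `ρ`. -/
noncomputable def visit (ρ : ℝ) : ℝ → ℝ := Set.indicator {x | dep x ≤ ρ} fun _ => 1

lemma visit_of_le {ρ x : ℝ} (h : dep x ≤ ρ) : visit ρ x = 1 := Set.indicator_of_mem (by exact h) _

lemma visit_of_lt {ρ x : ℝ} (h : ρ < dep x) : visit ρ x = 0 :=
  Set.indicator_of_notMem (by simpa using h) _

lemma visit_nonneg (ρ x : ℝ) : 0 ≤ visit ρ x := Set.indicator_nonneg (fun _ _ => zero_le_one) x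

lemma measurableSet_visit (ρ : ℝ) : MeasurableSet {x | dep x ≤ ρ} :=
  (isClosed_le continuous_dep continuous_const).measurableSet

lemma visit_intervalIntegrable (ρ a b c : ℝ) :
    IntervalIntegrable (fun x => visit ρ (x + c)) volume a b := by
  have h : IntervalIntegrable (visit ρ) volume (a + c) (b + c) :=
    ⟨(integrable_const 1).indicator (measurableSet_visit ρ),
      (integrable_const 1).indicator (measurableSet_visit ρ)⟩
  simpa using h.comp_add_right c

/-- By periodicity the shift disappears and the period is centred at the critical point, where the
set of visits is squeezed between two intervals. -/
lemma integral_visit (ρ c : ℝ) : ∫ x in (0 : ℝ)..(2 * Real.pi), visit ρ (x + c) =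
    volume.real ({x | dep x ≤ ρ} ∩ Set.Ioc (-Real.pi) Real.pi) := by
  have hper : Function.Periodic (visit ρ) (2 * Real.pi) := by
    intro x
    simp only [visit, Set.indicator, Set.mem_ofPred_eq, dep_add_two_pi]
  have hp := Real.pi_pos
  rw [intervalIntegral.integral_comp_add_right (visit ρ), zero_add, add_comm,
    hper.intervalIntegral_add_eq c (-Real.pi), intervalIntegral.integral_of_le (by linarith)]
  have e : -Real.pi + 2 * Real.pi = Real.pi := by ring
  rw [e]
  unfold visit
  rw [integral_indicator_const _ (measurableSet_visit ρ), smul_eq_mul, mul_one,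
    measureReal_restrict_apply (measurableSet_visit ρ)]

lemma integral_visit_le {ρ : ℝ} (hρ : 0 ≤ ρ) (c : ℝ) :
    ∫ x in (0 : ℝ)..(2 * Real.pi), visit ρ (x + c) ≤ 2 * Real.pi * ρ := by
  have hp := Real.pi_pos
  rw [integral_visit]
  have h : {x | dep x ≤ ρ} ∩ Set.Ioc (-Real.pi) Real.pi ⊆ Set.Icc (-(Real.pi * ρ)) (Real.pi * ρ) := by
    rintro x ⟨h1, h2, h3⟩
    have h4 := (abs_div_pi_le_dep (abs_le.2 ⟨h2.le, h3⟩)).trans h1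
    rw [div_le_iff₀ hp, mul_comm] at h4
    exact abs_le.1 h4
  refine (measureReal_mono h (by simp)).trans ?_
  rw [Real.volume_real_Icc_of_le (by nlinarith)]
  linarith

lemma le_integral_visit {ρ : ℝ} (hρ : 0 ≤ ρ) (hρ1 : ρ ≤ 1) (c : ℝ) :
    4 * ρ ≤ ∫ x in (0 : ℝ)..(2 * Real.pi), visit ρ (x + c) := by
  have hp := Real.pi_gt_three
  rw [integral_visit]
  have h : Set.Icc (-(2 * ρ)) (2 * ρ) ⊆ {x | dep x ≤ ρ} ∩ Set.Ioc (-Real.pi) Real.pi := by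
    rintro x ⟨h1, h2⟩
    have h3 := dep_le_half_abs x
    have h4 := abs_le.2 ⟨h1, h2⟩
    exact ⟨by simp only [Set.mem_ofPred_eq]; linarith, by linarith, by linarith⟩
  have h2 := measureReal_mono (μ := volume) h
    ((measure_mono Set.inter_subset_right).trans_lt (by simp)).ne
  rw [Real.volume_real_Icc_of_le (by linarith)] at h2
  linarith

end Lyapunov

/-! ### Lower bound for the limit cocycle -/

namespace Frame

variable {F : Frame} {v w : ℝ → ℝ}

/-- The estimates for the products of real matrices. -/
lemma AllOK.real {h : F.Adm v w} {ρ : ℝ} {hρ : 0 < ρ} (hOK : AllOK h hρ) {x : ℝ} {a : ℤ} {n : ℕ}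
    (hg : Good (fun m : ℤ => F.tau (x + m * F.γ)) F.K.τ₀ F.K.β a n)
    (hi : InSet {m : ℤ | ρ ≤ dep (x + m * F.γ)} a n) :
    ∃ p q v' w', LDU (orbitSeg F.K.lam F.γ (F.co v w) (F.si v w) a n x) p q v' w' ∧
      |q| ≤ F.K.lam⁻¹ ^ (n + 1) * Real.exp (F.K.Φ n) ∧ |v'| ≤ 1 / 4 ∧ |w'| ≤ 1 / 4 ∧
      v' = realSlope (orbitSeg F.K.lam F.γ (F.co v w) (F.si v w) a n x) ∧
      w' = realCoslope (orbitSeg F.K.lam F.γ (F.co v w) (F.si v w) a n x) := by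
  obtain ⟨p, q, v', w', h1, h2, h3, h4⟩ := (hOK x 0 a n hg hi).1
  have he : ∀ i j, PowerSeries.constantCoeff ((data h hρ x 0).mat a n i j) =
      orbitSeg F.K.lam F.γ (F.co v w) (F.si v w) a n x i j := by
    intro i j
    rw [← jetMat_eq_mat]
    simp [jetMat, constantCoeff_jet]
  have h5 := SegData.quarter_geomSum_le (K := F.K) n
  have h6 := SegData.inv_lam_le (K := F.K)
  have hL : LDU (orbitSeg F.K.lam F.γ (F.co v w) (F.si v w) a n x) (PowerSeries.constantCoeff p)
      (PowerSeries.constantCoeff q) (PowerSeries.constantCoeff v') (PowerSeries.constantCoeff w') := by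
    refine ⟨?_, ?_, ?_, ?_, ?_⟩
    · rw [← he, h1.h00]
    · rw [← he, h1.h01, map_mul]
    · rw [← he, h1.h10, map_mul]
    · rw [← he, h1.h11, map_add, map_mul, map_mul]
    · rw [← map_mul, h1.hpq, map_one]
  have hp0 : PowerSeries.constantCoeff p ≠ 0 := left_ne_zero_of_mul_eq_one hL.hpq
  refine ⟨_, _, _, _, hL, (abs_coeff_zero_le q).trans h2, (abs_coeff_zero_le v').trans (h3.trans (by linarith)),
    (abs_coeff_zero_le w').trans (h4.trans (by linarith)), ?_, ?_⟩
  · rw [realSlope, hL.h10, hL.h00]; field_simp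
  · rw [realCoslope, hL.h01, hL.h00]; field_simp

/-- The rotations of admissible slope functions. -/
lemma Adm.rotFun (h : F.Adm v w) (hv : Function.Periodic v (2 * Real.pi))
    (hw : Function.Periodic w (2 * Real.pi)) : RotFun F.s (F.co v w) (F.si v w) :=
  ⟨h.smooth, co_periodic hv hw, fun _ => rot_unit _ _ _,
    40, fun x t => ⟨(h.bounds x t).1, (h.bounds x t).2.1⟩⟩

lemma one_le_lam (F : Frame) : 1 ≤ F.K.lam := by linarith [F.K.two_le_lam]

lemma exists_r_lt (F : Frame) {ρ : ℝ} (hρ : 0 < ρ) : ∃ n, F.r n < ρ := by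
  have h : ∀ n, F.r n = F.r 0 * (1 / 16) ^ n := by
    intro n
    induction n with
    | zero => simp
    | succ n ih => rw [F.r_succ, ih]; ring
  obtain ⟨n, hn⟩ := exists_pow_lt_of_lt_one (div_pos hρ (F.r_pos 0)) (by norm_num : (1 / 16 : ℝ) < 1)
  refine ⟨n, ?_⟩
  rw [h]
  rw [lt_div_iff₀ (F.r_pos 0)] at hn
  linarith

/-- Growth of the products along good segments of the limit cocycle. -/
lemma Limit.le_log_opNorm {α : ℝ} (hα : F.γ = 2 * Real.pi * α) (h : F.Limit v w) {x : ℝ} {n : ℕ}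
    (hg : Good (fun m : ℤ => F.tau (x + m * F.γ)) F.K.τ₀ F.K.β 0 n)
    (hi : ∀ i < n, 0 < dep (x + (i : ℕ) * F.γ)) :
    n * (Real.log F.K.lam - F.C₂) ≤ Real.log (opNorm (iterate α
      ((h.adm.rotFun h.periodic.1 h.periodic.2).cocycle F.one_le_s F.one_le_lam).toFun n x)) := by
  -- Finitely many points avoiding the critical point stay outside some ball; the estimate of that
  -- scale applies, and its constants do not depend on the scale.
  obtain ⟨ρ, hρ, hρi⟩ : ∃ ρ, 0 < ρ ∧ ∀ i < n, ρ ≤ dep (x + (i : ℕ) * F.γ) := by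
    rcases Nat.eq_zero_or_pos n with rfl | hn
    · exact ⟨1, one_pos, fun i hi => absurd hi (by omega)⟩
    · obtain ⟨i, hi', hm⟩ := Finset.exists_min_image (Finset.range n)
        (fun i : ℕ => dep (x + (i : ℕ) * F.γ)) ⟨0, Finset.mem_range.2 hn⟩
      exact ⟨_, hi i (Finset.mem_range.1 hi'), fun j hj => hm j (Finset.mem_range.2 hj)⟩
  obtain ⟨m, hm⟩ := F.exists_r_lt hρ
  obtain ⟨p, q, v', w', h1, h2, -⟩ := (h.ok m).real (x := x) (a := 0) (n := n) hg
    (fun i hi' => by simpa using hm.le.trans (hρi i hi'))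
  have hl := SegData.lam_pos (K := F.K)
  have key := (h.adm.rotFun h.periodic.1 h.periodic.2).iterate_mul_diag F.one_le_s F.one_le_lam α x 0 n
  rw [← hα, Int.cast_zero, zero_mul, add_zero] at key
  have k00 := congrFun (congrFun key 0) 0
  rw [h1.h00, Matrix.mul_apply, Fin.sum_univ_two] at k00
  simp only [Matrix.of_apply, Matrix.cons_val', Matrix.cons_val_zero, Matrix.cons_val_one,
    Matrix.cons_val_fin_one, mul_zero, add_zero] at k00
  set Y := iterate α ((h.adm.rotFun h.periodic.1 h.periodic.2).cocycle F.one_le_s F.one_le_lam).toFun n x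
    with hY
  have hY0 := abs_entry_le (Y : Matrix (Fin 2) (Fin 2) ℝ) 0 0
  have hpq : |p| * |q| = 1 := by rw [← abs_mul, h1.hpq, abs_one]
  have hp : |p| = |(Y : Matrix (Fin 2) (Fin 2) ℝ) 0 0| * F.K.lam := by
    rw [← k00, abs_mul, abs_of_pos hl]
  have h5 : 1 ≤ matNorm Y * (F.K.lam⁻¹ ^ n * Real.exp (F.K.Φ n)) := by
    calc (1 : ℝ) = |p| * |q| := hpq.symm
      _ ≤ (matNorm Y * F.K.lam) * (F.K.lam⁻¹ ^ (n + 1) * Real.exp (F.K.Φ n)) := by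
          rw [hp]
          have := matNorm_nonneg (Y : Matrix (Fin 2) (Fin 2) ℝ)
          gcongr
      _ = matNorm Y * (F.K.lam⁻¹ ^ n * Real.exp (F.K.Φ n)) * (F.K.lam * F.K.lam⁻¹) := by ring
      _ = _ := by rw [mul_inv_cancel₀ hl.ne', mul_one]
  have h6 : F.K.lam ^ n * Real.exp (-F.K.Φ n) ≤ opNorm Y := by
    rw [opNorm_eq]
    have h7 := mul_le_mul_of_nonneg_right h5
      (show 0 ≤ F.K.lam ^ n * Real.exp (-F.K.Φ n) by positivity)
    rw [one_mul] at h7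
    refine h7.trans (le_of_eq ?_)
    have h8 : F.K.lam⁻¹ ^ n * F.K.lam ^ n = 1 := by
      rw [← mul_pow, inv_mul_cancel₀ hl.ne', one_pow]
    have h9 : Real.exp (F.K.Φ n) * Real.exp (-F.K.Φ n) = 1 := by rw [← Real.exp_add]; simp
    calc matNorm Y * (F.K.lam⁻¹ ^ n * Real.exp (F.K.Φ n)) * (F.K.lam ^ n * Real.exp (-F.K.Φ n))
        = matNorm Y * (F.K.lam⁻¹ ^ n * F.K.lam ^ n) * (Real.exp (F.K.Φ n) * Real.exp (-F.K.Φ n)) := by ring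
      _ = _ := by rw [h8, h9, mul_one, mul_one]
  have h10 := Real.log_le_log (by positivity) h6
  rw [Real.log_mul (by positivity) (by positivity), Real.log_pow, Real.log_exp] at h10
  have := F.Φ_le n
  linarith

/-- Lower bound of the Lyapunov exponent of the limit cocycle. -/
lemma Limit.le_lyapunov {α : ℝ} (hα : F.γ = 2 * Real.pi * α) (h : F.Limit v w)
    (hlam : F.C₂ ≤ Real.log F.K.lam) {B : ℕ → ℝ} (hB0 : ∀ i, 0 ≤ B i)
    (hB : ∀ i y, B i < dep y → F.tau y ≤ F.K.τ₀ ∨ F.tau y ≤ (i : ℝ) ^ F.K.β) {E : ℝ}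
    (hE : ∀ n, ∑ i ∈ Finset.range n, B i ≤ E) :
    (Real.log F.K.lam - F.C₂) * (1 - 2 * E) ≤ lyapunov α
      ((h.adm.rotFun h.periodic.1 h.periodic.2).cocycle F.one_le_s F.one_le_lam) := by
  refine GevreyLE.le_lyapunov fun n => ?_
  set A := (h.adm.rotFun h.periodic.1 h.periodic.2).cocycle F.one_le_s F.one_le_lam with hA
  have hp := Real.pi_pos
  have hd : 0 ≤ Real.log F.K.lam - F.C₂ := by linarith
  -- Counts the visits that spoil goodness: at index i within B_i, measured from either end. If
  -- there is none the segment is good and growth is known; if there is at least one, the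
  -- nonnegativity of the logarithm suffices.
  set g : ℝ → ℝ := fun x => ∑ i ∈ Finset.range (n + 1),
    (visit (B i) (x + i * F.γ) + visit (B i) (x + (n - i : ℝ) * F.γ)) with hgdef
  have hgnn : ∀ i x, 0 ≤ visit (B i) (x + i * F.γ) + visit (B i) (x + (n - i : ℝ) * F.γ) :=
    fun i x => add_nonneg (visit_nonneg _ _) (visit_nonneg _ _)
  have hgi : IntervalIntegrable g MeasureTheory.volume 0 (2 * Real.pi) := by
    have := IntervalIntegrable.sum (μ := MeasureTheory.volume) (a := 0) (b := 2 * Real.pi)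
      (Finset.range (n + 1))
      (f := fun (i : ℕ) x => visit (B i) (x + i * F.γ) + visit (B i) (x + (n - i : ℝ) * F.γ))
      fun i _ => (visit_intervalIntegrable _ _ _ _).add (visit_intervalIntegrable _ _ _ _)
    have e : g = ∑ i ∈ Finset.range (n + 1),
        fun x => visit (B i) (x + i * F.γ) + visit (B i) (x + (n - i : ℝ) * F.γ) := by
      funext x; rw [Finset.sum_apply]
    rw [e]; exact this
  have hgI : ∫ x in (0 : ℝ)..(2 * Real.pi), g x ≤ 4 * Real.pi * E := by
    simp only [hgdef]
    rw [intervalIntegral.integral_finsetSum fun i _ =>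
      (visit_intervalIntegrable _ _ _ _).add (visit_intervalIntegrable _ _ _ _)]
    calc _ ≤ ∑ i ∈ Finset.range (n + 1), (4 * Real.pi) * B i := by
          refine Finset.sum_le_sum fun i _ => ?_
          rw [intervalIntegral.integral_add (visit_intervalIntegrable _ _ _ _)
            (visit_intervalIntegrable _ _ _ _)]
          linarith [integral_visit_le (hB0 i) (i * F.γ), integral_visit_le (hB0 i) ((n - i : ℝ) * F.γ)]
      _ ≤ _ := by
          rw [← Finset.mul_sum]
          exact mul_le_mul_of_nonneg_left (hE _) (by positivity)
  have hpt : ∀ x, (n + 1 : ℝ) * (Real.log F.K.lam - F.C₂) * (1 - g x) ≤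
      Real.log (opNorm (iterate α A.toFun (n + 1) x)) := by
    intro x
    by_cases hx : ∀ i < n + 1, B i < dep (x + (i : ℕ) * F.γ) ∧ B i < dep (x + (n - i : ℝ) * F.γ)
    · have hgood : Good (fun m : ℤ => F.tau (x + m * F.γ)) F.K.τ₀ F.K.β 0 (n + 1) := by
        intro i j hij
        have e : (((0 : ℤ) + (i : ℤ) : ℤ) : ℝ) = (i : ℝ) := by simp
        have e' : (n - j : ℝ) = i := by
          have : (n : ℝ) = i + j := by exact_mod_cast (by omega : n = i + j)
          rw [this]; ring
        simp only [e]
        have h1 := hB i _ (hx i (by omega)).1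
        have h2 := hB j _ (hx j (by omega)).2
        rw [e'] at h2
        rcases h1 with h1 | h1
        · exact Or.inl h1
        · exact h2.imp id fun h2 => ⟨h1, h2⟩
      have h1 := h.le_log_opNorm hα hgood fun i hi => (hB0 i).trans_lt (hx i hi).1
      have h2 : 0 ≤ g x := Finset.sum_nonneg fun i _ => hgnn i x
      push_cast at h1
      refine le_trans ?_ h1
      have : 0 ≤ (n + 1 : ℝ) * (Real.log F.K.lam - F.C₂) := by positivity
      nlinarith
    · refine le_trans ?_ (log_opNorm_nonneg _)
      push Not at hx
      obtain ⟨i, hi, hx⟩ := hx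
      have h1 : 1 ≤ g x := by
        refine le_trans ?_ (Finset.single_le_sum (fun i _ => hgnn i x) (Finset.mem_range.2 hi))
        rcases le_or_gt (dep (x + (i : ℕ) * F.γ)) (B i) with h2 | h2
        · rw [visit_of_le h2]; linarith [visit_nonneg (B i) (x + (n - i : ℝ) * F.γ)]
        · rw [visit_of_le (hx h2)]; linarith [visit_nonneg (B i) (x + (i : ℝ) * F.γ)]
      have : 0 ≤ (n + 1 : ℝ) * (Real.log F.K.lam - F.C₂) := by positivity
      nlinarith
  have hmono := intervalIntegral.integral_mono_on (by positivity : (0 : ℝ) ≤ 2 * Real.pi)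
    ((intervalIntegrable_const.sub hgi).const_mul ((n + 1 : ℝ) * (Real.log F.K.lam - F.C₂)))
    ((continuous_log_opNorm α A (n + 1)).intervalIntegrable _ _) fun x _ => hpt x
  refine le_trans ?_ hmono
  rw [intervalIntegral.integral_const_mul, intervalIntegral.integral_sub intervalIntegrable_const hgi,
    intervalIntegral.integral_const, smul_eq_mul, mul_one, sub_zero]
  -- Each ball of radius B_i has measure at most 2π B_i and is counted from both ends, hence the
  -- factor 1 - 2E after division by 2π.
  have h0 : 0 ≤ (n + 1 : ℝ) * (Real.log F.K.lam - F.C₂) := by positivity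
  have h1 := mul_le_mul_of_nonneg_left hgI h0
  nlinarith

end Frame

/-! ### Collapse at a vanishing pivot -/

section Collapse

lemma matNorm_le_of_sq {M : Matrix (Fin 2) (Fin 2) ℝ} {a : ℝ} (ha : 0 ≤ a)
    (h : ∀ x y : ℝ, (M 0 0 * x + M 0 1 * y) ^ 2 + (M 1 0 * x + M 1 1 * y) ^ 2 ≤
      a ^ 2 * (x ^ 2 + y ^ 2)) : matNorm M ≤ a := by
  refine ContinuousLinearMap.opNorm_le_bound _ ha fun v => ?_
  have h2 : ‖Matrix.toEuclideanCLM (n := Fin 2) (𝕜 := ℝ) M v‖ ^ 2 ≤ (a * ‖v‖) ^ 2 := by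
    rw [mul_pow, EuclideanSpace.norm_sq_eq, EuclideanSpace.norm_sq_eq, Fin.sum_univ_two,
      Fin.sum_univ_two, toEuclideanCLM_apply_two, toEuclideanCLM_apply_two]
    simp only [Real.norm_eq_abs, sq_abs]
    exact h _ _
  exact abs_le_of_sq_le_sq' h2 (by positivity) |>.2

lemma matNorm_diag_mul_rot_le {l c σ : ℝ} (hl : 1 ≤ l) (hc : c * c + σ * σ = 1) :
    matNorm (!![l, 0; 0, l⁻¹] * rot c σ) ≤ l := by
  refine matNorm_le_of_sq (by linarith) fun x y => ?_
  rw [diag_mul_rot]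
  simp only [Matrix.of_apply, Matrix.cons_val', Matrix.cons_val_zero, Matrix.cons_val_one,
    Matrix.cons_val_fin_one]
  have h1 : (l⁻¹) ^ 2 ≤ l ^ 2 :=
    pow_le_pow_left₀ (by positivity) ((inv_le_one_of_one_le₀ hl).trans hl) 2
  have e : (l * c * x + l * -σ * y) ^ 2 + (l⁻¹ * σ * x + l⁻¹ * c * y) ^ 2 =
      l ^ 2 * (c * x - σ * y) ^ 2 + (l⁻¹) ^ 2 * (σ * x + c * y) ^ 2 := by ring
  have e2 : x ^ 2 + y ^ 2 = (c * x - σ * y) ^ 2 + (σ * x + c * y) ^ 2 := by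
    linear_combination -(x ^ 2 + y ^ 2) * hc
  rw [e, e2]
  nlinarith [mul_le_mul_of_nonneg_right h1 (sq_nonneg (σ * x + c * y))]

variable {s l : ℝ} {co si : ℝ → ℝ}

lemma RotFun.opNorm_iterate_le (h : RotFun s co si) (hs : 1 ≤ s) (hl : 1 ≤ l) (α x : ℝ) (n : ℕ) :
    opNorm (iterate α (h.cocycle hs hl).toFun n x) ≤ l ^ n := by
  induction n with
  | zero =>
    rw [iterate, opNorm_eq, pow_zero]
    refine matNorm_le_of_sq zero_le_one fun x y => ?_
    simp
  | succ n ih =>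
    rw [iterate, opNorm_eq, Matrix.SpecialLinearGroup.coe_mul, pow_succ']
    exact (matNorm_mul_le _ _).trans (mul_le_mul (matNorm_diag_mul_rot_le hl (h.unit _)) ih
      (matNorm_nonneg _) (by linarith))

lemma matNorm_diag_le (hl : 1 ≤ l) : matNorm !![l, 0; 0, l⁻¹] ≤ l ∧ matNorm !![l⁻¹, 0; 0, l] ≤ l := by
  have h1 : (l⁻¹) ^ 2 ≤ l ^ 2 :=
    pow_le_pow_left₀ (by positivity) ((inv_le_one_of_one_le₀ hl).trans hl) 2
  constructor <;>
  · refine matNorm_le_of_sq (by linarith) fun x y => ?_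
    simp only [Matrix.of_apply, Matrix.cons_val', Matrix.cons_val_zero, Matrix.cons_val_one,
      Matrix.cons_val_fin_one]
    nlinarith [mul_le_mul_of_nonneg_right h1 (sq_nonneg x), mul_le_mul_of_nonneg_right h1 (sq_nonneg y)]

lemma RotFun.abs_orbitSeg_le (h : RotFun s co si) (hs : 1 ≤ s) (hl : 1 ≤ l) (α x : ℝ) (a : ℤ) (n : ℕ)
    (i j : Fin 2) : |orbitSeg l (2 * Real.pi * α) co si a n x i j| ≤ l ^ (n + 1) := by
  refine (abs_entry_le _ i j).trans ?_
  rw [← h.iterate_mul_diag hs hl, pow_succ]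
  exact (matNorm_mul_le _ _).trans (mul_le_mul (h.opNorm_iterate_le hs hl α _ n) (matNorm_diag_le hl).1
    (matNorm_nonneg _) (by positivity))

/-- A rotation taking the expanded direction of one product to the contracted one of the next
destroys the growth. -/
lemma matNorm_collapse_le {M₁ M₂ : Matrix (Fin 2) (Fin 2) ℝ} {p₁ q₁ v₁ w₁ p₂ q₂ v₂ w₂ c σ P Q : ℝ}
    (h₂ : LDU M₂ p₂ q₂ v₂ w₂) (h₁ : LDU M₁ p₁ q₁ v₁ w₁) (hc : c * c + σ * σ = 1)
    (hk : kap c σ w₂ v₁ = 0) (hp₁ : |p₁| ≤ P) (hp₂ : |p₂| ≤ P) (hq₁ : |q₁| ≤ Q) (hq₂ : |q₂| ≤ Q)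
    (hv₁ : |v₁| ≤ 1 / 4) (hw₁ : |w₁| ≤ 1 / 4) (hv₂ : |v₂| ≤ 1 / 4) (hw₂ : |w₂| ≤ 1 / 4)
    (hQ : Q ≤ P) : matNorm (M₂ * rot c σ * M₁) ≤ 8 * (P * Q) := by
  have hP0 : 0 ≤ P := (abs_nonneg _).trans hp₁
  have hQ0 : 0 ≤ Q := (abs_nonneg _).trans hq₁
  have hPQ : 0 ≤ P * Q := mul_nonneg hP0 hQ0
  have hc1 : |c| ≤ 1 := abs_le_of_sq_le_sq (by nlinarith [mul_self_nonneg σ]) zero_le_one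
  have hs1 : |σ| ≤ 1 := abs_le_of_sq_le_sq (by nlinarith [mul_self_nonneg c]) zero_le_one
  have hx : |p₂ * q₁ * (c * w₂ - σ)| ≤ 5 / 4 * (P * Q) := by
    have h1 : |c * w₂ - σ| ≤ 5 / 4 := by
      refine (abs_sub _ _).trans ?_
      rw [abs_mul]
      have := mul_le_mul hc1 hw₂ (abs_nonneg _) zero_le_one
      linarith
    rw [abs_mul, abs_mul]
    have := mul_le_mul (mul_le_mul hp₂ hq₁ (abs_nonneg _) hP0) h1 (abs_nonneg _) hPQ
    linarith
  have hy : |q₂ * p₁ * (σ + c * v₁)| ≤ 5 / 4 * (P * Q) := by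
    have h1 : |σ + c * v₁| ≤ 5 / 4 := by
      refine (abs_add_le _ _).trans ?_
      rw [abs_mul c]
      have := mul_le_mul hc1 hv₁ (abs_nonneg _) zero_le_one
      linarith
    rw [abs_mul, abs_mul]
    have := mul_le_mul (mul_le_mul hq₂ hp₁ (abs_nonneg _) hQ0) h1 (abs_nonneg _) (by positivity)
    linarith
  have hz : |q₂ * c * q₁| ≤ P * Q := by
    rw [abs_mul, abs_mul]
    have := mul_le_mul (mul_le_mul (hq₂.trans hQ) hc1 (abs_nonneg _) hP0) hq₁ (abs_nonneg _)
      (by linarith)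
    linarith
  -- With zero pivot all terms containing p₁ p₂ cancel, and each remaining term has a factor q₁ or
  -- q₂.
  unfold kap at hk
  have e00 : (M₂ * rot c σ * M₁) 0 0 = 0 := by
    simp only [Matrix.mul_apply, Fin.sum_univ_two, rot, h₁.h00, h₁.h10, h₂.h00, h₂.h01,
      Matrix.of_apply, Matrix.cons_val', Matrix.cons_val_zero, Matrix.cons_val_one,
      Matrix.cons_val_fin_one]
    linear_combination p₂ * p₁ * hk
  have e01 : (M₂ * rot c σ * M₁) 0 1 = p₂ * q₁ * (c * w₂ - σ) := by
    simp only [Matrix.mul_apply, Fin.sum_univ_two, rot, h₁.h01, h₁.h11, h₂.h00, h₂.h01,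
      Matrix.of_apply, Matrix.cons_val', Matrix.cons_val_zero, Matrix.cons_val_one,
      Matrix.cons_val_fin_one]
    linear_combination p₂ * p₁ * w₁ * hk
  have e10 : (M₂ * rot c σ * M₁) 1 0 = q₂ * p₁ * (σ + c * v₁) := by
    simp only [Matrix.mul_apply, Fin.sum_univ_two, rot, h₁.h00, h₁.h10, h₂.h10, h₂.h11,
      Matrix.of_apply, Matrix.cons_val', Matrix.cons_val_zero, Matrix.cons_val_one,
      Matrix.cons_val_fin_one]
    linear_combination p₂ * p₁ * v₂ * hk
  have e11 : (M₂ * rot c σ * M₁) 1 1 = v₂ * (p₂ * q₁ * (c * w₂ - σ)) +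
      q₂ * p₁ * (σ + c * v₁) * w₁ + q₂ * c * q₁ := by
    simp only [Matrix.mul_apply, Fin.sum_univ_two, rot, h₁.h01, h₁.h11, h₂.h10, h₂.h11,
      Matrix.of_apply, Matrix.cons_val', Matrix.cons_val_zero, Matrix.cons_val_one,
      Matrix.cons_val_fin_one]
    linear_combination p₂ * p₁ * v₂ * w₁ * hk
  have key : ∀ i j, |(M₂ * rot c σ * M₁) i j| ≤ 2 * (P * Q) := by
    intro i j
    fin_cases i <;> fin_cases j
    · simp only [Fin.zero_eta]; rw [e00, abs_zero]; linarith
    · simp only [Fin.zero_eta, Fin.mk_one]; rw [e01]; linarith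
    · simp only [Fin.zero_eta, Fin.mk_one]; rw [e10]; linarith
    · simp only [Fin.mk_one]; rw [e11]
      refine (abs_add_le _ _).trans ((add_le_add (abs_add_le _ _) le_rfl).trans ?_)
      rw [abs_mul v₂, abs_mul _ w₁]
      have h1 := mul_le_mul hv₂ hx (abs_nonneg _) (by norm_num)
      have h2 := mul_le_mul hy hw₁ (abs_nonneg _) (by positivity)
      linarith
  exact (matNorm_le_sum _ key).trans (by linarith)

end Collapse

/-! ### The perturbed cocycles and their exponents -/

namespace Frame

variable {F : Frame}

/-- The factor `f`, cut off near the critical point. -/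
noncomputable def cut (F : Frame) (n : ℕ) (x : ℝ) : ℝ := F.f x * (1 - F.χ n x)

lemma cut_jet (F : Frame) (n : ℕ) (x : ℝ) : ContDiffAt ℝ ∞ (F.cut n) x ∧
    jet (F.cut n) x = jet F.f x - jet F.f x * jet (F.χ n) x := by
  have hf := F.f_smooth.contDiffAt (x := x)
  have hχ := (F.χ_smooth n).contDiffAt (x := x)
  have e : F.cut n = fun y => F.f y - F.f y * F.χ n y := by funext y; unfold cut; ring
  rw [e]
  exact ⟨hf.sub (hf.mul hχ), by rw [jet_sub hf (hf.mul hχ), jet_mul hf hχ]⟩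

lemma cut_le (F : Frame) (n : ℕ) (x : ℝ) (t : ℕ) : jetNorm F.s t (jet (F.cut n) x) ≤ 1 / 2 := by
  rw [(F.cut_jet n x).2]
  have h1 := jetNorm_sub (s := F.s) (t := t) (jet F.f x) (jet F.f x * jet (F.χ n) x)
  linarith [F.f_le x t, (F.f_mul_χ_le n x t).trans (F.ζ_le n)]

/-- The cosine of the perturbed rotation. -/
noncomputable def cutCo (F : Frame) (n : ℕ) (y : ℝ) : ℝ :=
  rotC (F.V (n + 1) y) (F.W (n + 1) y) (F.cut (n + 1) y)

/-- The sine of the perturbed rotation. -/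
noncomputable def cutSi (F : Frame) (n : ℕ) (y : ℝ) : ℝ :=
  rotS (F.V (n + 1) y) (F.W (n + 1) y) (F.cut (n + 1) y)

lemma cut_rotFun (F : Frame) (n : ℕ) : RotFun F.s (F.cutCo n) (F.cutSi n) := by
  have h := (F.stage (n + 1)).adm
  have hp := F.VW_periodic (n + 1)
  have hc : Function.Periodic (F.cut (n + 1)) (2 * Real.pi) := fun x => by
    simp only [cut, F.f_periodic x, F.χ_periodic (n + 1) x]
  refine ⟨⟨contDiff_iff_contDiffAt.2 fun x =>
      (rot_contDiffAt h.sv.contDiffAt h.sw.contDiffAt (F.cut_jet (n + 1) x).1).1,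
    contDiff_iff_contDiffAt.2 fun x =>
      (rot_contDiffAt h.sv.contDiffAt h.sw.contDiffAt (F.cut_jet (n + 1) x).1).2⟩,
    ⟨fun x => ?_, fun x => ?_⟩, fun x => rot_unit _ _ _, 40, fun x t => ?_⟩
  · simp only [cutCo, hp.1 x, hp.2 x, hc x]
  · simp only [cutSi, hp.1 x, hp.2 x, hc x]
  · have := jet_rot_bounds F.one_le_s h.sv.contDiffAt h.sw.contDiffAt (F.cut_jet (n + 1) x).1
      ((h.nv x t).trans F.e₀_le) ((h.nw x t).trans F.e₀_le) (F.cut_le (n + 1) x t)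
    exact ⟨this.1, this.2.1⟩

/-- The perturbed cocycles converge to the limit cocycle. -/
lemma Limit.tendsto_dist {v w : ℝ → ℝ} (h : F.Limit v w) :
    Filter.Tendsto (fun n => gevreyDist 4 ((F.cut_rotFun n).cocycle F.one_le_s F.one_le_lam)
      ((h.adm.rotFun h.periodic.1 h.periodic.2).cocycle F.one_le_s F.one_le_lam)) Filter.atTop (𝓝 0) := by
  have hle : ∀ n, gevreyDist 4 ((F.cut_rotFun n).cocycle F.one_le_s F.one_le_lam)
      ((h.adm.rotFun h.periodic.1 h.periodic.2).cocycle F.one_le_s F.one_le_lam) ≤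
      ENNReal.ofReal (4 * Real.pi ^ 2 / 3) *
        ENNReal.ofReal (F.K.lam * (300 * (F.rem (n + 1) + F.ζ (n + 1)))) := by
    intro n
    refine RotFun.dist_le _ _ _ _ fun x t => ?_
    have h' := (F.stage (n + 1)).adm
    have hζ : 0 ≤ F.ζ (n + 1) := (jetNorm_nonneg _).trans (F.f_mul_χ_le (n + 1) x t)
    have hr : 0 ≤ F.rem (n + 1) := (jetNorm_nonneg _).trans (h.near (n + 1) x t).1
    refine jet_rot_sub_le F.one_le_s h'.sv.contDiffAt h'.sw.contDiffAt (F.cut_jet (n + 1) x).1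
      h.adm.sv.contDiffAt h.adm.sw.contDiffAt F.f_smooth.contDiffAt
      ((h'.nv x t).trans F.e₀_le) ((h'.nw x t).trans F.e₀_le) (F.cut_le (n + 1) x t)
      ((h.adm.nv x t).trans F.e₀_le) ((h.adm.nw x t).trans F.e₀_le)
      ((F.f_le x t).trans (by norm_num)) ?_ ?_ ?_
    · rw [jetNorm_sub_comm]; linarith [(h.near (n + 1) x t).1]
    · rw [jetNorm_sub_comm]; linarith [(h.near (n + 1) x t).2]
    · rw [(F.cut_jet (n + 1) x).2, sub_sub_cancel_left, jetNorm_neg]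
      linarith [F.f_mul_χ_le (n + 1) x t]
  refine tendsto_of_tendsto_of_tendsto_of_le_of_le tendsto_const_nhds ?_ (fun _ => bot_le) hle
  have h1 : Filter.Tendsto (fun n => F.K.lam * (300 * (F.rem (n + 1) + F.ζ (n + 1))))
      Filter.atTop (𝓝 0) := by
    have := (((Filter.tendsto_add_atTop_iff_nat 1).2 (F.rem_tendsto.add F.ζ_tendsto)).const_mul
      300).const_mul F.K.lam
    simpa using this
  have h2 := ENNReal.Tendsto.const_mul (a := ENNReal.ofReal (4 * Real.pi ^ 2 / 3))
    (ENNReal.tendsto_ofReal h1) (Or.inr ENNReal.ofReal_ne_top)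
  simpa using h2

/-- Outside the ball of radius r_n neither the cutoff χ_{n+1} nor the last modification of the
slopes is active. The reference products are therefore those of the unperturbed construction. -/
lemma orbitSeg_cut_eq (F : Frame) {n : ℕ} {x : ℝ} {a : ℤ} {k : ℕ}
    (hi : InSet {m : ℤ | F.r n ≤ dep (x + m * F.γ)} a k) :
    orbitSeg F.K.lam F.γ (F.cutCo n) (F.cutSi n) a k x =
      orbitSeg F.K.lam F.γ (F.co (F.V n) (F.W n)) (F.si (F.V n) (F.W n)) a k x := by
  refine seg_congr fun i hi' => ?_
  have hd : F.r n ≤ dep (x + (a + i : ℤ) * F.γ) := hi i hi'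
  have hr := F.r_pos n
  have h1 := F.r_succ n
  obtain ⟨e1, e2⟩ := (F.stage n).agree _ hd
  simp only [cutCo, cutSi, cut, co, si]
  rw [F.χ_off (n + 1) _ (by linarith), e1.self_of_nhds, e2.self_of_nhds, sub_zero, mul_one]
  exact ⟨rfl, rfl⟩

/-- No growth of the perturbed products around a close visit. -/
lemma opNorm_block_le {α : ℝ} (hα : F.γ = 2 * Real.pi * α)
    (hlam : F.C₂ ≤ Real.log F.K.lam) {n : ℕ} {y : ℝ} (hy : dep y ≤ F.r (n + 1) / 8) :
    opNorm (iterate α ((F.cut_rotFun n).cocycle F.one_le_s F.one_le_lam).toFun (2 * F.N n + 1)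
      (y + (0 - F.N n : ℤ) * (2 * Real.pi * α))) ≤ 8 * Real.exp (F.C₂ * F.N n) * F.K.lam := by
  have hr := F.r_pos n
  have hr1 := F.r_succ n
  have hl := SegData.lam_pos (K := F.K)
  have hy0 : dep (y + (0 : ℤ) * F.γ) ≤ F.r n := by simp; linarith
  obtain ⟨⟨g1, i1⟩, g2, i2⟩ := F.ref_good hy0
  obtain ⟨p₁, q₁, v₁, w₁, L₁, Q₁, b1, b2, e1, -⟩ := (F.stage n).ok.real g1 i1
  obtain ⟨p₂, q₂, v₂, w₂, L₂, Q₂, b3, b4, -, e2⟩ := (F.stage n).ok.real g2 i2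
  rw [← F.orbitSeg_cut_eq i1] at L₁
  rw [← F.orbitSeg_cut_eq i2] at L₂
  -- Near the critical point the prescribed slopes are exactly the slopes of the two reference
  -- products, and f has been cut to zero: the pivot vanishes identically there.
  obtain ⟨s1, s2⟩ := (F.stage n).glue.2.2.1 y (by linarith)
  have k1 : v₁ = F.V (n + 1) y := e1.trans s1.self_of_nhds.symm
  have k2 : w₂ = F.W (n + 1) y := e2.trans s2.self_of_nhds.symm
  have hk : kap (F.cutCo n y) (F.cutSi n y) w₂ v₁ = 0 := by
    rw [k1, k2, cutCo, cutSi, cut, F.χ_on (n + 1) y hy, sub_self, mul_zero]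
    exact kap_rot_zero _ _
  have hP : ∀ {a : ℤ} {p q v' w' : ℝ},
      LDU (orbitSeg F.K.lam F.γ (F.cutCo n) (F.cutSi n) a (F.N n) y) p q v' w' →
      |p| ≤ F.K.lam ^ (F.N n + 1) := by
    intro a p q v' w' hL
    rw [← hL.h00, hα]
    exact (F.cut_rotFun n).abs_orbitSeg_le F.one_le_s F.one_le_lam α y a (F.N n) 0 0
  have hΦ : F.K.lam⁻¹ ^ (F.N n + 1) * Real.exp (F.K.Φ (F.N n)) ≤
      F.K.lam⁻¹ ^ (F.N n + 1) * Real.exp (F.C₂ * F.N n) :=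
    mul_le_mul_of_nonneg_left (Real.exp_le_exp.2 (F.Φ_le _)) (by positivity)
  have hQP : F.K.lam⁻¹ ^ (F.N n + 1) * Real.exp (F.C₂ * F.N n) ≤ F.K.lam ^ (F.N n + 1) := by
    have h1 : Real.exp (F.C₂ * F.N n) ≤ F.K.lam ^ (F.N n + 1) := by
      calc Real.exp (F.C₂ * F.N n) ≤ Real.exp (F.N n * Real.log F.K.lam) := by
            rw [mul_comm]; gcongr
        _ = F.K.lam ^ F.N n := by rw [mul_comm, Real.exp_mul, Real.exp_log hl, Real.rpow_natCast]
        _ ≤ _ := pow_le_pow_right₀ F.one_le_lam (by omega)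
    have h2 : F.K.lam⁻¹ ^ (F.N n + 1) ≤ 1 :=
      pow_le_one₀ (by positivity) (inv_le_one_of_one_le₀ F.one_le_lam)
    calc _ ≤ 1 * F.K.lam ^ (F.N n + 1) := by gcongr
      _ = _ := one_mul _
  have key := matNorm_collapse_le L₂ L₁ ((F.cut_rotFun n).unit y) hk (hP L₁) (hP L₂)
    (Q₁.trans hΦ) (Q₂.trans hΦ) b1 b2 b3 b4 hQP
  have hPQ : F.K.lam ^ (F.N n + 1) * (F.K.lam⁻¹ ^ (F.N n + 1) * Real.exp (F.C₂ * F.N n)) =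
      Real.exp (F.C₂ * F.N n) := by
    rw [← mul_assoc, ← mul_pow, mul_inv_cancel₀ hl.ne', one_pow, one_mul]
  rw [hPQ] at key
  have hsplit : orbitSeg F.K.lam F.γ (F.cutCo n) (F.cutSi n) (0 - F.N n) (2 * F.N n + 1) y =
      orbitSeg F.K.lam F.γ (F.cutCo n) (F.cutSi n) (0 + 1) (F.N n) y *
        rot (F.cutCo n y) (F.cutSi n y) *
        orbitSeg F.K.lam F.γ (F.cutCo n) (F.cutSi n) (0 - F.N n) (F.N n) y := by
    have e : 2 * F.N n + 1 = F.N n + 1 + F.N n := by ring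
    unfold orbitSeg
    rw [e, seg_split]
    have e' : (0 : ℤ) - F.N n + F.N n = 0 := by ring
    simp only [e', Int.cast_zero, zero_mul, add_zero]
  rw [← hsplit, hα, ← (F.cut_rotFun n).iterate_mul_diag F.one_le_s F.one_le_lam] at key
  set Y := iterate α ((F.cut_rotFun n).cocycle F.one_le_s F.one_le_lam).toFun (2 * F.N n + 1)
      (y + (0 - F.N n : ℤ) * (2 * Real.pi * α)) with hY
  -- The segment product carries one extra diagonal factor; removing it costs a single λ.
  have hone : (!![F.K.lam, 0; 0, F.K.lam⁻¹] : Matrix (Fin 2) (Fin 2) ℝ) *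
      !![F.K.lam⁻¹, 0; 0, F.K.lam] = 1 := by
    ext i j; fin_cases i <;> fin_cases j <;> simp [Matrix.mul_apply, hl.ne']
  have hYe : (Y : Matrix (Fin 2) (Fin 2) ℝ) = (Y : Matrix (Fin 2) (Fin 2) ℝ) *
      !![F.K.lam, 0; 0, F.K.lam⁻¹] * !![F.K.lam⁻¹, 0; 0, F.K.lam] := by
    rw [Matrix.mul_assoc, hone, Matrix.mul_one]
  rw [opNorm_eq, hYe]
  exact (matNorm_mul_le _ _).trans (mul_le_mul key (matNorm_diag_le F.one_le_lam).2
    (matNorm_nonneg _) (by positivity))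

lemma one_le_N (F : Frame) (n : ℕ) : 1 ≤ F.N n := by
  by_contra! h
  have h1 := F.le_N n
  have h2 := F.κ₀_pos
  rw [Nat.lt_one_iff.1 h] at h1
  simp at h1; linarith

/-- At most one close visit among `N n` consecutive ones. -/
lemma sum_visit_le (F : Frame) (n : ℕ) (x : ℝ) {ρ : ℝ} (hρ : ρ ≤ F.r n) {i : ℕ} (hi : i < F.N n)
    (hd : dep (x + (F.N n + i : ℕ) * F.γ) ≤ ρ) :
    ∑ j ∈ Finset.range (F.N n), visit ρ (x + (F.N n + j : ℕ) * F.γ) = 1 := by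
  rw [Finset.sum_eq_single_of_mem i (Finset.mem_range.2 hi), visit_of_le hd]
  intro j hj hij
  rw [Finset.mem_range] at hj
  refine visit_of_lt (lt_of_not_ge fun hd' => ?_)
  have hne : ((F.N n + j : ℕ) : ℤ) - ((F.N n + i : ℕ) : ℤ) ≠ 0 := by push_cast; omega
  have h1 := F.sep _ hne
  have h2 := F.dep_int_sub x ((F.N n + j : ℕ) : ℤ) ((F.N n + i : ℕ) : ℤ)
  rw [Int.cast_natCast, Int.cast_natCast] at h2
  have h3 : |((((F.N n + j : ℕ) : ℤ) - ((F.N n + i : ℕ) : ℤ) : ℤ) : ℝ)| ≤ F.N n := by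
    rw [← Int.cast_abs]
    have : |((F.N n + j : ℕ) : ℤ) - ((F.N n + i : ℕ) : ℤ)| ≤ (F.N n : ℤ) := by
      push_cast; rw [abs_le]; omega
    exact_mod_cast this
  have h4 := F.N_le n
  have hr := F.r_pos n
  have hN : (1 : ℝ) ≤ F.N n := by exact_mod_cast F.one_le_N n
  -- Two visits within N_n steps would give c ≤ 2 N_n r_n ≤ c/2.
  have h5 := mul_le_mul h3 (h2.trans (add_le_add hd' hd)) (dep_nonneg _) (by linarith)
  nlinarith

/-- Upper bound of the Lyapunov exponents of the perturbed cocycles. -/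
lemma lyapunov_cut_le {α : ℝ} (hα : F.γ = 2 * Real.pi * α)
    (hC₂ : 0 ≤ F.C₂) (hlam : F.C₂ + Real.log 8 ≤ Real.log F.K.lam) (n : ℕ) :
    lyapunov α ((F.cut_rotFun n).cocycle F.one_le_s F.one_le_lam) ≤
      (1 - F.κ₀ / 1000) * Real.log F.K.lam := by
  set A := (F.cut_rotFun n).cocycle F.one_le_s F.one_le_lam with hA
  have hN1 := F.one_le_N n
  have hN : (1 : ℝ) ≤ F.N n := by exact_mod_cast hN1
  have hl := SegData.lam_pos (K := F.K)
  have h8 : 0 ≤ Real.log 8 := Real.log_nonneg (by norm_num)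
  have hlog : 0 ≤ Real.log F.K.lam := by linarith
  have hr := F.r_pos n
  have hr1 := F.r_succ n
  set ρ := F.r (n + 1) / 8 with hρ
  have htriv : ∀ k x, Real.log (opNorm (iterate α A.toFun k x)) ≤ k * Real.log F.K.lam := by
    intro k x
    rw [← Real.log_pow]
    exact Real.log_le_log (zero_lt_one.trans_le (one_le_opNorm _))
      ((F.cut_rotFun n).opNorm_iterate_le F.one_le_s F.one_le_lam α x k)
  -- Products of length 3N_n are used, counting visits in the middle third so that N_n steps remain
  -- on each side. Such a visit saves at least N_n log λ against the trivial bound.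
  set g : ℝ → ℝ := fun x => ∑ j ∈ Finset.range (F.N n), visit ρ (x + (F.N n + j : ℕ) * F.γ) with hg
  have hpt : ∀ x, Real.log (opNorm (iterate α A.toFun (3 * F.N n) x)) ≤
      F.N n * Real.log F.K.lam * (3 - g x) := by
    intro x
    by_cases hx : ∃ i < F.N n, dep (x + (F.N n + i : ℕ) * F.γ) ≤ ρ
    · obtain ⟨i, hi, hd⟩ := hx
      have hgx : g x = 1 := F.sum_visit_le n x (by linarith) hi hd
      have hsp : 3 * F.N n = i + (2 * F.N n + 1) + (F.N n - 1 - i) := by omega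
      have hcast : ((F.N n - 1 - i : ℕ) : ℝ) = F.N n - 1 - i := by
        rw [Nat.sub_sub, Nat.cast_sub (by omega)]; push_cast; ring
      -- The pieces are i steps, the collapsing block centred at the visit, and N_n - 1 - i steps;
      -- the outer pieces are bounded trivially.
      rw [hsp, iterate_add, iterate_add]
      have hblock := opNorm_block_le (F := F) hα (by linarith) (n := n) hd
      have e : x + (F.N n + i : ℕ) * F.γ + (0 - F.N n : ℤ) * (2 * Real.pi * α) =
          x + i * (2 * Real.pi * α) := by rw [hα]; push_cast; ring
      rw [e] at hblock
      have hb := Real.log_le_log (zero_lt_one.trans_le (one_le_opNorm _)) hblock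
      rw [Real.log_mul (by positivity) (by positivity), Real.log_mul (by positivity) (by positivity),
        Real.log_exp] at hb
      have h1 := log_opNorm_mul_le (iterate α A.toFun (F.N n - 1 - i)
        (x + (i + (2 * F.N n + 1) : ℕ) * (2 * Real.pi * α)))
        (iterate α A.toFun (2 * F.N n + 1) (x + i * (2 * Real.pi * α)) * iterate α A.toFun i x)
      have h2 := log_opNorm_mul_le (iterate α A.toFun (2 * F.N n + 1) (x + i * (2 * Real.pi * α)))
        (iterate α A.toFun i x)
      have h3 := htriv (F.N n - 1 - i) (x + (i + (2 * F.N n + 1) : ℕ) * (2 * Real.pi * α))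
      have h4 := htriv i x
      rw [hcast] at h3
      rw [hgx]
      have h5 : Real.log 8 + F.C₂ * F.N n ≤ F.N n * Real.log F.K.lam := by nlinarith
      nlinarith
    · push Not at hx
      have hgx : g x = 0 := Finset.sum_eq_zero fun j hj =>
        visit_of_lt (hx j (Finset.mem_range.1 hj))
      have := htriv (3 * F.N n) x
      push_cast at this
      rw [hgx]; linarith
  have hgi : IntervalIntegrable g MeasureTheory.volume 0 (2 * Real.pi) := by
    have := IntervalIntegrable.sum (μ := MeasureTheory.volume) (a := 0) (b := 2 * Real.pi)
      (Finset.range (F.N n))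
      (f := fun (j : ℕ) x => visit ρ (x + (F.N n + j : ℕ) * F.γ))
      fun i _ => visit_intervalIntegrable _ _ _ _
    have e : g = ∑ j ∈ Finset.range (F.N n), fun x => visit ρ (x + (F.N n + j : ℕ) * F.γ) := by
      funext x; rw [Finset.sum_apply]
    rw [e]; exact this
  have hr0 : F.r n ≤ 1 := by
    by_contra! hlt
    have h1 := F.N_le n
    have h2 := F.sep 1 one_ne_zero
    have h3 := dep_le_one ((1 : ℤ) * F.γ)
    simp only [Int.cast_one, abs_one, one_mul] at h2 h3
    nlinarith
  have hgI : F.N n * (4 * ρ) ≤ ∫ x in (0 : ℝ)..(2 * Real.pi), g x := by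
    simp only [hg]
    rw [intervalIntegral.integral_finsetSum fun i _ => visit_intervalIntegrable _ _ _ _]
    have := Finset.card_nsmul_le_sum (Finset.range (F.N n)) (fun j : ℕ =>
      ∫ x in (0 : ℝ)..(2 * Real.pi), visit ρ (x + (F.N n + j : ℕ) * F.γ)) (4 * ρ)
      fun j _ => le_integral_visit (by linarith) (by linarith) _
    rwa [Finset.card_range, nsmul_eq_mul] at this
  have hmono := intervalIntegral.integral_mono_on (by positivity : (0 : ℝ) ≤ 2 * Real.pi)
    ((continuous_log_opNorm α A (3 * F.N n)).intervalIntegrable _ _)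
    ((intervalIntegrable_const.sub hgi).const_mul (F.N n * Real.log F.K.lam)) fun x _ => hpt x
  rw [intervalIntegral.integral_const_mul, intervalIntegral.integral_sub intervalIntegrable_const hgi,
    intervalIntegral.integral_const, smul_eq_mul, sub_zero] at hmono
  have e3 : 3 * F.N n - 1 + 1 = 3 * F.N n := by omega
  refine lyapunov_le (3 * F.N n - 1) ?_
  rw [e3]
  have e4 : ((3 * F.N n - 1 : ℕ) : ℝ) + 1 = 3 * F.N n := by
    have := congrArg (Nat.cast (R := ℝ)) e3
    push_cast at this ⊢
    linarith
  rw [e4]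
  refine hmono.trans ?_
  have h1 := mul_le_mul_of_nonneg_left hgI (show 0 ≤ F.N n * Real.log F.K.lam by positivity)
  have h2 := F.le_N n
  have h3 : ρ = F.r n / 128 := by rw [hρ, hr1]; ring
  have h4 : F.κ₀ / 32 ≤ F.N n * (4 * ρ) := by rw [h3]; linarith
  have h5 := mul_le_mul_of_nonneg_left h4 (show 0 ≤ F.N n * Real.log F.K.lam by positivity)
  have hpi := Real.pi_lt_d2
  have hκ := F.κ₀_pos
  -- The total measure of the visits is at least N_n · 4ρ = N_n r_n/32. Dividing by 3 · 2π gives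
  -- κ₀/(192π), which exceeds κ₀/1000.
  have h6 : F.N n * Real.log F.K.lam * (F.κ₀ * (6 * Real.pi / 1000)) ≤
      F.N n * Real.log F.K.lam * (F.κ₀ / 32) := by
    refine mul_le_mul_of_nonneg_left ?_ (by positivity)
    nlinarith
  nlinarith

end Frame

/-! ### The loss function -/

section Constants

/-- Quantifies strict subadditivity: compared with i^β + j^β there is a gain of (1 - β) i^β, i being
the shorter length. -/
lemma add_rpow_le_of_le {β i j : ℝ} (hβ0 : 0 ≤ β) (hβ1 : β ≤ 1) (hi : 0 < i) (hij : i ≤ j) :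
    (i + j) ^ β ≤ j ^ β + β * i ^ β := by
  have hj : 0 < j := hi.trans_le hij
  have e : i + j = j * (1 + i / j) := by field_simp; ring
  have h1 : (1 + i / j) ^ β ≤ 1 + β * (i / j) :=
    rpow_one_add_le_one_add_mul_self (by linarith [div_pos hi hj]) hβ0 hβ1
  have h2 : j ^ β * (i / j) ≤ i ^ β := by
    have h3 : j ^ (β - 1) ≤ i ^ (β - 1) := Real.rpow_le_rpow_of_nonpos hi hij (by linarith)
    have h4 := mul_le_mul_of_nonneg_left h3 hi.le
    rw [Real.rpow_sub_one hj.ne', Real.rpow_sub_one hi.ne'] at h4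
    calc j ^ β * (i / j) = i * (j ^ β / j) := by ring
      _ ≤ i * (i ^ β / i) := h4
      _ = i ^ β := by field_simp
  rw [e, Real.mul_rpow hj.le (by positivity)]
  have h5 := mul_le_mul_of_nonneg_left h1 (Real.rpow_nonneg hj.le β)
  have h6 := mul_le_mul_of_nonneg_left h2 hβ0
  linarith

/-- The loss function `C₂ n - E n ^ β` of the products. -/
lemma loss_add {β L E τ₀ τ : ℝ} (hβ0 : 0 < β) (hβ1 : β < 1) (hL : 0 ≤ L) (hE : E = L / (1 - β))
    (hτ₀ : 0 ≤ τ₀) (hτ : 1 ≤ τ) {i j : ℕ} (h : τ ≤ τ₀ ∨ (τ ≤ (i : ℝ) ^ β ∧ τ ≤ (j : ℝ) ^ β)) :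
    ((E + L * τ₀) * i - E * (i : ℝ) ^ β) + ((E + L * τ₀) * j - E * (j : ℝ) ^ β) + L * τ ≤
      (E + L * τ₀) * (i + 1 + j : ℕ) - E * ((i + 1 + j : ℕ) : ℝ) ^ β := by
  -- The choice E = L/(1 - β) turns the gain of subadditivity into exactly L i^β, enough for a deep
  -- visit. A shallow visit is paid by the linear term, since each merge adds one to the length.
  have hE0 : 0 ≤ E := by rw [hE]; exact div_nonneg hL (by linarith)
  have hEL : E * (1 - β) = L := by rw [hE]; exact div_mul_cancel₀ _ (by linarith)
  have one : ∀ x : ℝ, 0 ≤ x → (x + 1) ^ β ≤ x ^ β + 1 := fun x hx => by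
    have := Real.rpow_add_le_add_rpow hx zero_le_one hβ0.le hβ1.le
    rwa [Real.one_rpow] at this
  have hLτ₀ : 0 ≤ L * τ₀ := mul_nonneg hL hτ₀
  have h1 : ((i + 1 + j : ℕ) : ℝ) ^ β ≤ ((i : ℝ) + j) ^ β + 1 := by
    have := one ((i : ℝ) + j) (by positivity)
    have e : ((i + 1 + j : ℕ) : ℝ) = (i : ℝ) + j + 1 := by push_cast; ring
    rwa [e]
  have h1E := mul_le_mul_of_nonneg_left h1 hE0
  push_cast at h1E ⊢
  rcases h with h | ⟨hi, hj⟩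
  · have h2 := mul_le_mul_of_nonneg_left
      (Real.rpow_add_le_add_rpow i.cast_nonneg j.cast_nonneg hβ0.le hβ1.le) hE0
    have h3 := mul_le_mul_of_nonneg_left h hL
    linarith
  · have pos : ∀ k : ℕ, τ ≤ (k : ℝ) ^ β → (0 : ℝ) < k := by
      intro k hk
      rcases k.eq_zero_or_pos with rfl | hk0
      · rw [Nat.cast_zero, Real.zero_rpow hβ0.ne'] at hk; linarith
      · exact_mod_cast hk0
    have key : ∀ i j : ℝ, 0 < i → i ≤ j → τ ≤ i ^ β → E * (i + j) ^ β + L * τ ≤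
        E * i ^ β + E * j ^ β := by
      intro i j hi0 hij hτi
      have h2 := mul_le_mul_of_nonneg_left (add_rpow_le_of_le hβ0.le hβ1.le hi0 hij) hE0
      have h3 := mul_le_mul_of_nonneg_left hτi hL
      have h4 : E * i ^ β = E * (β * i ^ β) + L * i ^ β := by rw [← hEL]; ring
      linarith
    have h2 : E * ((i : ℝ) + j) ^ β + L * τ ≤ E * (i : ℝ) ^ β + E * (j : ℝ) ^ β := by
      rcases le_total (i : ℝ) j with hij | hij
      · exact key i j (pos i hi) hij hi
      · have := key j i (pos j hj) hij hj
        rw [add_comm (j : ℝ)] at this; linarith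
    linarith

lemma le_of_le_rpow {β τ : ℝ} (hβ0 : 0 < β) (hβ1 : β < 1) {j : ℕ} (h : τ ≤ (j : ℝ) ^ β) :
    τ ≤ j := by
  refine h.trans ?_
  rcases j.eq_zero_or_pos with rfl | hj
  · rw [Nat.cast_zero, Real.zero_rpow hβ0.ne']
  · have h1 : (1 : ℝ) ≤ j := by exact_mod_cast hj
    exact (Real.rpow_le_rpow_of_exponent_le h1 hβ1.le).trans_eq (Real.rpow_one _)

/-- Admissible constants for large `lam`. -/
lemma exists_segConst {β L τ₀ : ℝ} (hβ0 : 0 < β) (hβ1 : β < 1) (hL : 0 ≤ L) (hτ₀ : 0 ≤ τ₀) :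
    ∃ C₂ Λ : ℝ, 0 ≤ C₂ ∧ ∀ lam, Λ ≤ lam → ∃ K : SegConst, K.lam = lam ∧ K.B = 40 ∧ K.τ₀ = τ₀ ∧
      K.β = β ∧ K.L = L ∧ ∀ n, K.Φ n ≤ C₂ * n := by
  set E := L / (1 - β) with hE
  have hE0 : 0 ≤ E := div_nonneg hL (by linarith)
  have hC : 0 ≤ E + L * τ₀ := by positivity
  -- Here 320 = 8B with B = 40, and the exponent bounds the loss per step in `big` because τ ≤ τ₀ +
  -- j.
  refine ⟨E + L * τ₀, 320 * Real.exp (2 * L * τ₀ + 2 * L + 2 * (E + L * τ₀)), hC, fun lam hlam => ?_⟩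
  have h1 : 1 ≤ Real.exp (2 * L * τ₀ + 2 * L + 2 * (E + L * τ₀)) := Real.one_le_exp (by positivity)
  refine ⟨⟨lam, 40, τ₀, β, L, fun n => (E + L * τ₀) * n - E * (n : ℝ) ^ β, by linarith, by norm_num, hL,
    by simp [Real.zero_rpow hβ0.ne'], fun i j τ hτ h => loss_add hβ0 hβ1 hL hE hτ₀ hτ h,
    fun j τ hτ h => ?_⟩, rfl, rfl, rfl, rfl, rfl, fun n => ?_⟩
  · have hτj : τ ≤ τ₀ + j := by
      have hj : (0 : ℝ) ≤ j := j.cast_nonneg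
      rcases h with h | h
      · linarith
      · linarith [le_of_le_rpow hβ0 hβ1 h]
    have hn : 0 ≤ E * (j : ℝ) ^ β := by positivity
    have hexp : 2 * (L * τ) + 2 * ((E + L * τ₀) * j - E * (j : ℝ) ^ β) ≤
        (j + 1 : ℕ) * (2 * L * τ₀ + 2 * L + 2 * (E + L * τ₀)) := by
      have h2 := mul_le_mul_of_nonneg_left hτj hL
      have h3 : 0 ≤ (j : ℝ) * (L * τ₀) := by positivity
      push_cast
      nlinarith
    calc 8 * 40 * Real.exp (2 * (L * τ) + 2 * ((E + L * τ₀) * j - E * (j : ℝ) ^ β))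
        ≤ 320 ^ (j + 1) * Real.exp (2 * L * τ₀ + 2 * L + 2 * (E + L * τ₀)) ^ (j + 1) := by
          rw [← Real.exp_nat_mul]
          refine mul_le_mul ?_ (Real.exp_le_exp.2 hexp) (Real.exp_pos _).le (by positivity)
          have := pow_le_pow_right₀ (by norm_num : (1 : ℝ) ≤ 320) (show 1 ≤ j + 1 by omega)
          linarith
      _ ≤ lam ^ (j + 1) := by
          rw [← mul_pow]
          exact pow_le_pow_left₀ (by positivity) hlam _
  · have hn : 0 ≤ E * (n : ℝ) ^ β := by positivity
    simp only; linarith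

end Constants

/-! ### Choice of scales and reference lengths -/

section Scales

/-- Choice of the initial scale. -/
lemma exists_radius {b β c ε : ℝ} (hb : 0 < b) (hbβ : b < β) (hc : 0 < c) (hε : 0 < ε) :
    ∃ r₀ : ℝ, 0 < r₀ ∧ r₀ ≤ c ^ 2 / 32 ∧
      (∀ r, 0 < r → r ≤ r₀ → (r / 256) ^ (-b) ≤ (c ^ 2 / 32 / r) ^ β) ∧
      (∀ i : ℕ, (4 * ((i : ℝ) + 1) / c) ^ b ≤ (r₀ / 16) ^ (-b) ∨
        (4 * ((i : ℝ) + 1) / c) ^ b ≤ (i : ℝ) ^ β) ∧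
      ∃ B : ℕ → ℝ, (∀ i, 0 ≤ B i) ∧ (∀ n, ∑ i ∈ Finset.range n, B i ≤ ε) ∧
        ∀ (i : ℕ) (d : ℝ), B i < d → d ^ (-b) ≤ (r₀ / 16) ^ (-b) ∨ d ^ (-b) ≤ (i : ℝ) ^ β := by
  have hβ : 0 < β := hb.trans hbβ
  obtain ⟨I, hI⟩ : ∃ I : ℕ, ∀ i : ℕ, I ≤ i → (4 * ((i : ℝ) + 1) / c) ^ b ≤ (i : ℝ) ^ β := by
    have h1 : Filter.Tendsto (fun i : ℕ => (i : ℝ) ^ (β - b)) Filter.atTop Filter.atTop :=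
      (tendsto_rpow_atTop (by linarith)).comp tendsto_natCast_atTop_atTop
    obtain ⟨I, hI⟩ := Filter.eventually_atTop.1 (h1.eventually_ge_atTop ((8 / c) ^ b))
    refine ⟨max I 1, fun i hi => ?_⟩
    have hi1 : (1 : ℝ) ≤ i := by exact_mod_cast (le_max_right I 1).trans hi
    have h2 := hI i ((le_max_left _ _).trans hi)
    calc (4 * ((i : ℝ) + 1) / c) ^ b ≤ (8 / c * i) ^ b := by
          refine Real.rpow_le_rpow (by positivity) ?_ hb.le
          rw [div_mul_eq_mul_div]
          exact div_le_div_of_nonneg_right (by linarith) hc.le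
      _ = (8 / c) ^ b * (i : ℝ) ^ b := Real.mul_rpow (by positivity) (by positivity)
      _ ≤ (i : ℝ) ^ (β - b) * (i : ℝ) ^ b := by gcongr
      _ = _ := by rw [← Real.rpow_add (by linarith)]; congr 1; ring
  -- A depth at most i^β means a distance at least i^(-β/b). Summability of these radii is the
  -- reason for requiring b < β.
  have ha : 1 < β / b := (one_lt_div hb).2 hbβ
  have hsum : Summable fun i : ℕ => (i : ℝ) ^ (-(β / b)) := Real.summable_nat_rpow.2 (by linarith)
  obtain ⟨J, hJ1, hJ⟩ : ∃ J : ℕ, 1 ≤ J ∧ ∑' i : ℕ, ((i + J : ℕ) : ℝ) ^ (-(β / b)) ≤ ε / 2 := by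
    have h1 := tendsto_sum_nat_add fun i : ℕ => (i : ℝ) ^ (-(β / b))
    obtain ⟨J, hJ⟩ := Filter.eventually_atTop.1 (h1.eventually_le_const (half_pos hε))
    exact ⟨max J 1, le_max_right _ _, hJ _ (le_max_left _ _)⟩
  obtain ⟨r₁, hr₁, hr₁'⟩ : ∃ r₁ : ℝ, 0 < r₁ ∧ ∀ r, 0 < r → r ≤ r₁ →
      (r / 256) ^ (-b) ≤ (c ^ 2 / 32 / r) ^ β := by
    set D : ℝ := (c ^ 2 / 32) ^ β / 256 ^ b with hD
    have hD0 : 0 < D := by positivity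
    refine ⟨D ^ (1 / (β - b)), by positivity, fun r hr hrr => ?_⟩
    have h1 : r ^ (β - b) ≤ D := by
      have := Real.rpow_le_rpow hr.le hrr (show 0 ≤ β - b by linarith)
      rwa [← Real.rpow_mul hD0.le, one_div_mul_cancel (by linarith), Real.rpow_one] at this
    rw [hD, le_div_iff₀ (by positivity), Real.rpow_sub hr, div_mul_eq_mul_div,
      div_le_iff₀ (by positivity)] at h1
    rw [Real.rpow_neg (by positivity), Real.div_rpow hr.le (by norm_num), inv_div,
      Real.div_rpow (by positivity) hr.le, div_le_div_iff₀ (by positivity) (by positivity)]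
    linarith
  set r₀ := min (min r₁ (c ^ 2 / 32)) (min (c / (4 * (I + 1))) (ε / (2 * J))) with hr₀
  have hJ0 : (0 : ℝ) < J := by exact_mod_cast hJ1
  have hr0 : 0 < r₀ := by
    refine lt_min (lt_min hr₁ (by positivity)) (lt_min (by positivity) (by positivity))
  have a1 : r₀ ≤ r₁ := (min_le_left _ _).trans (min_le_left _ _)
  have a2 : r₀ ≤ c ^ 2 / 32 := (min_le_left _ _).trans (min_le_right _ _)
  have a3 : r₀ ≤ c / (4 * (I + 1)) := (min_le_right _ _).trans (min_le_left _ _)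
  have a4 : r₀ ≤ ε / (2 * J) := (min_le_right _ _).trans (min_le_right _ _)
  refine ⟨r₀, hr0, a2, fun r h1 h2 => hr₁' r h1 (h2.trans a1), fun i => ?_,
    fun i => if i < J then r₀ / 16 else (i : ℝ) ^ (-(β / b)), fun i => ?_, fun n => ?_, fun i d hd => ?_⟩
  · rcases le_or_gt I i with h | h
    · exact Or.inr (hI i h)
    · refine Or.inl ?_
      have hi : (i : ℝ) + 1 ≤ I + 1 := by exact_mod_cast (by omega : i + 1 ≤ I + 1)
      rw [Real.rpow_neg (by positivity), ← Real.inv_rpow (by positivity)]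
      refine Real.rpow_le_rpow (by positivity) ?_ hb.le
      rw [le_inv_comm₀ (by positivity) (by positivity), inv_div]
      calc r₀ / 16 ≤ r₀ := by linarith
        _ ≤ _ := a3
        _ ≤ _ := by gcongr
  · beta_reduce; split_ifs <;> positivity
  · have hnn : ∀ i : ℕ, 0 ≤ (if i < J then r₀ / 16 else (i : ℝ) ^ (-(β / b)) : ℝ) := fun i => by
      split_ifs <;> positivity
    refine (Finset.sum_le_sum_of_subset_of_nonneg
      (Finset.range_mono (show n ≤ J + n by omega)) fun i _ _ => hnn i).trans ?_
    rw [Finset.sum_range_add]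
    have h1 : ∑ i ∈ Finset.range J, (if i < J then r₀ / 16 else (i : ℝ) ^ (-(β / b)) : ℝ) ≤ ε / 2 := by
      rw [Finset.sum_congr rfl fun i hi => if_pos (Finset.mem_range.1 hi), Finset.sum_const,
        Finset.card_range, nsmul_eq_mul]
      rw [le_div_iff₀ (by positivity)] at a4
      nlinarith
    have h2 : ∑ i ∈ Finset.range n, (if J + i < J then r₀ / 16 else ((J + i : ℕ) : ℝ) ^ (-(β / b)) : ℝ) ≤
        ε / 2 := by
      rw [Finset.sum_congr rfl fun i _ => if_neg (show ¬J + i < J by omega)]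
      refine le_trans ?_ hJ
      simp only [add_comm J]
      exact Summable.sum_le_tsum _ (fun i _ => by positivity)
        ((summable_nat_add_iff (f := fun i : ℕ => (i : ℝ) ^ (-(β / b))) J).2 hsum)
    linarith
  · beta_reduce at hd
    split_ifs at hd with h
    · exact Or.inl (Real.rpow_le_rpow_of_nonpos (by positivity) hd.le (by linarith))
    · refine Or.inr ?_
      have hi : (0 : ℝ) < i := by exact_mod_cast (by omega : 0 < i)
      refine (Real.rpow_le_rpow_of_nonpos (by positivity) hd.le (by linarith)).trans_eq ?_
      rw [← Real.rpow_mul hi.le]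
      congr 1; field_simp

/-- The length of the reference products at the scale `r`. -/
lemma exists_length {α c : ℝ} (hc0 : 0 < c) (hc1 : c ≤ 1)
    (hc : ∀ m : ℤ, m ≠ 0 → c ≤ |(m : ℝ)| * dep (m * (2 * Real.pi * α))) {r : ℝ} (hr : 0 < r)
    (hr1 : r ≤ c ^ 2 / 32) : ∃ N : ℕ, N * (4 * r) ≤ c ∧ c ^ 2 / 32 ≤ N * r ∧
      ∀ x, dep x ≤ r → ∀ (m : ℤ) (i j : ℕ), i + 1 + j = N → |m| = j + 1 →
        c / (4 * (i + 1)) ≤ dep (x + m * (2 * Real.pi * α)) ∧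
        c / (4 * (j + 1)) ≤ dep (x + m * (2 * Real.pi * α)) ∧ r ≤ dep (x + m * (2 * Real.pi * α)) := by
  set γ := 2 * Real.pi * α with hγ
  have hcr : 1 ≤ c / (4 * r) := by rw [le_div_iff₀ (by positivity)]; nlinarith
  set Q := ⌊c / (4 * r)⌋₊ with hQ
  have hQ1 : 0 < Q := Nat.floor_pos.2 hcr
  have hQle : (Q : ℝ) ≤ c / (4 * r) := Nat.floor_le (by positivity)
  have hQlt : c / (4 * r) < Q + 1 := Nat.lt_floor_add_one _
  -- The reference length is one less than a record return time, so that a visit just beyond the far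
  -- end is closer than any before it.
  obtain ⟨k, hk0, hkQ, hk, hrec⟩ := exists_record hc hQ1
  rw [le_div_iff₀ (by positivity)] at hQle
  rw [div_lt_iff₀ (by positivity)] at hQlt
  have hkQ' : (k : ℝ) ≤ Q := by exact_mod_cast hkQ
  have hcast : ((k - 1 : ℕ) : ℝ) = k - 1 := by rw [Nat.cast_sub hk0, Nat.cast_one]
  have hnat : ∀ m : ℕ, 0 < m → c / m ≤ dep (m * γ) := by
    intro m hm
    have h1 := hc m (by exact_mod_cast hm.ne')
    rw [Int.cast_natCast, abs_of_nonneg m.cast_nonneg] at h1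
    rw [div_le_iff₀ (by exact_mod_cast hm)]; linarith
  refine ⟨k - 1, ?_, ?_, fun x hx m i j hij hm => ?_⟩
  · rw [hcast]; nlinarith
  · rw [hcast]
    have h1 := mul_le_mul_of_nonneg_right hk hr.le
    nlinarith
  · have hk' : k = i + j + 2 := by omega
    have hi : 0 < i + 1 := i.succ_pos
    have e1 : dep (m * γ) = dep ((j + 1 : ℕ) * γ) := by
      rcases abs_eq (by positivity : (0 : ℤ) ≤ j + 1) |>.1 hm with h | h
      · rw [h]; push_cast; rfl
      · rw [h]
        have : ((-((j : ℤ) + 1) : ℤ) : ℝ) * γ = -(((j + 1 : ℕ) : ℝ) * γ) := by push_cast; ring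
        rw [this, dep_neg]
    have e2 : dep (m * γ) ≤ dep (x + m * γ) + dep x := by
      have := dep_sub_le (x + m * γ) x
      rwa [add_sub_cancel_left] at this
    have h1 := hnat (j + 1) j.succ_pos
    have h2 := hnat (i + 1) i.succ_pos
    have h3 := hrec (j + 1) j.succ_pos (by omega)
    -- Since k = (i+1) + (j+1) is a record, the return at time j+1 is at least half as far as the
    -- one at time i+1. This transfers the separation estimate to the far end of the segment.
    have h4 : dep ((i + 1 : ℕ) * γ) ≤ dep (k * γ) + dep ((j + 1 : ℕ) * γ) := by
      have e : ((i + 1 : ℕ) : ℝ) * γ = k * γ - (j + 1 : ℕ) * γ := by rw [hk']; push_cast; ring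
      rw [e]; exact dep_sub_le _ _
    have rle : ∀ l : ℕ, l ≤ Q → 0 < l → r ≤ c / (4 * l) := by
      intro l hl hl0
      have hl0' : (0 : ℝ) < l := by exact_mod_cast hl0
      have hl' : (l : ℝ) ≤ Q := by exact_mod_cast hl
      rw [le_div_iff₀ (by positivity)]
      nlinarith
    have r1 := rle (i + 1) (by omega) i.succ_pos
    have r2 := rle (j + 1) (by omega) j.succ_pos
    have q : ∀ l : ℕ, 0 < l → c / (l : ℝ) = 4 * (c / (4 * l)) := by
      intro l hl
      have : (0 : ℝ) < l := by exact_mod_cast hl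
      field_simp
    rw [q _ j.succ_pos] at h1
    rw [q _ i.succ_pos] at h2
    push_cast at *
    rw [e1] at e2
    exact ⟨by linarith, by linarith, by linarith⟩

end Scales

/-! ### Existence of the frame -/

lemma eight_le_exp_three : (8 : ℝ) ≤ Real.exp 3 := by
  have h1 : (2 : ℝ) ≤ Real.exp 1 := by linarith [Real.exp_one_gt_d9]
  calc (8 : ℝ) = 2 ^ 3 := by norm_num
    _ ≤ Real.exp 1 ^ 3 := pow_le_pow_left₀ (by norm_num) h1 3
    _ = Real.exp 3 := by rw [← Real.exp_nat_mul]; norm_num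

/-- The flat factor of the construction and the cutoffs at all scales. -/
lemma exists_factor {s b : ℝ} (hs : 2 < s) (hb : b = 1 / (s / 2)) :
    ∃ C₃ L₁ : ℝ, 0 ≤ C₃ ∧ 0 ≤ L₁ ∧ ∃ f : ℝ → ℝ, ContDiff ℝ ∞ f ∧ Function.Periodic f (2 * Real.pi) ∧
      (∀ x t, jetNorm s t (jet f x) ≤ 1 / 4) ∧
      (∀ x t, 0 < dep x → InvBd s t (jet f x) (Real.exp (L₁ * dep x ^ (-b)) / 4)) ∧
      ∀ r : ℝ, 0 < r → r ≤ 1 → ∃ χ : ℝ → ℝ, ContDiff ℝ ∞ χ ∧ Function.Periodic χ (2 * Real.pi) ∧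
        (∀ x, r / 2 < dep x → χ x = 0) ∧ (∀ x, dep x ≤ r / 8 → χ x = 1) ∧
        (∀ t x, jetNorm s t (jet χ x) ≤ Real.exp (C₃ * r ^ (-b))) ∧
        ∀ x t, jetNorm s t (jet f x * jet χ x) ≤ 2 * Real.exp (-(3 * r ^ (-b))) := by
  have hσ : 0 < s / 2 := by linarith
  have hb0 : 0 < b := by rw [hb]; positivity
  obtain ⟨C, hC, hf⟩ := flat_jet_bounds (s := s) hσ (by linarith)
  -- With σ = s/2 the cutoffs have class s/2 = 1 + 1/p, which determines p and requires s > 2.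
  obtain ⟨C₃, hC₃, hχ⟩ := exists_cutoff (s := s) (p := 2 / (s - 2)) hσ
    (div_pos two_pos (by linarith)) (by rw [one_div_div]; ring)
  rw [← hb] at hf hχ
  -- Flat enough to beat the Gevrey cost C of f and the cost C₃ of a cutoff, with a surplus of 3
  -- that also absorbs numerical factors through 8 ≤ exp 3.
  set H := 2 * (C + C₃ + 3) with hH
  have hH0 : 0 < H := by positivity
  have hτ : ∀ x, 0 < dep x → 1 ≤ dep x ^ (-b) := fun x hx =>
    Real.one_le_rpow_of_pos_of_le_one_of_nonpos hx (dep_le_one x) (by linarith)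
  obtain ⟨hsm, hz⟩ := flat_contDiff hb0 hH0
  have hjz : ∀ x, dep x = 0 → jet (flat b H) x = 0 := by
    intro x hx
    ext k
    rw [coeff_jet, hz x hx k, zero_div, map_zero]
  have hle : ∀ x t, 0 < dep x → jetNorm s t (jet (flat b H) x) ≤
      2 * Real.exp (-((C₃ + 3) * dep x ^ (-b))) := by
    intro x t hx
    have e : C - H / 2 = -(C₃ + 3) := by rw [hH]; ring
    have := (hf H hH0 x hx t).1
    rwa [e, neg_mul] at this
  refine ⟨C₃, C + 2 * H + 3, hC₃, by positivity, flat b H, hsm, flat_periodic b H,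
    fun x t => ?_, fun x t hx => ?_, fun r hr hr1 => ?_⟩
  · rcases (dep_nonneg x).eq_or_lt with hx | hx
    · rw [hjz x hx.symm, jetNorm_zero]; norm_num
    · refine (hle x t hx).trans ?_
      have h1 : Real.exp (-((C₃ + 3) * dep x ^ (-b))) ≤ Real.exp (-3) :=
        Real.exp_le_exp.2 (by nlinarith [hτ x hx])
      rw [Real.exp_neg 3] at h1
      have h2 : (Real.exp 3)⁻¹ ≤ 8⁻¹ := inv_anti₀ (by norm_num) eight_le_exp_three
      linarith
  · refine (hf H hH0 x hx t).2.mono ?_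
    have hexp3 := eight_le_exp_three
    have h1 : Real.exp 3 * Real.exp ((C + 2 * H) * dep x ^ (-b)) ≤
        Real.exp ((C + 2 * H + 3) * dep x ^ (-b)) := by
      rw [← Real.exp_add]
      exact Real.exp_le_exp.2 (by nlinarith [hτ x hx])
    nlinarith [Real.exp_pos ((C + 2 * H) * dep x ^ (-b))]
  · obtain ⟨χ, h1, h2, h3, h4, h5⟩ := hχ r hr hr1
    refine ⟨χ, h1, h2, h3, h4, h5, fun x t => ?_⟩
    rcases lt_or_ge (r / 2) (dep x) with hx | hx
    · have e : χ =ᶠ[𝓝 x] fun _ => 0 := by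
        filter_upwards [(isOpen_lt continuous_const continuous_dep).mem_nhds hx] with y hy
        exact h3 y hy
      rw [jet_congr e, jet_const, map_zero, mul_zero, jetNorm_zero]
      positivity
    · rcases (dep_nonneg x).eq_or_lt with hx0 | hx0
      · rw [hjz x hx0.symm, zero_mul, jetNorm_zero]; positivity
      · refine (jetNorm_mul_le (by linarith) (hle x t hx0) (h5 t x)).trans ?_
        rw [mul_assoc, ← Real.exp_add]
        have h6 : r ^ (-b) ≤ dep x ^ (-b) :=
          Real.rpow_le_rpow_of_nonpos hx0 (by linarith) (by linarith)
        have h7 : -((C₃ + 3) * dep x ^ (-b)) + C₃ * r ^ (-b) ≤ -(3 * r ^ (-b)) := by nlinarith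
        have := Real.exp_le_exp.2 h7
        linarith

lemma sum_geometric_le {e : ℝ} (he : 0 ≤ e) (n : ℕ) :
    ∑ i ∈ Finset.range n, e * (1 / 2 : ℝ) ^ (i + 1) ≤ e := by
  have h1 : ∑ i ∈ Finset.range n, e * (1 / 2 : ℝ) ^ (i + 1) = e * (1 - (1 / 2) ^ n) := by
    induction n with
    | zero => simp
    | succ n ih => rw [Finset.sum_range_succ, ih]; ring
  rw [h1]
  have : (0 : ℝ) < (1 / 2) ^ n := by positivity
  nlinarith

/-- The cost exp(Cρ) of a cutoff, ρ being at most the reference length m, is paid by one factor exp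
C per step; what remains is the power of a ratio at most 1/2. -/
lemma exp_mul_pow_le {C ρ x e : ℝ} (hC : 0 ≤ C) (hx : 0 ≤ x) (he : e ≤ 4)
    (hθ : Real.exp C * x ≤ e / 8) {m n : ℕ} (hmn : n + 1 ≤ m) (hρ : ρ ≤ m) :
    Real.exp (C * ρ) * (2 * x ^ m) ≤ e * (1 / 2 : ℝ) ^ (n + 1 + 1) := by
  have hθ0 : 0 ≤ Real.exp C * x := by positivity
  calc Real.exp (C * ρ) * (2 * x ^ m)
      ≤ Real.exp (m * C) * (2 * x ^ m) := by
        refine mul_le_mul_of_nonneg_right (Real.exp_le_exp.2 ?_) (by positivity)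
        rw [mul_comm]; exact mul_le_mul_of_nonneg_right hρ hC
    _ = 2 * (Real.exp C * x) ^ m := by rw [Real.exp_nat_mul, mul_pow]; ring
    _ ≤ 2 * (Real.exp C * x) ^ (n + 1) := by
        have := pow_le_pow_of_le_one hθ0 (hθ.trans (by linarith)) hmn
        linarith
    _ = 2 * ((Real.exp C * x) ^ n * (Real.exp C * x)) := by rw [pow_succ]
    _ ≤ 2 * ((1 / 2) ^ n * (e / 8)) := by
        refine mul_le_mul_of_nonneg_left (mul_le_mul
          (pow_le_pow_left₀ hθ0 (hθ.trans (by linarith)) n) hθ hθ0 (by positivity)) two_pos.le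
    _ = _ := by ring

lemma tendsto_exp_neg_scale {r b : ℝ} (hr : 0 < r) (hb : 0 < b) :
    Filter.Tendsto (fun n : ℕ => 2 * Real.exp (-(3 * (r / 16 ^ n) ^ (-b)))) Filter.atTop (𝓝 0) := by
  have h1 : Filter.Tendsto (fun n : ℕ => r / 16 ^ n) Filter.atTop (𝓝[>] 0) := by
    refine tendsto_nhdsWithin_iff.2 ⟨?_, Filter.Eventually.of_forall fun n => div_pos hr (by positivity)⟩
    have := (tendsto_pow_atTop_nhds_zero_of_lt_one (by norm_num : (0 : ℝ) ≤ 1 / 16)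
      (by norm_num)).const_mul r
    rw [mul_zero] at this
    refine this.congr fun n => ?_
    rw [one_div, inv_pow, div_eq_mul_inv]
  have h2 := (tendsto_rpow_neg_nhdsGT_zero (y := -b) (by linarith)).comp h1
  have h3 := Real.tendsto_exp_neg_atTop_nhds_zero.comp (h2.const_mul_atTop (by norm_num : (0 : ℝ) < 3))
  simpa using h3.const_mul 2

set_option maxHeartbeats 600000 in
/-- The multiscale construction is possible for large `lam`. -/
theorem exists_frame {α c : ℝ} (hc0 : 0 < c) (hc1 : c ≤ 1)
    (hc : ∀ m : ℤ, m ≠ 0 → c ≤ |(m : ℝ)| * dep (m * (2 * Real.pi * α))) {s : ℝ} (hs : 2 < s)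
    {ε : ℝ} (hε : 0 < ε) : ∃ Λ : ℝ, ∀ lam : ℝ, Λ ≤ lam → ∃ F : Frame, F.s = s ∧
      F.γ = 2 * Real.pi * α ∧ F.K.lam = lam ∧ F.κ₀ = c ^ 2 / 32 ∧ 0 ≤ F.C₂ ∧
      F.C₂ + Real.log 8 ≤ Real.log lam ∧ F.C₂ ≤ ε * Real.log lam ∧
      ∃ B : ℕ → ℝ, (∀ i, 0 ≤ B i) ∧ (∀ n, ∑ i ∈ Finset.range n, B i ≤ ε) ∧
        ∀ i y, B i < dep y → F.tau y ≤ F.K.τ₀ ∨ F.tau y ≤ (i : ℝ) ^ F.K.β := by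
  obtain ⟨b, hb⟩ : ∃ b, b = 1 / (s / 2) := ⟨_, rfl⟩
  have hb0 : 0 < b := by rw [hb]; positivity
  have hb1 : b < 1 := by rw [hb, div_lt_one (by linarith)]; linarith
  obtain ⟨C₃, L₁, hC₃, hL₁, f, f1, f2, f3, f4, hχ⟩ := exists_factor hs hb
  -- Any exponent strictly between b and 1 would do.
  set β := (1 + b) / 2 with hβ
  have hbβ : b < β := by rw [hβ]; linarith
  have hβ0 : 0 < β := hb0.trans hbβ
  have hβ1 : β < 1 := by rw [hβ]; linarith
  obtain ⟨r₀, hr0, hr0c, hdeep, hcrit, B, hB0, hBE, hB⟩ := exists_radius hb0 hbβ hc0 hε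
  have hc2 : c ^ 2 / 32 ≤ 1 := by nlinarith
  set r : ℕ → ℝ := fun n => r₀ / 16 ^ n with hr
  have rpos : ∀ n, 0 < r n := fun n => by positivity
  have rle : ∀ n, r n ≤ r₀ := fun n => div_le_self hr0.le (one_le_pow₀ (by norm_num))
  have rsucc : ∀ n, r (n + 1) = r n / 16 := fun n => by
    simp only [hr]; rw [pow_succ, div_div]
  have rmono : ∀ m n, m ≤ n → r m ^ (-b) ≤ r n ^ (-b) := fun m n hmn =>
    Real.rpow_le_rpow_of_nonpos (rpos n)
      (div_le_div_of_nonneg_left hr0.le (by positivity) (pow_le_pow_right₀ (by norm_num) hmn))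
      (by linarith)
  have r1 : ∀ n, r n ≤ 1 := fun n => (rle n).trans (hr0c.trans hc2)
  choose χ χ1 χ2 χ3 χ4 χ5 χ6 using fun n => hχ (r n) (rpos n) (r1 n)
  choose N N1 N2 N3 using fun n => exists_length hc0 hc1 hc (rpos n) ((rle n).trans hr0c)
  have Ngrow : ∀ n, n + 1 ≤ N n := by
    intro n
    have h1 : r₀ ≤ N n * (r₀ / 16 ^ n) := hr0c.trans (N2 n)
    have h2 : (16 : ℝ) ^ n ≤ N n := by
      have h16 : (0 : ℝ) < 16 ^ n := by positivity
      rw [← mul_div_assoc, le_div_iff₀ h16] at h1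
      nlinarith
    have h3 : n + 1 ≤ 16 ^ n := Nat.lt_pow_self (by norm_num)
    have h4 : ((n + 1 : ℕ) : ℝ) ≤ N n := le_trans (by exact_mod_cast h3) h2
    exact_mod_cast h4
  have deep : ∀ n, r (n + 2) ^ (-b) ≤ (N n : ℝ) ^ β := by
    intro n
    have e : r (n + 2) = r n / 256 := by
      rw [rsucc, rsucc, div_div]; norm_num
    rw [e]
    refine (hdeep _ (rpos n) (rle n)).trans ?_
    refine Real.rpow_le_rpow (div_nonneg (by positivity) (rpos n).le) ?_ hβ0.le
    rw [div_le_iff₀ (rpos n)]; exact N2 n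
  set τ₀ := r 1 ^ (-b) with hτ₀
  have hτ₀' : τ₀ = (r₀ / 16) ^ (-b) := by rw [hτ₀, rsucc]; simp [hr]
  have hτ₀0 : 0 ≤ τ₀ := Real.rpow_nonneg (rpos 1).le _
  obtain ⟨C₂, Λ₀, hC₂, hK⟩ := exists_segConst (L := L₁ + 1) hβ0 hβ1 (by linarith) hτ₀0
  -- With 640 = 16B this makes slopes of size e₀ harmless for pivots of depth at most τ₀.
  set e₀ := Real.exp (-(L₁ * τ₀)) / 640 with he₀
  have he₀0 : 0 < e₀ := by positivity
  have he₀1 : e₀ ≤ 1 / 4 := by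
    have : Real.exp (-(L₁ * τ₀)) ≤ 1 := Real.exp_le_one_iff.2 (by nlinarith)
    rw [he₀]; linarith
  -- In order, λ must serve the segment constants, the comparison at deep visits, the later
  -- increments of the slopes, the first increment, the collapse estimate, and C₂ ≤ ε log λ. All
  -- thresholds depend only on data fixed before λ.
  obtain ⟨Λ, hΛ⟩ := Filter.eventually_atTop.1 ((Filter.eventually_ge_atTop Λ₀).and
    ((Filter.eventually_ge_atTop (1920 * Real.exp (L₁ + C₃))).and
    ((Filter.eventually_ge_atTop (8 * Real.exp C₃ / e₀)).and
    ((Filter.eventually_ge_atTop (2 * Real.exp (C₃ * r 0 ^ (-b)) / e₀)).and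
    ((Filter.eventually_ge_atTop (8 * Real.exp C₂)).and
    (Filter.eventually_ge_atTop (Real.exp (C₂ / ε))))))))
  refine ⟨Λ, fun lam hlam => ?_⟩
  obtain ⟨l1, l2, l3, l4, l5, l6⟩ := hΛ lam hlam
  obtain ⟨K, rfl, KB, Kτ, Kβ, KL, KΦ⟩ := hK lam l1
  have hl0 : 0 < K.lam := SegData.lam_pos
  rw [div_le_iff₀ he₀0] at l3 l4
  have hθ : Real.exp C₃ * K.lam⁻¹ ≤ e₀ / 8 := by
    rw [← div_eq_mul_inv, div_le_iff₀ hl0]; linarith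
  have hinv : K.lam⁻¹ ≤ e₀ := by
    have : 1 ≤ Real.exp C₃ := Real.one_le_exp hC₃
    have h0 : 0 < K.lam⁻¹ := inv_pos.2 hl0
    nlinarith
  have hηsucc : ∀ n, Real.exp (C₃ * r (n + 1) ^ (-b)) * (2 * K.lam⁻¹ ^ min (N n) (N (n + 1))) ≤
      e₀ * (1 / 2 : ℝ) ^ (n + 1 + 1) := by
    intro n
    refine exp_mul_pow_le hC₃ (inv_pos.2 hl0).le (by linarith) hθ
      (le_min (Ngrow n) ((Nat.le_succ _).trans (Ngrow (n + 1)))) ?_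
    rcases min_choice (N n) (N (n + 1)) with h | h
    · rw [h]
      exact (rmono _ _ (by omega)).trans (le_of_le_rpow hβ0 hβ1 (deep n))
    · rw [h]
      exact (rmono _ _ (by omega)).trans (le_of_le_rpow hβ0 hβ1 (deep (n + 1)))
  have g1 : C₂ + Real.log 8 ≤ Real.log K.lam := by
    have := Real.log_le_log (by positivity) l5
    rw [Real.log_mul (by norm_num) (Real.exp_pos _).ne', Real.log_exp] at this
    linarith
  have g2 : C₂ ≤ ε * Real.log K.lam := by
    have := Real.log_le_log (Real.exp_pos _) l6
    rw [Real.log_exp, div_le_iff₀ hε] at this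
    linarith
  refine ⟨{
      K := K, s := s, γ := 2 * Real.pi * α, b := b, c := c, L₁ := L₁, C₃ := C₃, e₀ := e₀, f := f,
      r := r, χ := χ, N := N, η := fun n => e₀ * (1 / 2 : ℝ) ^ (n + 1), one_le_s := by linarith,
      b_pos := hb0, c_pos := hc0, sep := hc, f_smooth := f1, f_periodic := f2, f_le := f3, f_inv := f4,
      B_eq := KB, r_pos := rpos, r_succ := rsucc, τ₀_eq := Kτ
      good_crit := fun i => by rw [Kτ, hτ₀', Kβ]; exact hcrit i
      χ_smooth := χ1, χ_periodic := χ2, χ_off := χ3, χ_on := χ4, χ_le := χ5, C₃_nonneg := hC₃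
      ref := N3
      deep := fun n => by rw [Kβ]; exact deep n
      hL := fun τ hτ => ?_
      hdeep := fun k τ hτ hτk => ?_
      inv_lam_le := hinv, e₀_le := he₀1
      hshallow := fun τ _ hττ => ?_
      η_zero := ?_
      η_succ := hηsucc, η_sum := sum_geometric_le he₀0.le, C₂ := C₂, Φ_le := KΦ, N_le := N1, κ₀ := c ^ 2 / 32
      le_N := N2
      κ₀_pos := by positivity
      ζ := fun n => 2 * Real.exp (-(3 * r n ^ (-b)))
      ζ_le := fun n => ?_
      ζ_tendsto := tendsto_exp_neg_scale hr0 hb0, f_mul_χ_le := χ6 }, rfl, rfl, rfl, rfl, hC₂, g1, g2, B, hB0, hBE, fun i y hy => ?_⟩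
  · rw [KL]
    have h1 : (2 : ℝ) ≤ Real.exp τ := by linarith [Real.add_one_le_exp τ]
    have e : (L₁ + 1) * τ = τ + L₁ * τ := by ring
    rw [e, Real.exp_add]
    exact mul_le_mul_of_nonneg_right h1 (Real.exp_pos _).le
  · rw [Kβ] at hτk
    have hτk' := le_of_le_rpow hβ0 hβ1 hτk
    have hk1 : 1 ≤ k := by
      have : (1 : ℝ) ≤ k := hτ.trans hτk'
      exact_mod_cast this
    rw [KB, ← Real.exp_add]
    calc 48 * 40 * Real.exp (L₁ * τ + C₃ * τ) ≤ 1920 ^ k * Real.exp (L₁ + C₃) ^ k := by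
          rw [← Real.exp_nat_mul]
          refine mul_le_mul ?_ (Real.exp_le_exp.2 (by nlinarith)) (Real.exp_pos _).le (by positivity)
          have := pow_le_pow_right₀ (by norm_num : (1 : ℝ) ≤ 1920) hk1
          linarith
      _ ≤ K.lam ^ k := by
          rw [← mul_pow]
          exact pow_le_pow_left₀ (by positivity) l2 k
  · rw [KB, he₀]
    rw [Kτ] at hττ
    have h1 : Real.exp (-(L₁ * τ₀)) * Real.exp (L₁ * τ) ≤ 1 := by
      rw [← Real.exp_add]
      exact Real.exp_le_one_iff.2 (by nlinarith)
    linarith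
  · simp only [zero_add, pow_one]
    rw [← div_eq_mul_inv, div_le_iff₀ hl0]
    linarith
  · have h1 : 1 ≤ r n ^ (-b) :=
      Real.one_le_rpow_of_pos_of_le_one_of_nonpos (rpos n) (r1 n) (by linarith)
    have h2 : Real.exp (-(3 * r n ^ (-b))) ≤ Real.exp (-3) := Real.exp_le_exp.2 (by linarith)
    rw [Real.exp_neg 3] at h2
    have h5 : (Real.exp 3)⁻¹ ≤ 8⁻¹ := inv_anti₀ (by norm_num) eight_le_exp_three
    linarith
  · have := hB i (dep y) hy
    simp only [Frame.tau]
    rw [Kτ, hτ₀', Kβ]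
    exact this

/-- An open set of the inductive limit contains a ball of the step in which the sequence converges,
so convergence in one step already tests continuity. -/
lemma not_continuousAt_lyapunov {α s : ℝ} {D : GevreyCocycle s} {A : ℕ → GevreyCocycle s} {K a b : ℝ}
    (hK : 0 < K) (hD : D.InStep K) (hA : ∀ n, (A n).InStep K)
    (hAD : Filter.Tendsto (fun n => gevreyDist K (A n) D) Filter.atTop (𝓝 0)) (hab : a < b)
    (hb : b ≤ lyapunov α D) (ha : ∀ n, lyapunov α (A n) ≤ a) :
    ¬ ContinuousAt (fun B : GevreyCocycle s => lyapunov α B) D := by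
  intro hc
  obtain ⟨U, hUs, hU, hDU⟩ := mem_nhds_iff.1 (hc.preimage_mem_nhds (Ioi_mem_nhds (hab.trans_le hb)))
  obtain ⟨r, hr, h⟩ := hU K hK D hDU hD
  obtain ⟨n, hn⟩ := (hAD.eventually_lt_const hr).exists
  exact absurd (hUs (h (A n) (hA n) hn)) (not_lt.2 (ha n))

lemma le_exp_rpow_self {q x : ℝ} (hq : 1 ≤ q) (hx : x ≤ q) : x ≤ Real.exp (q ^ q) := by
  have h1 : q ≤ q ^ q := by
    calc q = q ^ (1 : ℝ) := (Real.rpow_one q).symm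
      _ ≤ q ^ q := Real.rpow_le_rpow_of_exponent_le hq hq
  linarith [Real.add_one_le_exp (q ^ q)]

end GevreyLE

/-! ### The theorem -/

theorem theorem1p2 (α : ℝ) (hα : GevreyLE.IsBoundedType α) (s : ℝ) (hs : 2 < s) :
    ∃ M₀ : ℝ, ∀ M : ℝ, M₀ ≤ M → ∃ N₀ : ℕ, ∀ N : ℕ, N₀ ≤ N →
      ∀ ε δ lam : ℝ, ε = 1 / M ^ 100 → δ = 1 / (4 * M ^ 20) →
        lam = Real.exp (GevreyLE.convDen α N ^ GevreyLE.convDen α N) →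
      ∃ (D : GevreyLE.GevreyCocycle s) (A : ℕ → GevreyLE.GevreyCocycle s),
        ¬ ContinuousAt (fun B : GevreyLE.GevreyCocycle s => GevreyLE.lyapunov α B) D ∧
        (1 - 4 * ε) * Real.log lam ≤ GevreyLE.lyapunov α D ∧
        (∃ K : ℝ, 0 < K ∧
          Filter.Tendsto (fun n => GevreyLE.gevreyDist K (A n) D) Filter.atTop (nhds 0)) ∧
        (∀ n : ℕ, GevreyLE.lyapunov α (A n) ≤ (1 - δ) * Real.log lam) ∧
        GevreyLE.HasDiagRotForm lam D ∧
        (∀ n : ℕ, GevreyLE.HasDiagRotForm lam (A n)) := by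
  obtain ⟨c, hc0, hc1, hc⟩ := hα.exists_separation
  -- The second bound gives δ ≤ κ₀/1000 with κ₀ = c²/32; the first gives 4ε < δ, since M^80 > 16.
  refine ⟨max 2 (32000 / c ^ 2), fun M hM => ?_⟩
  have hM2 : 2 ≤ M := (le_max_left _ _).trans hM
  have hMc : 32000 / c ^ 2 ≤ M := (le_max_right _ _).trans hM
  have hM0 : 0 < M := by linarith
  obtain ⟨Λ, hΛ⟩ := GevreyLE.exists_frame hc0 hc1 hc hs (show 0 < 1 / M ^ 100 by positivity)
  refine ⟨max 5 ⌈Λ⌉₊, fun N hN ε δ lam hε hδ hlam => ?_⟩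
  have hq := GevreyLE.natCast_le_convDen hα.1 ((le_max_left _ _).trans hN)
  have hN5 : (5 : ℝ) ≤ N := by exact_mod_cast (le_max_left _ _).trans hN
  have hΛN : Λ ≤ N := (Nat.le_ceil Λ).trans (by exact_mod_cast (le_max_right _ _).trans hN)
  rw [← hε] at hΛ
  have hε0 : 0 < ε := by rw [hε]; positivity
  have hδ0 : 0 < δ := by rw [hδ]; positivity
  have hδc : δ ≤ c ^ 2 / 32 / 1000 := by
    rw [div_le_iff₀ (by positivity)] at hMc
    have h1 : M ≤ M ^ 20 := le_self_pow₀ (by linarith) (by norm_num)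
    rw [hδ, div_le_iff₀ (by positivity)]
    nlinarith [sq_nonneg c]
  have hεδ : 4 * ε < δ := by
    have h1 : (2 : ℝ) ^ 80 ≤ M ^ 80 := pow_le_pow_left₀ (by norm_num) hM2 80
    have h2 : (0 : ℝ) < M ^ 20 := by positivity
    have h3 : M ^ 100 = M ^ 20 * M ^ 80 := by ring
    rw [hε, hδ, mul_one_div, div_lt_div_iff₀ (by positivity) (by positivity), h3]
    nlinarith
  obtain ⟨F, rfl, hγ, rfl, hκ, hC₂, hlog8, hCε, B, hB0, hBE, hB⟩ := hΛ lam
    (hlam ▸ GevreyLE.le_exp_rpow_self (by linarith) (hΛN.trans hq))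
  have hlog : 0 < Real.log F.K.lam := by linarith [Real.log_pos (show (1 : ℝ) < 8 by norm_num)]
  obtain ⟨v, w, h⟩ := F.exists_limit
  have hlow := h.le_lyapunov hγ (by linarith [Real.log_pos (show (1 : ℝ) < 8 by norm_num)])
    hB0 hB hBE
  have hup := GevreyLE.Frame.lyapunov_cut_le hγ hC₂ hlog8
  -- One ε pays for C₂ and two for the exceptional points.
  have hlow' : (1 - 4 * ε) * Real.log F.K.lam ≤ (Real.log F.K.lam - F.C₂) * (1 - 2 * ε) := by
    have h1 : ε ≤ 1 / 4 := by
      have : δ ≤ 1 := hδc.trans (by nlinarith)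
      linarith
    nlinarith [mul_nonneg hC₂ hε0.le]
  have hup' : ∀ n, GevreyLE.lyapunov α ((F.cut_rotFun n).cocycle F.one_le_s F.one_le_lam) ≤
      (1 - δ) * Real.log F.K.lam := fun n => (hup n).trans (by rw [hκ]; gcongr)
  have hform := (h.adm.rotFun h.periodic.1 h.periodic.2).hasDiagRotForm F.one_le_s F.one_le_lam
  have hforms := fun n => (F.cut_rotFun n).hasDiagRotForm F.one_le_s F.one_le_lam
  refine ⟨_, _, ?_, hlow'.trans hlow, ⟨4, by norm_num, h.tendsto_dist⟩, hup', hform, hforms⟩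
  refine GevreyLE.not_continuousAt_lyapunov (K := 4) (by norm_num) (GevreyLE.RotFun.inStep _ _ _)
    (fun n => GevreyLE.RotFun.inStep _ _ _) h.tendsto_dist ?_ (hlow'.trans hlow) hup'
  exact mul_lt_mul_of_pos_right (by linarith) hlog
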